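/- Let $\mathcal S,\mathcal A$ be finite sets with $S$ and $A$ elements, and let $\mathcal M(\theta)=(\mathcal S,\mathcal A,P_\theta,r,\nu)$, $\theta\in\varTheta$, be Markov decision processes with transition kernels $P_\theta(s'|s,a)$ (measurable in $\theta$) and with known rewards $r:\mathcal S\times\mathcal A\to[0,1]$ and known initial distribution $\nu$. For $\gamma\in(0,1)$ let $V^*_\gamma(s;\theta)$ be the optimal total discounted reward from $s$, and, with a fixed reference state $\hat s$, let $$\bar r^*(\theta)=\lim_{\gamma\uparrow1}(1-\gamma)V^*_\gamma(\hat s;\theta),\qquad v(s;\theta)=\lim_{\gamma\uparrow1}\bigl[V^*_\gamma(s;\theta)-V^*_\gamma(\hat s;\theta)\bigr],\qquad q(s,a;\theta)=r(s,a)+\sum_{s'}P_\theta(s'|s,a)v(s';\theta).$$ Assume that every $\mathcal M(\theta)$ is communicating (every state can be reached with positive probability from every state under some stationary Markov policy), and that $\max_s v(s;\theta)-\min_s v(s;\theta)\le\bar v$ for all $\theta\in\varTheta$. The true parameter $\theta^*$ has distribution $\mu_0$ on $\varTheta$. Given $\theta^*$, an offline dataset $\mathcal D_0=(\bar s_0,\bar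 a_0,\dots,\bar a_{N-1},\bar s_N)$ is generated in $\mathcal M(\theta^*)$ from a fixed state $\bar s_0$ by the expert policy $\pi^\beta(a|s)=e^{\beta q(s,a;\theta^*)}/\sum_{a'}e^{\beta q(s,a';\theta^*)}$, where $\beta>0$ is known. Let $\mathtt{MDPSolve}$ be a deterministic measurable map which assigns to each $\theta$ a policy $\pi:\mathcal S\to\mathcal A$ with $\pi(s)\in\arg\max_a q(s,a;\theta)$ for all $s$. Let $T_1,T_2,\dots$ be fixed positive integers (the episode lengths), and let $t_k=\sum_{l=1}^{k-1}T_l$. The algorithm inf-iPSRL interacts with $\mathcal M(\theta^*)$ as follows: $s_0\sim\nu$; $\mu_1$ is the posterior of $\theta^*$ given $\mathcal D_0$; at the start $t_k$ of episode $k$ it samples $\tilde\theta^k\sim\mu_k$ and sets $\tilde\pi^k=\mathtt{MDPSolve}(\tilde\theta^k)$; it plays $a_t=\tilde\pi^k(s_t)$ for $t_k\le t<t_{k+1}$; and it then obtains $\mu_{k+1}$ from $\mu_k$ by Bayes' rule with the likelihood $\prod_{t=t_k}^{t_{k+1}-1}P_\theta(s_{t+1}|s_t,a_t)$. Let $T\ge1$,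 let $K_T=\max\{k:\sum_{l=1}^{k-1}T_l<T\}$, and let $\varepsilon=\Pr(\tilde\pi^1\ne\pi^*)$, where $\pi^*=\mathtt{MDPSolve}(\theta^*)$. Then the Bayesian regret $\mathfrak{BR}_T=\mathbb E\bigl[T\bar r^*(\theta^*)-\sum_{t=0}^{T-1}r(s_t,a_t)\bigr]$ of inf-iPSRL (is well defined and) satisfies $$\mathfrak{BR}_T\le 3\bar v+2\bar v(R_1+R_2+R_3),$$ where $$R_1=\varepsilon K_T,\qquad R_2=\sqrt{\varepsilon S^2AT\log(2SAK_TT)\Bigl[1+\log\Bigl(\frac T{SA}+1\Bigr)\Bigr]},\qquad R_3=\min\Bigl\{\varepsilon T,\;SA\Bigl(\max_{1\le k\le K_T}T_k\Bigr)\log_2\Bigl(\frac T{SA}+1\Bigr)\Bigr\}.$$ -/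

import Mathlib

open MeasureTheory Filter Topology

noncomputable section

namespace InfPSRL

/-- A trajectory `(s₀, a₀, …, s_{t-1}, a_{t-1}, s_t)`: the first `t` state-action pairs, and the
current state. -/
abbrev History (S A : Type*) (t : ℕ) : Type _ := (Fin t → S × A) × S

/-- The state `s_i` of a trajectory (for `i ≤ t`). -/
def History.state {S A : Type*} {t : ℕ} (x : History S A t) (i : ℕ) : S :=
  if h : i < t then (x.1 ⟨i, h⟩).1 else x.2

/-- The trajectory extended by the action `a` and the next state `s'`. -/
def History.extend {S A : Type*} {t : ℕ} (x : History S A t) (a : A) (s' : S) :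
    History S A (t + 1) :=
  (Fin.snoc (α := fun _ => S × A) x.1 (x.2, a), s')

/-- General (history-dependent, randomized) policies. -/
abbrev Policy (S A : Type*) : Type _ := (t : ℕ) → History S A t → PMF A

/-- A randomized stationary Markov policy, as a general policy. -/
def stationary {S A : Type*} (π : S → PMF A) : Policy S A := fun _ x => π x.2

/-- Law of the trajectory up to time `t` under the transition kernel `P` and the policy `π`,
started at the state `s`. -/
def histLaw {S A : Type*} (P : S → A → PMF S) (π : Policy S A) (s : S) :
    (t : ℕ) → PMF (History S A t)
  | 0 => PMF.pure (Fin.elim0, s)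
  | t + 1 => (histLaw P π s t).bind fun x => (π t x).bind fun a =>
      (P x.2 a).map fun s' => x.extend a s'

/-- A controlled Markov chain is communicating if for any pair of states `s, s'` there are a
stationary Markov policy and a `k` such that `s_k = s'` has positive probability given `s₀ = s`. -/
def Communicating {S A : Type*} (P : S → A → PMF S) : Prop :=
  ∀ s s' : S, ∃ (π : S → PMF A) (k : ℕ),
    0 < ((histLaw P (stationary π) s k).map Prod.snd) s'

/-- The softmax weight `exp(β q(s, a)) / ∑_{a'} exp(β q(s, a'))`. -/
def softmax {S A : Type*} [Fintype A] (q : S → A → ℝ) (β : ℝ) (s : S) (a : A) : ℝ :=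
  Real.exp (β * q s a) / ∑ a', Real.exp (β * q s a')

lemma sum_softmax {S A : Type*} [Fintype A] [Nonempty A] (q : S → A → ℝ) (β : ℝ) (s : S) :
    ∑ a, ENNReal.ofReal (softmax q β s a) = 1 := by
  have hpos : 0 < ∑ a' : A, Real.exp (β * q s a') :=
    Finset.sum_pos (fun _ _ => Real.exp_pos _) Finset.univ_nonempty
  unfold softmax
  rw [← ENNReal.ofReal_sum_of_nonneg
    (fun a _ => div_nonneg (Real.exp_pos _).le hpos.le)]
  rw [← Finset.sum_div, div_self hpos.ne', ENNReal.ofReal_one]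

section MDP

variable {S A : Type*} [Fintype S] [Fintype A]

/-- `E^π[r(s_t, a_t) | s₀ = s]`. -/
def expReward (P : S → A → PMF S) (r : S → A → ℝ) (π : Policy S A) (s : S) (t : ℕ) : ℝ :=
  ∑ x : History S A t, (histLaw P π s t x).toReal * ∑ a, (π t x a).toReal * r x.2 a

/-- `E^π[∑_t γ^t r(s_t, a_t) | s₀ = s]`. -/
def discountedReward (P : S → A → PMF S) (r : S → A → ℝ) (γ : ℝ) (π : Policy S A) (s : S) : ℝ :=
  ∑' t : ℕ, γ ^ t * expReward P r π s t

/-- Optimal total discounted reward `V_γ^*(s)`. -/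
def optDiscounted (P : S → A → PMF S) (r : S → A → ℝ) (γ : ℝ) (s : S) : ℝ :=
  ⨆ π : Policy S A, discountedReward P r γ π s

/-- Optimal average reward `r̄^* = lim_{γ → 1} (1 - γ) V_γ^*(ŝ)`, with `ŝ` the reference state. -/
def optGain (P : S → A → PMF S) (r : S → A → ℝ) (sref : S) : ℝ :=
  limUnder (𝓝[<] (1 : ℝ)) fun γ => (1 - γ) * optDiscounted P r γ sref

/-- Relative state value function `v(s) = lim_{γ → 1} [V_γ^*(s) - V_γ^*(ŝ)]`. -/
def relValue (P : S → A → PMF S) (r : S → A → ℝ) (sref : S) (s : S) : ℝ :=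
  limUnder (𝓝[<] (1 : ℝ)) fun γ => optDiscounted P r γ s - optDiscounted P r γ sref

/-- Relative state-action value function `q(s, a) = r(s, a) + ∑_{s'} P(s' | s, a) v(s')`. -/
def relQ (P : S → A → PMF S) (r : S → A → ℝ) (sref : S) (s : S) (a : A) : ℝ :=
  r s a + ∑ s', (P s a s').toReal * relValue P r sref s'

/-- The expert's policy `π^β(· | s)`. -/
def expertPolicy [Nonempty A] (q : S → A → ℝ) (β : ℝ) (s : S) : PMF A :=
  PMF.ofFintype (fun a => ENNReal.ofReal (softmax q β s a)) (sum_softmax q β s)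

end MDP

/-- A family of environments `M(θ)`, `θ ∈ Θ`, with states `S`, actions `A`, an unknown transition
kernel indexed (measurably) by `θ`, and known rewards and initial distribution. -/
structure Model (S A Θ : Type*) [MeasurableSpace Θ] where
  /-- `trans θ s a` is the distribution of the next state. -/
  trans : Θ → S → A → PMF S
  measurable_trans : ∀ s a s', Measurable fun θ => trans θ s a s'
  /-- instantaneous reward -/
  reward : S → A → ℝ
  reward_nonneg : ∀ s a, 0 ≤ reward s a
  reward_le_one : ∀ s a, reward s a ≤ 1
  /-- distribution of the initial state of the learning agent -/
  init : PMF S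

section Bayes

variable {Θ : Type*} [MeasurableSpace Θ]

open Classical in
/-- Bayes' rule: the probability measure proportional to `B ↦ ∫_B L dμ`. (If `∫ L dμ = 0`, that is,
if the observation has probability zero, the measure is left unchanged.) -/
def bayesUpdate (μ : Measure Θ) (L : Θ → ENNReal) : Measure Θ :=
  if ∫⁻ θ, L θ ∂μ = 0 ∨ ∫⁻ θ, L θ ∂μ = ⊤ then μ else (∫⁻ θ, L θ ∂μ)⁻¹ • μ.withDensity L

instance (μ : Measure Θ) [IsProbabilityMeasure μ] (L : Θ → ENNReal) :
    IsProbabilityMeasure (bayesUpdate μ L) := by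
  unfold bayesUpdate
  split_ifs with h
  · infer_instance
  · push Not at h
    constructor
    rw [Measure.smul_apply, withDensity_apply _ MeasurableSet.univ, Measure.restrict_univ,
      smul_eq_mul, ENNReal.inv_mul_cancel h.1 h.2]

end Bayes

/-- Start time `t_k = ∑_{l=1}^{k-1} T_l` of the `k`-th episode (`k ≥ 1`). -/
def startTime (ep : ℕ → ℕ) (k : ℕ) : ℕ := ∑ l ∈ Finset.Ico 1 k, ep l

/-- `K_T = max {k : ∑_{l=1}^{k-1} T_l < T}`. -/
def numEpisodes (ep : ℕ → ℕ) (T : ℕ) : ℕ := sSup {k | startTime ep k < T}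

/-- The index of the episode which contains the time `t`, i.e. `max {k : t_k ≤ t}`. -/
def episodeAt (ep : ℕ → ℕ) (t : ℕ) : ℕ := numEpisodes ep (t + 1)

section Algorithm

variable {S A Θ : Type*} [Fintype S] [Fintype A] [MeasurableSpace Θ]

namespace Model

variable (M : Model S A Θ)

/-- `r̄^*(θ)` -/
def gain (sref : S) (θ : Θ) : ℝ := optGain (M.trans θ) M.reward sref

/-- `v(s; θ)` -/
def value (sref : S) (θ : Θ) (s : S) : ℝ := relValue (M.trans θ) M.reward sref s

/-- `q(s, a; θ)` -/
def q (sref : S) (θ : Θ) (s : S) (a : A) : ℝ := relQ (M.trans θ) M.reward sref s a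

/-- The law, under `θ`, of the offline dataset `(s̄₀, ā₀, …, ā_{N-1}, s̄_N)`, which the expert's
policy generates from the fixed initial state `s̄₀ = sbar`. -/
def offlineLaw [Nonempty A] (sref : S) (β : ℝ) (sbar : S) (N : ℕ) (θ : Θ) :
    PMF (History S A N) :=
  histLaw (M.trans θ) (stationary (expertPolicy (M.q sref θ) β)) sbar N

/-- Likelihood of the offline dataset:
`∏_{t<N} θ(s̄_{t+1} | s̄_t, ā_t) exp(β q(s̄_t, ā_t; θ)) / ∑_{a'} exp(β q(s̄_t, a'; θ))`. -/
def offlineLik (sref : S) (β : ℝ) {N : ℕ} (D : History S A N) (θ : Θ) : ENNReal :=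
  ∏ i : Fin N, M.trans θ (D.1 i).1 (D.1 i).2 (D.state ((i : ℕ) + 1)) *
    ENNReal.ofReal (softmax (M.q sref θ) β (D.1 i).1 (D.1 i).2)

/-- Likelihood of the transitions of the online trajectory during episode `k`:
`∏_{t_k ≤ t < t_{k+1}} θ(s_{t+1} | s_t, a_t)`. -/
def episodeLik (ep : ℕ → ℕ) {t : ℕ} (x : History S A t) (k : ℕ) (θ : Θ) : ENNReal :=
  ∏ i ∈ (Finset.univ : Finset (Fin t)).filter
      (fun i : Fin t => startTime ep k ≤ (i : ℕ) ∧ (i : ℕ) < startTime ep (k + 1)),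
    M.trans θ (x.1 i).1 (x.1 i).2 (x.state ((i : ℕ) + 1))

/-- The posteriors: `μ₀` is the prior, `μ₁` is the posterior given the offline dataset `D`, and
`μ_{k+1}` is obtained from `μ_k` through the transitions of episode `k` of the online trajectory. -/
def posterior (μ₀ : Measure Θ) (sref : S) (β : ℝ) (ep : ℕ → ℕ) {N : ℕ} (D : History S A N)
    {t : ℕ} (x : History S A t) : ℕ → Measure Θ
  | 0 => μ₀
  | 1 => bayesUpdate μ₀ (M.offlineLik sref β D)
  | k + 2 => bayesUpdate (posterior μ₀ sref β ep D x (k + 1)) (M.episodeLik ep x (k + 1))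

instance (μ₀ : Measure Θ) [IsProbabilityMeasure μ₀] (sref : S) (β : ℝ) (ep : ℕ → ℕ) {N : ℕ}
    (D : History S A N) {t : ℕ} (x : History S A t) (k : ℕ) :
    IsProbabilityMeasure (M.posterior μ₀ sref β ep D x k) := by
  induction k with
  | zero => unfold posterior; infer_instance
  | succ k ih => cases k <;> (unfold posterior; infer_instance)

end Model

/-- A planning oracle: a deterministic (measurable) map from parameters to deterministic stationary
Markov policies which are greedy with respect to `q(·, ·; θ)`. -/
structure PlanningOracle (M : Model S A Θ) (sref : S) where
  solve : Θ → S → A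
  measurableSet_fiber : ∀ π : S → A, MeasurableSet (solve ⁻¹' {π})
  greedy : ∀ θ s a, M.q sref θ s a ≤ M.q sref θ s (solve θ s)

variable [DecidableEq S] {M : Model S A Θ} {sref : S}

/-- The law of the policy `π̃ = MDPSolve(θ̃)` when `θ̃` is sampled from `μ`. -/
def PlanningOracle.sampledPolicy (O : PlanningOracle M sref) (μ : Measure Θ)
    [IsProbabilityMeasure μ] : PMF (S → A) :=
  PMF.ofFintype (fun π => μ (O.solve ⁻¹' {π})) <| by
    rw [sum_measure_preimage_singleton _ fun π _ => O.measurableSet_fiber π]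
    simp

/-- The law of the run of the inf-iPSRL algorithm in the environment `M(θ)`, given the offline
dataset `D`: the online trajectory up to time `t`, together with the policy which the algorithm
applies at time `t`. At the start of each episode `k` this policy is `MDPSolve(θ̃^k)` for a
`θ̃^k` newly sampled from `μ_k`; it is kept until the end of the episode. -/
def runLaw (O : PlanningOracle M sref) (μ₀ : Measure Θ) [IsProbabilityMeasure μ₀] (β : ℝ)
    (ep : ℕ → ℕ) {N : ℕ} (D : History S A N) (θ : Θ) :
    (t : ℕ) → PMF (History S A t × (S → A))
  | 0 => M.init.bind fun s =>
      (O.sampledPolicy (M.posterior μ₀ sref β ep D ((Fin.elim0, s) : History S A 0) 1)).map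
        fun π => ((Fin.elim0, s), π)
  | t + 1 => (runLaw O μ₀ β ep D θ t).bind fun y =>
      (M.trans θ y.1.2 (y.2 y.1.2)).bind fun s' =>
        let x' := y.1.extend (y.2 y.1.2) s'
        if startTime ep (episodeAt ep (t + 1)) = t + 1 then
          (O.sampledPolicy (M.posterior μ₀ sref β ep D x' (episodeAt ep (t + 1)))).map
            fun π => (x', π)
        else PMF.pure (x', y.2)

variable [Nonempty A]

/-- Regret of inf-iPSRL in the environment `M(θ)`:
`T r̄^*(θ) - E_θ[∑_{t<T} r(s_t, a_t)]`; the expectation is over the offline dataset and the run. -/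
def regret (O : PlanningOracle M sref) (μ₀ : Measure Θ) [IsProbabilityMeasure μ₀] (β : ℝ)
    (sbar : S) (N : ℕ) (ep : ℕ → ℕ) (T : ℕ) (θ : Θ) : ℝ :=
  T * M.gain sref θ - ∑ D : History S A N, (M.offlineLaw sref β sbar N θ D).toReal *
    ∑ t ∈ Finset.range T, ∑ y : History S A t × (S → A),
      (runLaw O μ₀ β ep D θ t y).toReal * M.reward y.1.2 (y.2 y.1.2)

/-- Bayesian regret of inf-iPSRL: the mean of the regret over `θ^* ∼ μ₀`. -/
def bayesRegret (O : PlanningOracle M sref) (μ₀ : Measure Θ) [IsProbabilityMeasure μ₀] (β : ℝ)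
    (sbar : S) (N : ℕ) (ep : ℕ → ℕ) (T : ℕ) : ℝ :=
  ∫ θ, regret O μ₀ β sbar N ep T θ ∂μ₀

/-- The initial mismatch probability `ε = Pr(π̃¹ ≠ π^*)`, where `θ^* ∼ μ₀`, the offline dataset is
generated under `θ^*`, `π^* = MDPSolve(θ^*)`, and `π̃¹ = MDPSolve(θ̃¹)` with `θ̃¹ ∼ μ₁`. -/
def initialMismatch (O : PlanningOracle M sref) (μ₀ : Measure Θ) [IsProbabilityMeasure μ₀] (β : ℝ)
    (sbar : S) (N : ℕ) : ℝ :=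
  ∫ θ, ∑ D : History S A N, (M.offlineLaw sref β sbar N θ D).toReal *
    (bayesUpdate μ₀ (M.offlineLik sref β D)).real {θ' | O.solve θ' ≠ O.solve θ} ∂μ₀

end Algorithm

end InfPSRL

end

/-! Call r̄(θ) + v(s;θ) − q(s,a;θ) the gap of the action a at s. For each γ the discounted value is
a maximum of finitely many functions rational in γ, so it is rational near γ = 1; in a communicating
process the differences of values also stay bounded. Hence the limits defining r̄ and v exist, and
passing to the limit in the Bellman equation shows that greedy actions have gap 0
(`relQ_eq_of_forall_le`). Telescoping v(·;θ^*) along the run bounds the regret by v̄ plus the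
expected sum of gaps (`regret_le`).

Only episodes with π̃^k ≠ π^* have gaps. In such an episode of n steps they amount to at most n
r̄(θ^*) minus the reward plus v̄. Given the observations at the start of the episode, θ^* and θ̃^k
are independent with law the posterior (`exists_jointExpect_eq`), and the mismatch event is
symmetric in them; so r̄(θ^*) may be exchanged for r̄(θ̃^k). The Bellman equation of θ̃^k then
leaves a second v̄ and the model errors (P_θ̃ − P_θ^*)v(·;θ̃) (`gain_sub_rewardSum_le`). If the
observed frequencies are typical for both parameters, each error is at most v̄ times a bonus
√(2SL/n), with n the visit count at the start of the episode. Atypicality has probability at most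
1/T for θ^* (`expect_not_consistent_le`), and by exchangeability for θ̃^k.

The mismatch probability never exceeds ε: it equals 1 − E Σ_π p_k(π)², where p_k is the conditional
law of π^*, a martingale in k, so convexity makes it nonincreasing
(`jointExpect_mismatch_start_le`).

The bonuses count only during mismatches (`sum_jointExpect_mismatch_mul_bonus_le`). Cauchy–Schwarz
against the mismatch indicator puts ε under the root and leaves a harmonic sum of inverse counts.
Counts frozen at the start of an episode lag behind the current ones; the times at which a count has
more than doubled are charged to R₃ instead. In total, 3v̄ is v̄ from the telescoping and 2v̄ from
atypical data, 2v̄εK_T comes from two spans per mismatched episode, and the bonuses give v̄(R₃ +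
2R₂). -/

open MeasureTheory Filter Topology

noncomputable section

namespace InfPSRL

/-! ### Expectations with respect to probability mass functions on finite types -/

/-- Expectation of a real function under a probability mass function on a finite type. -/
def expect {α : Type*} [Fintype α] (p : PMF α) (f : α → ℝ) : ℝ := ∑ x, (p x).toReal * f x

section Expect

variable {α γ : Type*} [Fintype α] [Fintype γ]

lemma sum_toReal_pmf (p : PMF α) : ∑ x, (p x).toReal = 1 := by
  rw [← ENNReal.toReal_sum fun x _ => p.apply_ne_top x, ← tsum_fintype (L := .unconditional _),
    p.tsum_coe, ENNReal.toReal_one]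

lemma expect_const (p : PMF α) (c : ℝ) : expect p (fun _ => c) = c := by
  simp [expect, ← Finset.sum_mul, sum_toReal_pmf]

lemma expect_pure (a : α) (f : α → ℝ) : expect (PMF.pure a) f = f a := by
  classical
  unfold expect
  rw [Finset.sum_eq_single a]
  · simp
  · intro b _ hb
    simp [PMF.pure_apply, hb]
  · simp

lemma expect_bind (p : PMF α) (g : α → PMF γ) (f : γ → ℝ) :
    expect (p.bind g) f = expect p fun x => expect (g x) f := by
  unfold expect
  simp_rw [PMF.bind_apply, tsum_fintype]
  have h (y : γ) : (∑ x, p x * g x y).toReal = ∑ x, (p x).toReal * (g x y).toReal := by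
    rw [ENNReal.toReal_sum fun x _ => ENNReal.mul_ne_top (p.apply_ne_top x) ((g x).apply_ne_top y)]
    simp
  simp_rw [h, Finset.sum_mul, Finset.mul_sum]
  rw [Finset.sum_comm]
  simp_rw [mul_assoc]

lemma expect_map (p : PMF α) (h : α → γ) (f : γ → ℝ) :
    expect (p.map h) f = expect p fun x => f (h x) := by
  rw [← PMF.bind_pure_comp, expect_bind]
  simp [expect_pure]

lemma expect_add (p : PMF α) (f g : α → ℝ) :
    expect p (fun x => f x + g x) = expect p f + expect p g := by
  simp [expect, mul_add, Finset.sum_add_distrib]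

lemma expect_sub (p : PMF α) (f g : α → ℝ) :
    expect p (fun x => f x - g x) = expect p f - expect p g := by
  simp [expect, mul_sub, Finset.sum_sub_distrib]

lemma expect_const_mul (p : PMF α) (c : ℝ) (f : α → ℝ) :
    expect p (fun x => c * f x) = c * expect p f := by
  simp only [expect, Finset.mul_sum]
  exact Finset.sum_congr rfl fun x _ => by ring

lemma expect_mul_const (p : PMF α) (c : ℝ) (f : α → ℝ) :
    expect p (fun x => f x * c) = expect p f * c := by
  simp only [expect, Finset.sum_mul, mul_assoc]

lemma expect_sum {ι : Type*} (s : Finset ι) (p : PMF α) (f : ι → α → ℝ) :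
    expect p (fun x => ∑ i ∈ s, f i x) = ∑ i ∈ s, expect p (f i) := by
  simp only [expect, Finset.mul_sum]
  exact Finset.sum_comm

lemma expect_mono_of_support (p : PMF α) {f g : α → ℝ} (h : ∀ x, p x ≠ 0 → f x ≤ g x) :
    expect p f ≤ expect p g := by
  refine Finset.sum_le_sum fun x _ => ?_
  by_cases hx : p x = 0
  · simp [hx]
  · exact mul_le_mul_of_nonneg_left (h x hx) ENNReal.toReal_nonneg

lemma expect_congr_of_support (p : PMF α) {f g : α → ℝ} (h : ∀ x, p x ≠ 0 → f x = g x) :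
    expect p f = expect p g :=
  le_antisymm (expect_mono_of_support p fun x hx => (h x hx).le)
    (expect_mono_of_support p fun x hx => (h x hx).ge)

lemma expect_mono (p : PMF α) {f g : α → ℝ} (h : ∀ x, f x ≤ g x) : expect p f ≤ expect p g :=
  expect_mono_of_support p fun x _ => h x

lemma expect_nonneg (p : PMF α) {f : α → ℝ} (h : ∀ x, 0 ≤ f x) : 0 ≤ expect p f :=
  Finset.sum_nonneg fun x _ => mul_nonneg ENNReal.toReal_nonneg (h x)

lemma expect_le_const (p : PMF α) {f : α → ℝ} {c : ℝ} (h : ∀ x, f x ≤ c) : expect p f ≤ c :=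
  (expect_mono p h).trans_eq (expect_const p c)

lemma const_le_expect (p : PMF α) {f : α → ℝ} {c : ℝ} (h : ∀ x, c ≤ f x) : c ≤ expect p f :=
  (expect_const p c).symm.trans_le (expect_mono p h)

lemma abs_expect_le (p : PMF α) {f : α → ℝ} {c : ℝ} (h : ∀ x, |f x| ≤ c) : |expect p f| ≤ c :=
  abs_le.2 ⟨const_le_expect p fun x => (abs_le.1 (h x)).1,
    expect_le_const p fun x => (abs_le.1 (h x)).2⟩

lemma expect_indicator_eq [DecidableEq α] (p : PMF α) (a : α) :
    expect p (fun x => if x = a then 1 else 0) = (p a).toReal := by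
  simp [expect]

end Expect

/-! ### Discounted Markov decision processes -/

section Discounted

variable {S A : Type*} [Fintype S] [Fintype A]

lemma expReward_eq (P : S → A → PMF S) (r : S → A → ℝ) (π : Policy S A) (s : S) (t : ℕ) :
    expReward P r π s t = expect (histLaw P π s t) fun x => expect (π t x) fun a => r x.2 a := rfl

lemma expect_histLaw_succ (P : S → A → PMF S) (π : Policy S A) (s : S) (t : ℕ) (W : S → ℝ) :
    expect (histLaw P π s (t + 1)) (fun x => W x.2) =
      expect (histLaw P π s t) fun x => expect (π t x) fun a => expect (P x.2 a) W := by
  simp only [histLaw, expect_bind, expect_map]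
  rfl

lemma expect_histLaw_zero (P : S → A → PMF S) (π : Policy S A) (s : S) (W : S → ℝ) :
    expect (histLaw P π s 0) (fun x => W x.2) = W s := by
  simp [histLaw, expect_pure]

variable {P : S → A → PMF S} {r : S → A → ℝ} {γ : ℝ}

lemma expReward_mem_Icc (h0 : ∀ s a, 0 ≤ r s a) (h1 : ∀ s a, r s a ≤ 1) (π : Policy S A) (s : S)
    (t : ℕ) : expReward P r π s t ∈ Set.Icc (0 : ℝ) 1 := by
  rw [expReward_eq]
  exact ⟨expect_nonneg _ fun x => expect_nonneg _ fun a => h0 _ _,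
    expect_le_const _ fun x => expect_le_const _ fun a => h1 _ _⟩

lemma hasSum_discountedReward (h0 : ∀ s a, 0 ≤ r s a) (h1 : ∀ s a, r s a ≤ 1) (hγ0 : 0 ≤ γ)
    (hγ1 : γ < 1) (π : Policy S A) (s : S) :
    HasSum (fun t => γ ^ t * expReward P r π s t) (discountedReward P r γ π s) := by
  refine Summable.hasSum ?_
  refine Summable.of_nonneg_of_le (fun t => mul_nonneg (pow_nonneg hγ0 _)
    (expReward_mem_Icc h0 h1 π s t).1) (fun t => ?_) (summable_geometric_of_lt_one hγ0 hγ1)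
  exact mul_le_of_le_one_right (pow_nonneg hγ0 _) (expReward_mem_Icc h0 h1 π s t).2

lemma tendsto_pow_mul_expect_histLaw (hγ0 : 0 ≤ γ) (hγ1 : γ < 1) (π : Policy S A) (s : S)
    (W : S → ℝ) :
    Tendsto (fun n => γ ^ n * expect (histLaw P π s n) fun x => W x.2) atTop (𝓝 0) := by
  obtain ⟨C, hC⟩ : ∃ C, ∀ s, |W s| ≤ C :=
    ⟨∑ s, |W s|, fun s => Finset.single_le_sum (fun i _ => abs_nonneg (W i)) (Finset.mem_univ s)⟩
  refine squeeze_zero_norm (a := fun n => γ ^ n * C) (fun n => ?_) ?_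
  · rw [Real.norm_eq_abs, abs_mul, abs_of_nonneg (pow_nonneg hγ0 n)]
    exact mul_le_mul_of_nonneg_left (abs_expect_le _ fun x => hC _) (pow_nonneg hγ0 n)
  · simpa using (tendsto_pow_atTop_nhds_zero_of_lt_one hγ0 hγ1).mul_const C

/-- Verification for arbitrary history-dependent policies: a superharmonic `W`, less its discounted
expectation at time n, dominates the reward of the first n steps, and the subtracted term tends to
0. -/
lemma discountedReward_le (h0 : ∀ s a, 0 ≤ r s a) (h1 : ∀ s a, r s a ≤ 1) (hγ0 : 0 ≤ γ)
    (hγ1 : γ < 1) {W : S → ℝ} (hW : ∀ s a, r s a + γ * expect (P s a) W ≤ W s)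
    (π : Policy S A) (s : S) : discountedReward P r γ π s ≤ W s := by
  have key (n : ℕ) : ∑ t ∈ Finset.range n, γ ^ t * expReward P r π s t ≤
      W s - γ ^ n * expect (histLaw P π s n) fun x => W x.2 := by
    induction n with
    | zero => simp [expect_histLaw_zero]
    | succ n ih =>
      have : expReward P r π s n + γ * expect (histLaw P π s (n + 1)) (fun x => W x.2) ≤
          expect (histLaw P π s n) fun x => W x.2 := by
        rw [expReward_eq, expect_histLaw_succ, ← expect_const_mul, ← expect_add]
        refine expect_mono _ fun x => ?_
        rw [← expect_const_mul, ← expect_add]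
        exact expect_le_const _ fun a => hW _ _
      have := mul_le_mul_of_nonneg_left this (pow_nonneg hγ0 n)
      rw [Finset.sum_range_succ, pow_succ]
      linarith
  have h := tendsto_const_nhds (x := W s) |>.sub
    (tendsto_pow_mul_expect_histLaw (P := P) hγ0 hγ1 π s W)
  rw [sub_zero] at h
  exact le_of_tendsto_of_tendsto'
    (hasSum_discountedReward h0 h1 hγ0 hγ1 π s).tendsto_sum_nat h key

lemma discountedReward_pure (h0 : ∀ s a, 0 ≤ r s a) (h1 : ∀ s a, r s a ≤ 1) (hγ0 : 0 ≤ γ)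
    (hγ1 : γ < 1) {W : S → ℝ} {f : S → A} (hW : ∀ s, r s (f s) + γ * expect (P s (f s)) W = W s)
    (s : S) : discountedReward P r γ (stationary fun s => PMF.pure (f s)) s = W s := by
  set π : Policy S A := stationary fun s => PMF.pure (f s)
  have key (n : ℕ) : ∑ t ∈ Finset.range n, γ ^ t * expReward P r π s t =
      W s - γ ^ n * expect (histLaw P π s n) fun x => W x.2 := by
    induction n with
    | zero => simp [expect_histLaw_zero]
    | succ n ih =>
      have : expReward P r π s n + γ * expect (histLaw P π s (n + 1)) (fun x => W x.2) =
          expect (histLaw P π s n) fun x => W x.2 := by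
        rw [expReward_eq, expect_histLaw_succ, ← expect_const_mul, ← expect_add]
        congr 1
        funext x
        simp only [π, stationary, expect_pure]
        exact hW _
      rw [Finset.sum_range_succ, pow_succ, ih]
      linear_combination γ ^ n * this
  have h := tendsto_const_nhds (x := W s) |>.sub
    (tendsto_pow_mul_expect_histLaw (P := P) hγ0 hγ1 π s W)
  rw [sub_zero] at h
  refine tendsto_nhds_unique
    (hasSum_discountedReward h0 h1 hγ0 hγ1 π s).tendsto_sum_nat (h.congr fun n => (key n).symm)

variable [Nonempty A]

/-- The Bellman operator with discount factor `γ`. -/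
def bellman (P : S → A → PMF S) (r : S → A → ℝ) (γ : ℝ) (V : S → ℝ) (s : S) : ℝ :=
  Finset.univ.sup' Finset.univ_nonempty fun a => r s a + γ * expect (P s a) V

lemma le_bellman (V : S → ℝ) (s : S) (a : A) :
    r s a + γ * expect (P s a) V ≤ bellman P r γ V s :=
  Finset.le_sup' (fun a => r s a + γ * expect (P s a) V) (Finset.mem_univ a)

lemma exists_bellman_eq (P : S → A → PMF S) (r : S → A → ℝ) (γ : ℝ) (V : S → ℝ) (s : S) :
    ∃ a, r s a + γ * expect (P s a) V = bellman P r γ V s := by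
  obtain ⟨a, -, ha⟩ := Finset.exists_mem_eq_sup' Finset.univ_nonempty
    fun a => r s a + γ * expect (P s a) V
  exact ⟨a, ha.symm⟩

lemma bellman_le_add (hγ0 : 0 ≤ γ) {V W : S → ℝ} {c : ℝ} (h : ∀ s, V s ≤ W s + c) (s : S) :
    bellman P r γ V s ≤ bellman P r γ W s + γ * c := by
  refine Finset.sup'_le _ _ fun a _ => ?_
  have h1 := le_bellman (P := P) (r := r) (γ := γ) W s a
  have h2 : expect (P s a) V ≤ expect (P s a) W + c := by
    calc _ ≤ expect (P s a) fun s => W s + c := expect_mono _ h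
      _ = _ := by rw [expect_add, expect_const]
  nlinarith [mul_le_mul_of_nonneg_left h2 hγ0]

lemma contractingWith_bellman (hγ0 : 0 ≤ γ) (hγ1 : γ < 1) :
    ContractingWith ⟨γ, hγ0⟩ (bellman P r γ) := by
  refine ⟨hγ1, LipschitzWith.of_dist_le_mul fun V W => ?_⟩
  refine (dist_pi_le_iff (mul_nonneg hγ0 dist_nonneg)).2 fun s => ?_
  have hVW (s : S) : |V s - W s| ≤ dist V W := by
    rw [← Real.dist_eq]
    exact dist_le_pi_dist V W s
  rw [Real.dist_eq, abs_le]
  have h1 := bellman_le_add (P := P) (r := r) hγ0 (V := V) (W := W) (c := dist V W)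
    (fun s => by linarith [(abs_le.1 (hVW s)).2]) s
  have h2 := bellman_le_add (P := P) (r := r) hγ0 (V := W) (W := V) (c := dist V W)
    (fun s => by linarith [(abs_le.1 (hVW s)).1]) s
  change -(γ * dist V W) ≤ _ ∧ _ ≤ γ * dist V W
  constructor <;> linarith

/-- A fixed point dominates every policy by `discountedReward_le`, and the deterministic policy
greedy for it attains it by `discountedReward_pure`. -/
lemma optDiscounted_eq_of_isFixedPt (h0 : ∀ s a, 0 ≤ r s a) (h1 : ∀ s a, r s a ≤ 1)
    (hγ0 : 0 ≤ γ) (hγ1 : γ < 1) {W : S → ℝ} (hW : bellman P r γ W = W) :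
    optDiscounted P r γ = W := by
  funext s
  have hle (π : Policy S A) : discountedReward P r γ π s ≤ W s :=
    discountedReward_le h0 h1 hγ0 hγ1
      (fun s a => (le_bellman W s a).trans_eq (congrFun hW s)) π s
  have : Nonempty (Policy S A) := ⟨fun _ _ => PMF.pure (Classical.arbitrary A)⟩
  refine le_antisymm (ciSup_le hle) ?_
  choose f hf using fun s => exists_bellman_eq P r γ W s
  refine le_ciSup_of_le ⟨W s, Set.forall_mem_range.2 hle⟩
    (stationary fun s => PMF.pure (f s)) (discountedReward_pure h0 h1 hγ0 hγ1 (fun s => ?_) s).ge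
  rw [hf, hW]

lemma bellman_optDiscounted (h0 : ∀ s a, 0 ≤ r s a) (h1 : ∀ s a, r s a ≤ 1)
    (hγ0 : 0 ≤ γ) (hγ1 : γ < 1) :
    bellman P r γ (optDiscounted P r γ) = optDiscounted P r γ := by
  have h := (contractingWith_bellman (P := P) (r := r) hγ0 hγ1).fixedPoint_isFixedPt
  rw [optDiscounted_eq_of_isFixedPt h0 h1 hγ0 hγ1 h]
  exact h

lemma tendsto_iterate_bellman (h0 : ∀ s a, 0 ≤ r s a) (h1 : ∀ s a, r s a ≤ 1)
    (hγ0 : 0 ≤ γ) (hγ1 : γ < 1) :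
    Tendsto (fun n => (bellman P r γ)^[n] 0) atTop (𝓝 (optDiscounted P r γ)) := by
  have hc := contractingWith_bellman (P := P) (r := r) hγ0 hγ1
  rw [optDiscounted_eq_of_isFixedPt h0 h1 hγ0 hγ1 hc.fixedPoint_isFixedPt]
  exact hc.tendsto_iterate_fixedPoint 0

omit [Nonempty A] in
lemma optDiscounted_nonneg (h0 : ∀ s a, 0 ≤ r s a) (s : S) (hγ0 : 0 ≤ γ) :
    0 ≤ optDiscounted P r γ s :=
  Real.iSup_nonneg fun π => tsum_nonneg fun t => mul_nonneg (pow_nonneg hγ0 t) <| by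
    rw [expReward_eq]
    exact expect_nonneg _ fun x => expect_nonneg _ fun a => h0 _ _

omit [Nonempty A] in
lemma optDiscounted_le (h0 : ∀ s a, 0 ≤ r s a) (h1 : ∀ s a, r s a ≤ 1)
    (hγ0 : 0 ≤ γ) (hγ1 : γ < 1) (s : S) : optDiscounted P r γ s ≤ (1 - γ)⁻¹ := by
  refine Real.iSup_le (fun π => ?_) (inv_nonneg.2 (sub_nonneg.2 hγ1.le))
  refine discountedReward_le (W := fun _ => (1 - γ)⁻¹) h0 h1 hγ0 hγ1 (fun s a => ?_) π s
  rw [expect_const]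
  have : (1 - γ) * (1 - γ)⁻¹ = 1 := mul_inv_cancel₀ (by linarith)
  linarith [h1 s a]

/-- Rewards are nonnegative, so dropping them from the Bellman equation leaves a supermartingale
inequality. -/
lemma optDiscounted_supermartingale (h0 : ∀ s a, 0 ≤ r s a) (h1 : ∀ s a, r s a ≤ 1)
    (hγ0 : 0 ≤ γ) (hγ1 : γ < 1) (π : Policy S A) (s : S) (n : ℕ) :
    γ ^ n * expect (histLaw P π s n) (fun x => optDiscounted P r γ x.2) ≤
      optDiscounted P r γ s := by
  induction n with
  | zero => simp [expect_histLaw_zero]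
  | succ n ih =>
    refine le_trans ?_ ih
    rw [pow_succ, mul_assoc]
    refine mul_le_mul_of_nonneg_left ?_ (pow_nonneg hγ0 n)
    rw [expect_histLaw_succ, ← expect_const_mul]
    refine expect_mono _ fun x => ?_
    rw [← expect_const_mul]
    refine expect_le_const _ fun a => ?_
    have := le_bellman (P := P) (r := r) (γ := γ) (optDiscounted P r γ) x.2 a
    rw [bellman_optDiscounted h0 h1 hγ0 hγ1] at this
    linarith [h0 x.2 a]

/-- In a communicating process the optimal discounted values of the states differ by an amount which
is bounded uniformly in the discount factor. -/
lemma exists_optDiscounted_sub_le (h0 : ∀ s a, 0 ≤ r s a) (h1 : ∀ s a, r s a ≤ 1)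
    (hP : Communicating P) :
    ∃ C, ∀ γ : ℝ, 1 / 2 ≤ γ → γ < 1 → ∀ s s',
      optDiscounted P r γ s' - optDiscounted P r γ s ≤ C := by
  classical
  choose π k hk using hP
  let p (s s' : S) : ℝ := (((histLaw P (stationary (π s s')) s (k s s')).map Prod.snd) s').toReal
  have hp0 (s s') : 0 < p s s' := ENNReal.toReal_pos (hk s s').ne' (PMF.apply_ne_top _ _)
  -- Number of steps divided by discount times hitting probability; replacing γ by 1/2 in the
  -- discount makes the bound uniform.
  let c (s s' : S) : ℝ := k s s' / ((1 / 2) ^ k s s' * p s s')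
  have hc (s s') : 0 ≤ c s s' := by have := hp0 s s'; positivity
  refine ⟨∑ s, ∑ s', c s s', fun γ hγ hγ1 s s' => ?_⟩
  have hγ0 : 0 ≤ γ := by linarith
  set V := optDiscounted P r γ
  -- Starting from a minimiser of `V`, every endpoint other than s' can be bounded below by `V m`.
  obtain ⟨m, -, hm⟩ := Finset.exists_min_image Finset.univ V ⟨s, Finset.mem_univ s⟩
  have hm' (x : S) : V m ≤ V x := hm x (Finset.mem_univ x)
  have key : V s' - V m ≤ c m s' := by
    set n := k m s'
    have hsup := optDiscounted_supermartingale (P := P) (r := r) h0 h1 hγ0 hγ1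
      (stationary (π m s')) m n
    have hexp : V m + p m s' * (V s' - V m) ≤
        expect (histLaw P (stationary (π m s')) m n) fun x => V x.2 := by
      have e1 : p m s' = expect (histLaw P (stationary (π m s')) m n)
          fun x => if x.2 = s' then 1 else 0 := by
        rw [← expect_map (h := Prod.snd) (f := fun x => if x = s' then (1 : ℝ) else 0),
          expect_indicator_eq]
      rw [e1, ← expect_mul_const]
      nth_rewrite 1 [← expect_const (histLaw P (stationary (π m s')) m n) (V m)]
      rw [← expect_add]
      refine expect_mono _ fun x => ?_
      split_ifs with hx
      · rw [hx]; linarith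
      · linarith [hm' x.2]
    -- `V m` may blow up like 1/(1 − γ), but Bernoulli's inequality shows that discounting over n
    -- steps costs at most n.
    have h2 : (1 - γ ^ n) * V m ≤ n := by
      have hb : 1 - γ ^ n ≤ n * (1 - γ) := by
        have := one_add_mul_le_pow (a := γ - 1) (by linarith) n
        rw [add_sub_cancel] at this
        linarith
      calc (1 - γ ^ n) * V m ≤ (n * (1 - γ)) * (1 - γ)⁻¹ :=
            mul_le_mul hb (optDiscounted_le h0 h1 hγ0 hγ1 m) (optDiscounted_nonneg h0 m hγ0)
              (mul_nonneg n.cast_nonneg (by linarith))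
        _ = n := by rw [mul_assoc, mul_inv_cancel₀ (by linarith), mul_one]
    have h3 : γ ^ n * p m s' * (V s' - V m) ≤ n := by
      have := mul_le_mul_of_nonneg_left hexp (pow_nonneg hγ0 n)
      nlinarith
    have h4 : (1 / 2) ^ n * p m s' * (V s' - V m) ≤ n := by
      refine le_trans (mul_le_mul_of_nonneg_right ?_ (by linarith [hm' s'])) h3
      exact mul_le_mul_of_nonneg_right (pow_le_pow_left₀ (by norm_num) hγ n) (hp0 m s').le
    rw [le_div_iff₀ (mul_pos (by positivity) (hp0 m s'))]
    linarith
  calc V s' - V s ≤ V s' - V m := by linarith [hm' s]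
    _ ≤ c m s' := key
    _ ≤ ∑ y, c m y := Finset.single_le_sum (fun y _ => hc m y) (Finset.mem_univ s')
    _ ≤ ∑ x, ∑ y, c x y := Finset.single_le_sum (f := fun x => ∑ y, c x y)
        (fun x _ => Finset.sum_nonneg fun y _ => hc x y) (Finset.mem_univ m)

end Discounted

/-! ### Functions which are rational near `1` -/

/-- `f` agrees with a rational function on some interval `(1 - δ, 1)`. -/
def EventuallyRational (f : ℝ → ℝ) : Prop :=
  ∃ p q : Polynomial ℝ, q ≠ 0 ∧ ∀ᶠ x in 𝓝[<] (1 : ℝ), f x = p.eval x / q.eval x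

lemma eventually_eval_ne_zero {q : Polynomial ℝ} (hq : q ≠ 0) :
    ∀ᶠ x in 𝓝[<] (1 : ℝ), q.eval x ≠ 0 := by
  have h : ∀ᶠ x in cofinite, q.eval x ≠ 0 := by
    have : {x | q.eval x = 0}.Finite := by
      refine q.roots.toFinset.finite_toSet.subset fun x hx => ?_
      simpa [hq] using hx
    simpa [eventually_cofinite] using this
  exact h.filter_mono ((nhdsLT_le_nhdsNE 1).trans (nhdsNE_le_cofinite 1))

/-- A nonzero polynomial has no root on some interval ending at 1, and there the intermediate value
theorem excludes a change of sign. -/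
lemma eventually_eval_nonneg_or_nonpos (p : Polynomial ℝ) :
    (∀ᶠ x in 𝓝[<] (1 : ℝ), 0 ≤ p.eval x) ∨ ∀ᶠ x in 𝓝[<] (1 : ℝ), p.eval x ≤ 0 := by
  by_cases hp : p = 0
  · simp [hp]
  obtain ⟨l, hl, hl'⟩ := (mem_nhdsLT_iff_exists_Ioo_subset (a := (1 : ℝ))).1
    (eventually_eval_ne_zero hp)
  by_contra! hcon
  obtain ⟨h1, h2⟩ := hcon
  have hIoo : ∀ᶠ x in 𝓝[<] (1 : ℝ), x ∈ Set.Ioo l 1 := Ioo_mem_nhdsLT hl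
  obtain ⟨x, hx, hxl⟩ := (h1.and_eventually hIoo).exists
  obtain ⟨y, hy, hyl⟩ := (h2.and_eventually hIoo).exists
  obtain ⟨z, hz, hz0⟩ := intermediate_value_uIcc (f := fun x => p.eval x) (a := x) (b := y)
    p.continuous.continuousOn (Set.mem_uIcc.2 (Or.inl ⟨hx.le, hy.le⟩))
  exact hl' (Set.OrdConnected.uIcc_subset Set.ordConnected_Ioo hxl hyl hz) hz0

namespace EventuallyRational

variable {f g : ℝ → ℝ}

lemma const (c : ℝ) : EventuallyRational fun _ => c :=
  ⟨Polynomial.C c, 1, one_ne_zero, by simp⟩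

lemma id : EventuallyRational fun x => x := ⟨Polynomial.X, 1, one_ne_zero, by simp⟩

lemma congr (hf : EventuallyRational f) (h : ∀ᶠ x in 𝓝[<] (1 : ℝ), g x = f x) :
    EventuallyRational g := by
  obtain ⟨p, q, hq, hpq⟩ := hf
  refine ⟨p, q, hq, ?_⟩
  filter_upwards [h, hpq] with x h1 h2
  rw [h1, h2]

lemma sub (hf : EventuallyRational f) (hg : EventuallyRational g) :
    EventuallyRational fun x => f x - g x := by
  obtain ⟨p, q, hq, hf⟩ := hf
  obtain ⟨p', q', hq', hg⟩ := hg
  refine ⟨p * q' - q * p', q * q', mul_ne_zero hq hq', ?_⟩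
  filter_upwards [hf, hg, eventually_eval_ne_zero hq, eventually_eval_ne_zero hq'] with
    x h1 h2 h3 h4
  rw [h1, h2, div_sub_div _ _ h3 h4]
  simp

lemma mul (hf : EventuallyRational f) (hg : EventuallyRational g) :
    EventuallyRational fun x => f x * g x := by
  obtain ⟨p, q, hq, hf⟩ := hf
  obtain ⟨p', q', hq', hg⟩ := hg
  refine ⟨p * p', q * q', mul_ne_zero hq hq', ?_⟩
  filter_upwards [hf, hg] with x h1 h2
  rw [h1, h2, div_mul_div_comm]
  simp

lemma nonneg_or_nonpos (hf : EventuallyRational f) :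
    (∀ᶠ x in 𝓝[<] (1 : ℝ), 0 ≤ f x) ∨ ∀ᶠ x in 𝓝[<] (1 : ℝ), f x ≤ 0 := by
  obtain ⟨p, q, -, hpq⟩ := hf
  -- The quotient has the sign of `p * q`; with `x / 0 = 0` the identity survives at roots of `q`.
  have h (x : ℝ) : p.eval x / q.eval x = (p * q).eval x / q.eval x ^ 2 := by
    by_cases hq : q.eval x = 0
    · simp [hq]
    · rw [Polynomial.eval_mul]; field_simp
  refine (eventually_eval_nonneg_or_nonpos (p * q)).imp (fun h' => ?_) fun h' => ?_
  · filter_upwards [hpq, h'] with x h1 h2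
    rw [h1, h]
    positivity
  · filter_upwards [hpq, h'] with x h1 h2
    rw [h1, h]
    exact div_nonpos_of_nonpos_of_nonneg h2 (sq_nonneg _)

/-- The difference has a constant sign near 1, so the maximum is eventually one of the two
functions. -/
lemma sup (hf : EventuallyRational f) (hg : EventuallyRational g) :
    EventuallyRational (f ⊔ g) := by
  rcases (hf.sub hg).nonneg_or_nonpos with h | h
  · refine hf.congr ?_
    filter_upwards [h] with x hx
    exact max_eq_left (sub_nonneg.1 hx)
  · refine hg.congr ?_
    filter_upwards [h] with x hx
    exact max_eq_right (sub_nonpos.1 hx)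

/-- A function which is rational and bounded near `1` has a left limit at `1`. -/
lemma exists_tendsto (hf : EventuallyRational f) {C : ℝ}
    (hC : ∀ᶠ x in 𝓝[<] (1 : ℝ), |f x| ≤ C) : ∃ l, Tendsto f (𝓝[<] 1) (𝓝 l) := by
  -- An oscillation across a < b would make f − a change sign arbitrarily close to 1.
  refine tendsto_of_no_upcrossings dense_univ ?_ ?_ ?_
  · rintro a - b - hab ⟨h1, h2⟩
    rcases (hf.sub (const a)).nonneg_or_nonpos with h | h
    · exact h1 (h.mono fun x hx => not_lt.2 (sub_nonneg.1 hx))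
    · exact h2 (h.mono fun x hx => not_lt.2 ((sub_nonpos.1 hx).trans hab.le))
  · exact ⟨C, eventually_map.2 (hC.mono fun x hx => (abs_le.1 hx).2)⟩
  · exact ⟨-C, eventually_map.2 (hC.mono fun x hx => (abs_le.1 hx).1)⟩

end EventuallyRational

/-! ### The vanishing discount limit -/

section VanishingDiscount

variable {S A : Type*} [Fintype S] [Fintype A] {P : S → A → PMF S} {r : S → A → ℝ} {γ : ℝ}

omit [Fintype A] in
/-- If `D ≥ γ P_f D`, then `D ≥ 0`. -/
lemma nonneg_of_discounted_expect_le (hγ0 : 0 ≤ γ) (hγ1 : γ < 1) (f : S → A) {D : S → ℝ}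
    (hD : ∀ s, γ * expect (P s (f s)) D ≤ D s) (s : S) : 0 ≤ D s := by
  obtain ⟨m, -, hm⟩ := Finset.exists_min_image Finset.univ D ⟨s, Finset.mem_univ s⟩
  have h1 : D m ≤ expect (P m (f m)) D := const_le_expect _ fun x => hm x (Finset.mem_univ x)
  have h2 : γ * D m ≤ D m := (mul_le_mul_of_nonneg_left h1 hγ0).trans (hD m)
  have h3 : 0 ≤ D m := by nlinarith
  exact h3.trans (hm s (Finset.mem_univ s))

open Polynomial in
/-- The matrix `1 - X P_f` of the deterministic policy `f`. -/
def resolventMatrix [DecidableEq S] (P : S → A → PMF S) (f : S → A) : Matrix S S ℝ[X] :=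
  1 - (X : ℝ[X]) • (Matrix.of fun s s' => C (P s (f s) s').toReal)

omit [Fintype A] in
lemma eval_resolventMatrix_mulVec [DecidableEq S] (f : S → A) (W : S → ℝ) (s : S) :
    ((Polynomial.evalRingHom γ).mapMatrix (resolventMatrix P f)).mulVec W s =
      W s - γ * expect (P s (f s)) W := by
  have : (Polynomial.evalRingHom γ).mapMatrix (resolventMatrix P f) =
      1 - γ • Matrix.of fun s s' => (P s (f s) s').toReal := by
    ext i j
    simp [resolventMatrix, Matrix.one_apply, apply_ite]
    ring
  rw [this, Matrix.sub_mulVec, Matrix.one_mulVec, Matrix.smul_mulVec]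
  rfl

-- A kernel vector satisfies v = γ P_f v, and the minimum principle applied to v and to −v makes it
-- zero.
omit [Fintype A] in
lemma eval_det_resolventMatrix_ne_zero [DecidableEq S] (hγ0 : 0 ≤ γ) (hγ1 : γ < 1) (f : S → A) :
    (resolventMatrix P f).det.eval γ ≠ 0 := by
  rw [← Polynomial.coe_evalRingHom, RingHom.map_det]
  intro h
  obtain ⟨v, hv, hv0⟩ := Matrix.exists_mulVec_eq_zero_iff.2 h
  have hv0' (s : S) : v s - γ * expect (P s (f s)) v = 0 := by
    rw [← eval_resolventMatrix_mulVec, hv0, Pi.zero_apply]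
  refine hv (funext fun s => le_antisymm ?_ ?_)
  · have := nonneg_of_discounted_expect_le (P := P) hγ0 hγ1 f (D := fun s => -1 * v s)
      (fun s => by rw [expect_const_mul]; linarith [hv0' s]) s
    simpa using this
  · exact nonneg_of_discounted_expect_le (P := P) hγ0 hγ1 f (fun s => by linarith [hv0' s]) s

/-- The numerator of the discounted value of `f` at `s`, as a rational function of `γ`. -/
def valueNumerator [DecidableEq S] (P : S → A → PMF S) (r : S → A → ℝ) (f : S → A) (s : S) :
    Polynomial ℝ :=
  (resolventMatrix P f).adjugate.mulVec (fun s => Polynomial.C (r s (f s))) s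

omit [Fintype A] in
lemma eval_valueNumerator [DecidableEq S] (f : S → A) (s : S) :
    (valueNumerator P r f s).eval γ =
      ((Polynomial.evalRingHom γ).mapMatrix (resolventMatrix P f)).adjugate.mulVec
        (fun s => r s (f s)) s := by
  rw [← RingHom.map_adjugate]
  simp [valueNumerator, Matrix.mulVec, dotProduct, Polynomial.eval_finsetSum]

-- Cramer's rule for the evaluation equation (1 − γ P_f) W = r_f.
omit [Fintype A] in
lemma value_of_eq [DecidableEq S] (hγ0 : 0 ≤ γ) (hγ1 : γ < 1) (f : S → A) {W : S → ℝ}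
    (hW : ∀ s, r s (f s) + γ * expect (P s (f s)) W = W s) (s : S) :
    W s = (valueNumerator P r f s).eval γ / (resolventMatrix P f).det.eval γ := by
  rw [eq_div_iff (eval_det_resolventMatrix_ne_zero hγ0 hγ1 f), eval_valueNumerator,
    ← Polynomial.coe_evalRingHom, RingHom.map_det]
  set Q := (Polynomial.evalRingHom γ).mapMatrix (resolventMatrix P f)
  have : (fun s => r s (f s)) = Q.mulVec W := by
    funext s
    rw [eval_resolventMatrix_mulVec]
    linarith [hW s]
  rw [this, Matrix.mulVec_mulVec, Matrix.adjugate_mul, Matrix.smul_mulVec, Matrix.one_mulVec]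
  simp [mul_comm]

/-- The quotient solves the evaluation equation of `f`, so it is the reward of an actual policy. -/
lemma value_le_optDiscounted [DecidableEq S] [Nonempty A] (h0 : ∀ s a, 0 ≤ r s a)
    (h1 : ∀ s a, r s a ≤ 1) (hγ0 : 0 ≤ γ) (hγ1 : γ < 1) (f : S → A) (s : S) :
    (valueNumerator P r f s).eval γ / (resolventMatrix P f).det.eval γ ≤
      optDiscounted P r γ s := by
  set Q := (Polynomial.evalRingHom γ).mapMatrix (resolventMatrix P f)
  set W : S → ℝ := Q.det⁻¹ • Q.adjugate.mulVec fun s => r s (f s)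
  have hdet : Q.det ≠ 0 := by
    have := eval_det_resolventMatrix_ne_zero (P := P) hγ0 hγ1 f
    rwa [← Polynomial.coe_evalRingHom, RingHom.map_det] at this
  have hQW : Q.mulVec W = fun s => r s (f s) := by
    simp only [W]
    rw [Matrix.mulVec_smul, Matrix.mulVec_mulVec, Matrix.mul_adjugate, Matrix.smul_mulVec,
      Matrix.one_mulVec, smul_smul, inv_mul_cancel₀ hdet, one_smul]
  have hW (s : S) : r s (f s) + γ * expect (P s (f s)) W = W s := by
    have := congrFun hQW s
    simp only [Q] at this
    rw [eval_resolventMatrix_mulVec] at this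
    linarith
  rw [← value_of_eq hγ0 hγ1 f hW, ← discountedReward_pure h0 h1 hγ0 hγ1 hW]
  have hle (π : Policy S A) : discountedReward P r γ π s ≤ (1 - γ)⁻¹ := by
    refine discountedReward_le (W := fun _ => (1 - γ)⁻¹) h0 h1 hγ0 hγ1 (fun s a => ?_) π s
    rw [expect_const]
    have : (1 - γ) * (1 - γ)⁻¹ = 1 := mul_inv_cancel₀ (by linarith)
    linarith [h1 s a]
  exact le_ciSup (f := fun π => discountedReward P r γ π s) ⟨_, Set.forall_mem_range.2 hle⟩ _

lemma eventually_nhdsLT_one : ∀ᶠ γ in 𝓝[<] (1 : ℝ), 1 / 2 < γ ∧ γ < 1 :=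
  Ioo_mem_nhdsLT (by norm_num)

/-- For each γ near 1 some deterministic stationary policy is optimal, so the value is the maximum
of finitely many rational functions, which do not vary with γ. -/
lemma eventuallyRational_optDiscounted [Nonempty A] (h0 : ∀ s a, 0 ≤ r s a)
    (h1 : ∀ s a, r s a ≤ 1) (s : S) :
    EventuallyRational fun γ => optDiscounted P r γ s := by
  classical
  let F (f : S → A) (γ : ℝ) : ℝ :=
    (valueNumerator P r f s).eval γ / (resolventMatrix P f).det.eval γ
  have hF (f : S → A) : EventuallyRational (F f) := by
    refine ⟨valueNumerator P r f s, (resolventMatrix P f).det, fun h => ?_, by simp [F]⟩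
    -- The determinant is a nonzero polynomial because it does not vanish at γ = 0.
    exact eval_det_resolventMatrix_ne_zero (P := P) le_rfl zero_lt_one f (by simp [h])
  have hsup : EventuallyRational (Finset.univ.sup' Finset.univ_nonempty F) :=
    Finset.sup'_induction _ _ (fun f hf g hg => hf.sup hg) fun f _ => hF f
  refine hsup.congr ?_
  filter_upwards [eventually_nhdsLT_one] with γ hγ
  have hγ0 : 0 ≤ γ := by linarith
  rw [Finset.sup'_apply]
  refine le_antisymm ?_ (Finset.sup'_le _ _ fun f _ => value_le_optDiscounted h0 h1 hγ0 hγ.2 f s)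
  choose f hf using fun s => exists_bellman_eq P r γ (optDiscounted P r γ) s
  rw [bellman_optDiscounted h0 h1 hγ0 hγ.2] at hf
  rw [value_of_eq hγ0 hγ.2 f hf s]
  exact Finset.le_sup' (fun f => F f γ) (Finset.mem_univ f)

variable [Nonempty A] (h0 : ∀ s a, 0 ≤ r s a) (h1 : ∀ s a, r s a ≤ 1) (hP : Communicating P)

include h0 h1

/-- `limUnder` returns an arbitrary value unless the limit exists; here existence follows from
rationality and 0 ≤ (1 − γ)V ≤ 1. -/
lemma tendsto_optGain (sref : S) :
    Tendsto (fun γ => (1 - γ) * optDiscounted P r γ sref) (𝓝[<] 1) (𝓝 (optGain P r sref)) := by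
  refine tendsto_nhds_limUnder ?_
  refine (((EventuallyRational.const 1).sub .id).mul
    (eventuallyRational_optDiscounted h0 h1 sref)).exists_tendsto (C := 1) ?_
  filter_upwards [eventually_nhdsLT_one] with γ hγ
  have hγ0 : 0 ≤ γ := by linarith
  have h2 : 0 < 1 - γ := by linarith [hγ.2]
  rw [abs_of_nonneg (mul_nonneg h2.le (optDiscounted_nonneg h0 sref hγ0))]
  calc _ ≤ (1 - γ) * (1 - γ)⁻¹ :=
        mul_le_mul_of_nonneg_left (optDiscounted_le h0 h1 hγ0 hγ.2 sref) h2.le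
    _ = 1 := mul_inv_cancel₀ h2.ne'

lemma optGain_mem_Icc (sref : S) : optGain P r sref ∈ Set.Icc (0 : ℝ) 1 := by
  refine isClosed_Icc.mem_of_tendsto (tendsto_optGain h0 h1 sref) ?_
  filter_upwards [eventually_nhdsLT_one] with γ hγ
  have hγ0 : 0 ≤ γ := by linarith
  have h2 : 0 < 1 - γ := by linarith [hγ.2]
  refine ⟨mul_nonneg h2.le (optDiscounted_nonneg h0 sref hγ0), ?_⟩
  calc _ ≤ (1 - γ) * (1 - γ)⁻¹ :=
        mul_le_mul_of_nonneg_left (optDiscounted_le h0 h1 hγ0 hγ.2 sref) h2.le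
    _ = 1 := mul_inv_cancel₀ h2.ne'

include hP

lemma tendsto_relValue (sref s : S) :
    Tendsto (fun γ => optDiscounted P r γ s - optDiscounted P r γ sref) (𝓝[<] 1)
      (𝓝 (relValue P r sref s)) := by
  refine tendsto_nhds_limUnder ?_
  obtain ⟨C, hC⟩ := exists_optDiscounted_sub_le (P := P) h0 h1 hP
  refine ((eventuallyRational_optDiscounted h0 h1 s).sub
    (eventuallyRational_optDiscounted h0 h1 sref)).exists_tendsto (C := C) ?_
  filter_upwards [eventually_nhdsLT_one] with γ hγ
  exact abs_le.2 ⟨by linarith [hC γ hγ.1.le hγ.2 s sref], hC γ hγ.1.le hγ.2 sref s⟩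

lemma tendsto_bellman_relative (sref s : S) (a : A) :
    Tendsto (fun γ => r s a + γ * expect (P s a)
        (fun s' => optDiscounted P r γ s' - optDiscounted P r γ sref)) (𝓝[<] 1)
      (𝓝 (relQ P r sref s a)) := by
  have hid : Tendsto (fun γ : ℝ => γ) (𝓝[<] 1) (𝓝 1) := tendsto_id.mono_left nhdsWithin_le_nhds
  have h : Tendsto (fun γ => expect (P s a)
      (fun s' => optDiscounted P r γ s' - optDiscounted P r γ sref)) (𝓝[<] 1)
      (𝓝 (expect (P s a) (relValue P r sref))) :=
    tendsto_finsetSum _ fun s' _ => (tendsto_relValue h0 h1 hP sref s').const_mul _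
  have h' := (hid.mul h).const_add (r s a)
  rwa [one_mul] at h'

/-- The Bellman optimality inequality for the average reward. -/
lemma relQ_le_relValue_add_optGain (sref s : S) (a : A) :
    relQ P r sref s a ≤ relValue P r sref s + optGain P r sref := by
  refine le_of_tendsto_of_tendsto (tendsto_bellman_relative h0 h1 hP sref s a)
    ((tendsto_relValue h0 h1 hP sref s).add (tendsto_optGain h0 h1 sref)) ?_
  filter_upwards [eventually_nhdsLT_one] with γ hγ
  have := le_bellman (P := P) (r := r) (γ := γ) (optDiscounted P r γ) s a
  rw [bellman_optDiscounted h0 h1 (by linarith) hγ.2] at this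
  -- Subtracting γ V(ŝ) from the Bellman inequality turns values into relative values and leaves (1
  -- − γ)V(ŝ), whose limit is the gain.
  rw [expect_sub, expect_const]
  linarith

/-- Greedy actions attain equality in the Bellman optimality inequality. -/
lemma relQ_eq_of_forall_le (sref s : S) {a : A}
    (ha : ∀ a', relQ P r sref s a' ≤ relQ P r sref s a) :
    relQ P r sref s a = relValue P r sref s + optGain P r sref := by
  refine le_antisymm (relQ_le_relValue_add_optGain h0 h1 hP sref s a) ?_
  -- The maximising action may change with γ, so the limit is taken of the maximum over all actions.
  have hlim : Tendsto (fun γ => Finset.univ.sup' Finset.univ_nonempty fun a => r s a +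
      γ * expect (P s a) (fun s' => optDiscounted P r γ s' - optDiscounted P r γ sref)) (𝓝[<] 1)
      (𝓝 (Finset.univ.sup' Finset.univ_nonempty fun a => relQ P r sref s a)) :=
    Filter.Tendsto.finset_sup'_nhds_apply _
      fun a _ => tendsto_bellman_relative h0 h1 hP sref s a
  refine le_trans ?_ (Finset.sup'_le Finset.univ_nonempty _ fun a' _ => ha a')
  refine le_of_tendsto_of_tendsto
    ((tendsto_relValue h0 h1 hP sref s).add (tendsto_optGain h0 h1 sref)) hlim ?_
  filter_upwards [eventually_nhdsLT_one] with γ hγ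
  obtain ⟨b, hb⟩ := exists_bellman_eq P r γ (optDiscounted P r γ) s
  rw [bellman_optDiscounted h0 h1 (by linarith) hγ.2] at hb
  have := Finset.le_sup' (fun a => r s a +
    γ * expect (P s a) (fun s' => optDiscounted P r γ s' - optDiscounted P r γ sref))
    (Finset.mem_univ b)
  rw [expect_sub, expect_const] at this
  linarith

end VanishingDiscount

/-! ### Measurability in the parameter -/

section Measurability

variable {S A Θ : Type*} [Fintype S] [Fintype A] [Nonempty A] [MeasurableSpace Θ]
  (M : Model S A Θ)

omit [Fintype S] [Fintype A] [Nonempty A] in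
@[fun_prop]
lemma Model.measurable_trans_toReal (s : S) (a : A) (s' : S) :
    Measurable fun θ => (M.trans θ s a s').toReal := (M.measurable_trans s a s').ennreal_toReal

/-- Measurability is not visible from a supremum over all policies; value iteration presents the
value as a limit of finite maxima of measurable functions. -/
lemma Model.measurable_optDiscounted {γ : ℝ} (hγ0 : 0 ≤ γ) (hγ1 : γ < 1) :
    Measurable fun θ => optDiscounted (M.trans θ) M.reward γ := by
  refine measurable_of_tendsto_metrizable (f := fun n θ => (bellman (M.trans θ) M.reward γ)^[n] 0)
    (fun n => ?_) (tendsto_pi_nhds.2 fun θ =>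
      tendsto_iterate_bellman M.reward_nonneg M.reward_le_one hγ0 hγ1)
  induction n with
  | zero => simp
  | succ n ih =>
    simp only [Function.iterate_succ', Function.comp_apply]
    refine measurable_pi_lambda _ fun s => ?_
    unfold bellman
    have := Finset.measurable_sup' (f := fun (a : A) (θ : Θ) => M.reward s a +
      γ * expect (M.trans θ s a) ((bellman (M.trans θ) M.reward γ)^[n] 0))
      Finset.univ_nonempty (fun a _ => by
        unfold expect
        have (s' : S) : Measurable fun θ => (bellman (M.trans θ) M.reward γ)^[n] 0 s' :=
          (measurable_pi_apply s').comp ih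
        fun_prop)
    convert this using 1
    funext θ
    rw [Finset.sup'_apply]
    rfl

/-- A sequence increasing to `1`. -/
lemma tendsto_one_sub_inv :
    Tendsto (fun n : ℕ => 1 - 1 / ((n : ℝ) + 1)) atTop (𝓝[<] 1) := by
  refine tendsto_nhdsWithin_iff.2 ⟨?_, Eventually.of_forall fun n => ?_⟩
  · simpa using (tendsto_one_div_add_atTop_nhds_zero_nat (𝕜 := ℝ)).const_sub 1
  · have : 0 < 1 / ((n : ℝ) + 1) := by positivity
    exact Set.mem_Iio.2 (by linarith)

lemma one_sub_inv_mem (n : ℕ) : 0 ≤ 1 - 1 / ((n : ℝ) + 1) ∧ 1 - 1 / ((n : ℝ) + 1) < 1 := by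
  have h1 : 0 < 1 / ((n : ℝ) + 1) := by positivity
  have h2 : 1 / ((n : ℝ) + 1) ≤ 1 := by
    rw [div_le_one (by positivity)]
    linarith [n.cast_nonneg (α := ℝ)]
  constructor <;> linarith

lemma Model.measurable_optDiscounted_apply {γ : ℝ} (hγ0 : 0 ≤ γ) (hγ1 : γ < 1) (s : S) :
    Measurable fun θ => optDiscounted (M.trans θ) M.reward γ s :=
  (measurable_pi_apply s).comp (M.measurable_optDiscounted hγ0 hγ1)

@[fun_prop]
lemma Model.measurable_gain (sref : S) : Measurable (M.gain sref) :=
  measurable_of_tendsto_metrizable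
    (fun n => (M.measurable_optDiscounted_apply (one_sub_inv_mem n).1 (one_sub_inv_mem n).2
      sref).const_mul _)
    (tendsto_pi_nhds.2 fun _ =>
      (tendsto_optGain M.reward_nonneg M.reward_le_one sref).comp tendsto_one_sub_inv)

variable {M} (hM : ∀ θ, Communicating (M.trans θ))

include hM

lemma Model.measurable_value (sref s : S) : Measurable fun θ => M.value sref θ s :=
  measurable_of_tendsto_metrizable
    (fun n => (M.measurable_optDiscounted_apply (one_sub_inv_mem n).1 (one_sub_inv_mem n).2 s).sub
      (M.measurable_optDiscounted_apply (one_sub_inv_mem n).1 (one_sub_inv_mem n).2 sref))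
    (tendsto_pi_nhds.2 fun θ => (tendsto_relValue M.reward_nonneg M.reward_le_one
      (hM θ) sref s).comp tendsto_one_sub_inv)

lemma Model.measurable_q (sref s : S) (a : A) : Measurable fun θ => M.q sref θ s a := by
  have h := Model.measurable_value hM sref
  simp only [Model.q, relQ]
  simp only [Model.value] at h
  fun_prop

end Measurability

/-! ### Extensions of trajectories and likelihoods -/

section Histories

variable {S A : Type*} {t : ℕ}

lemma History.extend_fst_castSucc (x : History S A t) (a : A) (s' : S) (i : Fin t) :
    (x.extend a s').1 i.castSucc = x.1 i := by
  simp [History.extend]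

lemma History.extend_fst_last (x : History S A t) (a : A) (s' : S) :
    (x.extend a s').1 (Fin.last t) = (x.2, a) := by
  simp [History.extend]

lemma History.extend_snd (x : History S A t) (a : A) (s' : S) : (x.extend a s').2 = s' := rfl

lemma History.state_self (x : History S A t) : x.state t = x.2 := by
  simp [History.state]

lemma History.state_extend_of_le (x : History S A t) (a : A) (s' : S) {i : ℕ} (hi : i ≤ t) :
    (x.extend a s').state i = x.state i := by
  rcases hi.lt_or_eq with h | rfl
  · simp only [History.state, h, h.trans (Nat.lt_succ_self t), dif_pos]
    exact congrArg Prod.fst (x.extend_fst_castSucc a s' ⟨i, h⟩)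
  · rw [History.state_self]
    simp only [History.state, Nat.lt_succ_self, dif_pos]
    exact congrArg Prod.fst (x.extend_fst_last a s')

lemma History.extend_inj {x y : History S A t} {a b : A} {s s' : S} :
    x.extend a s = y.extend b s' ↔ x = y ∧ a = b ∧ s = s' := by
  refine ⟨fun h => ?_, by rintro ⟨rfl, rfl, rfl⟩; rfl⟩
  have hl : (x.2, a) = (y.2, b) := by
    rw [← x.extend_fst_last a s, h, y.extend_fst_last]
  obtain ⟨h1, h2⟩ := Prod.mk.inj hl
  refine ⟨Prod.ext (funext fun i => ?_) h1, h2, congrArg Prod.snd h⟩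
  rw [← x.extend_fst_castSucc a s, h, y.extend_fst_castSucc]

lemma History.exists_eq_extend (y : History S A (t + 1)) :
    ∃ (x : History S A t) (a : A) (s' : S), y = x.extend a s' := by
  refine ⟨(fun i => y.1 i.castSucc, (y.1 (Fin.last t)).1), (y.1 (Fin.last t)).2, y.2, ?_⟩
  refine Prod.ext (funext fun i => ?_) rfl
  refine Fin.lastCases ?_ (fun i => ?_) i
  · rw [History.extend_fst_last]
  · rw [History.extend_fst_castSucc]

/-- The product of the probabilities of the transitions of a trajectory. -/
def transLik (P : S → A → PMF S) (x : History S A t) : ENNReal :=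
  ∏ i : Fin t, P (x.1 i).1 (x.1 i).2 (x.state ((i : ℕ) + 1))

lemma transLik_extend (P : S → A → PMF S) (x : History S A t) (a : A) (s' : S) :
    transLik P (x.extend a s') = transLik P x * P x.2 a s' := by
  unfold transLik
  rw [Fin.prod_univ_castSucc]
  congr 1
  · refine Finset.prod_congr rfl fun i _ => ?_
    rw [History.extend_fst_castSucc, Fin.val_castSucc, History.state_extend_of_le _ _ _ i.2]
  · rw [History.extend_fst_last, Fin.val_last, History.state_self, History.extend_snd]

lemma transLik_zero (P : S → A → PMF S) (x : History S A 0) : transLik P x = 1 := by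
  simp [transLik]

lemma histLaw_extend [Fintype S] [Fintype A] (P : S → A → PMF S) (π : Policy S A) (s : S)
    (x : History S A t) (a : A) (s' : S) :
    histLaw P π s (t + 1) (x.extend a s') = histLaw P π s t x * (π t x a * P x.2 a s') := by
  classical
  have : Fintype (History S A t) := inferInstance
  simp only [histLaw, PMF.bind_apply, PMF.map_apply, tsum_fintype, History.extend_inj, ite_and]
  simp

lemma histLaw_stationary_apply [Fintype S] [Fintype A] [DecidableEq S] (P : S → A → PMF S)
    (π : S → PMF A) (s : S) (x : History S A t) :
    histLaw P (stationary π) s t x = (if x.state 0 = s then 1 else 0) *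
      ∏ i : Fin t, P (x.1 i).1 (x.1 i).2 (x.state ((i : ℕ) + 1)) * π (x.1 i).1 (x.1 i).2 := by
  induction t with
  | zero =>
    obtain ⟨x, y⟩ := x
    have : x = Fin.elim0 := Subsingleton.elim _ _
    subst this
    simp [histLaw, History.state, PMF.pure_apply]
  | succ t ih =>
    obtain ⟨x, a, s', rfl⟩ := x.exists_eq_extend
    rw [histLaw_extend, ih, Fin.prod_univ_castSucc, History.state_extend_of_le _ _ _ (Nat.zero_le _),
      mul_assoc]
    congr 2
    · refine Finset.prod_congr rfl fun i _ => ?_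
      rw [History.extend_fst_castSucc, Fin.val_castSucc, History.state_extend_of_le _ _ _ i.2]
    · rw [History.extend_fst_last, Fin.val_last, History.state_self, History.extend_snd, mul_comm]
      rfl

end Histories

/-! ### Bayes' rule -/

section Bayes

variable {Θ : Type*} [MeasurableSpace Θ]

/-- The form without division also covers observations of probability zero, for which both sides
vanish whatever the update returns. -/
lemma smul_bayesUpdate (μ : Measure Θ) [IsProbabilityMeasure μ] {L : Θ → ENNReal}
    (hL : Measurable L) (hL1 : ∀ θ, L θ ≤ 1) :
    (∫⁻ θ, L θ ∂μ) • bayesUpdate μ L = μ.withDensity L := by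
  have htop : ∫⁻ θ, L θ ∂μ ≠ ⊤ := by
    refine ne_top_of_le_ne_top ENNReal.one_ne_top ((lintegral_mono hL1).trans ?_)
    simp
  unfold bayesUpdate
  by_cases h0 : ∫⁻ θ, L θ ∂μ = 0
  · have : L =ᵐ[μ] 0 := (lintegral_eq_zero_iff hL).1 h0
    rw [h0, zero_smul, withDensity_congr_ae this, withDensity_zero]
  · rw [if_neg (by simp [h0, htop]), smul_smul, ENNReal.mul_inv_cancel h0 htop, one_smul]

/-- Successive updates multiply likelihoods: the evidence of the product is the evidence of `ℓ`
times that of `L` under the first posterior. -/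
lemma lintegral_smul_bayesUpdate_comp {μ₀ μ : Measure Θ} [IsProbabilityMeasure μ] {ℓ L : Θ → ENNReal}
    (hℓ : Measurable ℓ) (hL : Measurable L) (hL1 : ∀ θ, L θ ≤ 1)
    (h : (∫⁻ θ, ℓ θ ∂μ₀) • μ = μ₀.withDensity ℓ) :
    (∫⁻ θ, ℓ θ * L θ ∂μ₀) • bayesUpdate μ L = μ₀.withDensity fun θ => ℓ θ * L θ := by
  have h1 : ∫⁻ θ, ℓ θ * L θ ∂μ₀ = (∫⁻ θ, ℓ θ ∂μ₀) * ∫⁻ θ, L θ ∂μ := by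
    rw [← smul_eq_mul, ← lintegral_smul_measure, h, lintegral_withDensity_eq_lintegral_mul _ hℓ hL]
    rfl
  rw [h1, mul_smul, smul_bayesUpdate μ hL hL1, ← withDensity_smul_measure, h]
  exact (withDensity_mul μ₀ hℓ hL).symm

end Bayes

/-! ### Posteriors and likelihoods of episodes -/

section Posterior

variable {S A Θ : Type*} [Fintype S] [Fintype A] [MeasurableSpace Θ] (M : Model S A Θ)

omit [Fintype S] [Fintype A] in
lemma Model.measurable_episodeLik (ep : ℕ → ℕ) {t : ℕ} (x : History S A t) (k : ℕ) :
    Measurable (M.episodeLik ep x k) :=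
  Finset.measurable_fun_prod _ fun _ _ => M.measurable_trans _ _ _

omit [Fintype S] [Fintype A] in
lemma Model.episodeLik_le_one (ep : ℕ → ℕ) {t : ℕ} (x : History S A t) (k : ℕ) (θ : Θ) :
    M.episodeLik ep x k θ ≤ 1 :=
  Finset.prod_le_one' fun _ _ => PMF.coe_le_one _ _

lemma startTime_succ (ep : ℕ → ℕ) {k : ℕ} (hk : 1 ≤ k) :
    startTime ep (k + 1) = startTime ep k + ep k :=
  Finset.sum_Ico_succ_top hk ep

lemma startTime_one (ep : ℕ → ℕ) : startTime ep 1 = 0 := by simp [startTime]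

omit [Fintype S] [Fintype A] in
lemma Model.prod_episodeLik (ep : ℕ → ℕ) {t k : ℕ} (hk : 1 ≤ k) (x : History S A t) (θ : Θ) :
    ∏ j ∈ Finset.Ico 1 k, M.episodeLik ep x j θ =
      ∏ i ∈ (Finset.univ : Finset (Fin t)).filter (fun i : Fin t => (i : ℕ) < startTime ep k),
        M.trans θ (x.1 i).1 (x.1 i).2 (x.state ((i : ℕ) + 1)) := by
  induction k, hk using Nat.le_induction with
  | base => simp [startTime_one]
  | succ k hk ih =>
    rw [Finset.prod_Ico_succ_top hk, ih, Model.episodeLik, ← Finset.prod_union]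
    · congr 1
      ext i
      have := startTime_succ ep hk
      simp only [Finset.mem_union, Finset.mem_filter, Finset.mem_univ, true_and]
      omega
    · rw [Finset.disjoint_left]
      intro i hi hi'
      simp only [Finset.mem_filter, Finset.mem_univ, true_and] at hi hi'
      omega

-- The episodes before the k-th tile the times before t_k, so at the start of an episode each online
-- transition has been used exactly once.
omit [Fintype S] [Fintype A] in
lemma Model.prod_episodeLik_eq_transLik (ep : ℕ → ℕ) {t k : ℕ} (hk : 1 ≤ k)
    (ht : startTime ep k = t) (x : History S A t) (θ : Θ) :
    ∏ j ∈ Finset.Ico 1 k, M.episodeLik ep x j θ = transLik (M.trans θ) x := by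
  rw [M.prod_episodeLik ep hk]
  unfold transLik
  congr 1
  ext i
  simp [ht]

variable [Nonempty A]

omit [Fintype S] in
lemma ofReal_softmax_le_one (q : S → A → ℝ) (β : ℝ) (s : S) (a : A) :
    ENNReal.ofReal (softmax q β s a) ≤ 1 :=
  (expertPolicy q β s).coe_le_one a

lemma Model.offlineLik_le_one (sref : S) (β : ℝ) {N : ℕ} (D : History S A N) (θ : Θ) :
    M.offlineLik sref β D θ ≤ 1 :=
  Finset.prod_le_one' fun _ _ => mul_le_one' (PMF.coe_le_one _ _) (ofReal_softmax_le_one _ _ _ _)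

/-- The indicator of the initial state is free of θ, which is why the likelihood in Bayes' rule may
omit it. -/
lemma Model.offlineLaw_apply [DecidableEq S] (sref : S) (β : ℝ) (sbar : S) (N : ℕ) (θ : Θ)
    (D : History S A N) :
    M.offlineLaw sref β sbar N θ D =
      (if D.state 0 = sbar then 1 else 0) * M.offlineLik sref β D θ :=
  histLaw_stationary_apply _ _ _ _

variable {M} (hM : ∀ θ, Communicating (M.trans θ))

include hM

lemma Model.measurable_offlineLik (sref : S) (β : ℝ) {N : ℕ} (D : History S A N) :
    Measurable (M.offlineLik sref β D) := by
  unfold Model.offlineLik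
  refine Finset.measurable_fun_prod _ fun i _ => (M.measurable_trans _ _ _).mul ?_
  refine ENNReal.measurable_ofReal.comp ?_
  unfold softmax
  have := Model.measurable_q hM sref
  refine Measurable.div ?_ (Finset.measurable_fun_sum _ fun a _ => ?_) <;>
    exact Real.measurable_exp.comp ((this _ _).const_mul _)

/-- The posterior is proportional to the likelihood of the observations. -/
lemma Model.smul_posterior (μ₀ : Measure Θ) [IsProbabilityMeasure μ₀] (sref : S) (β : ℝ)
    (ep : ℕ → ℕ) {N : ℕ} (D : History S A N) {t : ℕ} (x : History S A t) {k : ℕ} (hk : 1 ≤ k) :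
    (∫⁻ θ, M.offlineLik sref β D θ * ∏ j ∈ Finset.Ico 1 k, M.episodeLik ep x j θ ∂μ₀) •
      M.posterior μ₀ sref β ep D x k = μ₀.withDensity fun θ =>
        M.offlineLik sref β D θ * ∏ j ∈ Finset.Ico 1 k, M.episodeLik ep x j θ := by
  have hoff := Model.measurable_offlineLik hM sref β D
  induction k, hk using Nat.le_induction with
  | base =>
    simp only [Finset.Ico_self, Finset.prod_empty, mul_one]
    exact smul_bayesUpdate μ₀ hoff (M.offlineLik_le_one sref β D)
  | succ k hk ih =>
    simp only [Finset.prod_Ico_succ_top hk, ← mul_assoc]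
    obtain ⟨k, rfl⟩ : ∃ j, k = j + 1 := ⟨k - 1, by omega⟩
    exact lintegral_smul_bayesUpdate_comp
      (hoff.mul (Finset.measurable_fun_prod _ fun j _ => M.measurable_episodeLik ep x j))
      (M.measurable_episodeLik ep x _) (M.episodeLik_le_one ep x _) ih

end Posterior

/-! ### The law of a run as a product of the likelihood and a known factor -/

section Run

variable {S A Θ : Type*} [Fintype S] [DecidableEq S] [Fintype A] [MeasurableSpace Θ]
  {M : Model S A Θ} {sref : S} (O : PlanningOracle M sref) (μ₀ : Measure Θ)
  [IsProbabilityMeasure μ₀] (β : ℝ) (ep : ℕ → ℕ) {N : ℕ} (D : History S A N)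

/-- The trajectory and the policy for the next step, when the trajectory is `x` and the last policy
is `π`: a new policy is drawn at the start of an episode. -/
def nextPolicy {t : ℕ} (x : History S A t) (π : S → A) : PMF (History S A t × (S → A)) :=
  if startTime ep (episodeAt ep t) = t then
    (O.sampledPolicy (M.posterior μ₀ sref β ep D x (episodeAt ep t))).map fun π => (x, π)
  else PMF.pure (x, π)

lemma runLaw_succ (θ : Θ) (t : ℕ) :
    runLaw O μ₀ β ep D θ (t + 1) = (runLaw O μ₀ β ep D θ t).bind fun y =>
      (M.trans θ y.1.2 (y.2 y.1.2)).bind fun s' =>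
        nextPolicy O μ₀ β ep D (y.1.extend (y.2 y.1.2) s') y.2 := rfl

lemma nextPolicy_apply_of_ne {t : ℕ} {x : History S A t} {π : S → A}
    {z : History S A t × (S → A)} (hz : z.1 ≠ x) : nextPolicy O μ₀ β ep D x π z = 0 := by
  classical
  unfold nextPolicy
  split_ifs
  · rw [PMF.map_apply]
    refine ENNReal.tsum_eq_zero.2 fun π' => if_neg fun h => hz (by rw [h])
  · rw [PMF.pure_apply, if_neg fun h => hz (by rw [h])]

open Classical in
lemma nextPolicy_apply_of_start {t : ℕ} (ht : startTime ep (episodeAt ep t) = t)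
    (x : History S A t) (π : S → A) (z : History S A t × (S → A)) :
    nextPolicy O μ₀ β ep D x π z = (if z.1 = x then 1 else 0) *
      M.posterior μ₀ sref β ep D z.1 (episodeAt ep t) (O.solve ⁻¹' {z.2}) := by
  split_ifs with h
  · obtain ⟨z, π'⟩ := z
    obtain rfl : z = x := h
    rw [nextPolicy, if_pos ht, PMF.map_apply, tsum_fintype, one_mul, Finset.sum_eq_single π']
    · simp [PlanningOracle.sampledPolicy]
    · intro π'' _ hne
      simp [hne.symm]
    · simp
  · rw [zero_mul, nextPolicy_apply_of_ne O μ₀ β ep D h]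

/-- The environment enters a run only through its transitions; all choices of the algorithm are
functions of the observations and go into a factor free of θ. -/
lemma exists_runLaw_eq_transLik_mul (t : ℕ) :
    ∃ α : History S A t × (S → A) → ENNReal,
      ∀ θ y, runLaw O μ₀ β ep D θ t y = transLik (M.trans θ) y.1 * α y := by
  induction t with
  | zero =>
    -- At time 0 the law does not involve θ, so any parameter represents it.
    refine ⟨runLaw O μ₀ β ep D (Classical.choice
      (nonempty_of_isProbabilityMeasure μ₀)) 0, fun θ y => ?_⟩
    rw [transLik_zero, one_mul]
    rfl
  | succ t ih =>
    obtain ⟨α, hα⟩ := ih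
    refine ⟨fun z => ∑ y, ∑ s', α y * nextPolicy O μ₀ β ep D (y.1.extend (y.2 y.1.2) s') y.2 z,
      fun θ z => ?_⟩
    simp only [runLaw_succ, PMF.bind_apply, tsum_fintype, hα, Finset.mul_sum]
    refine Finset.sum_congr rfl fun y _ => Finset.sum_congr rfl fun s' _ => ?_
    by_cases hz : z.1 = y.1.extend (y.2 y.1.2) s'
    · rw [hz, transLik_extend]
      ring
    · rw [nextPolicy_apply_of_ne O μ₀ β ep D hz]
      simp

lemma episodeAt_zero (hep : ∀ k, 1 ≤ k → 1 ≤ ep k) : episodeAt ep 0 = 1 := by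
  -- The index 0 also has start time 0, but it does not affect the supremum.
  have : {k | startTime ep k < 0 + 1} = Set.Iic 1 := by
    ext k
    simp only [Set.mem_ofPred_eq, Set.mem_Iic]
    constructor
    · intro h
      by_contra! hk
      have h1 := hep 1 le_rfl
      have : ep 1 ≤ startTime ep k :=
        Finset.single_le_sum (f := ep) (fun _ _ => Nat.zero_le _) (Finset.mem_Ico.2 ⟨le_rfl, hk⟩)
      omega
    · intro h
      interval_cases k <;> simp [startTime]
  rw [episodeAt, numEpisodes, this, csSup_Iic]

/-- At the start of an episode the policy is drawn from the posterior. -/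
lemma exists_runLaw_eq_transLik_mul_posterior (hep : ∀ k, 1 ≤ k → 1 ≤ ep k) {t : ℕ}
    (ht : startTime ep (episodeAt ep t) = t) :
    ∃ α : History S A t → ENNReal, ∀ θ x π, runLaw O μ₀ β ep D θ t (x, π) =
      transLik (M.trans θ) x * (α x *
        M.posterior μ₀ sref β ep D x (episodeAt ep t) (O.solve ⁻¹' {π})) := by
  classical
  cases t with
  | zero =>
    refine ⟨fun x => M.init x.2, fun θ x π => ?_⟩
    obtain ⟨x, s⟩ := x
    obtain rfl : x = Fin.elim0 := Subsingleton.elim _ _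
    rw [transLik_zero, one_mul, episodeAt_zero ep hep]
    simp only [runLaw, PMF.bind_apply, PMF.map_apply, tsum_fintype, Prod.mk.injEq, true_and]
    rw [Finset.sum_eq_single s]
    · simp [PlanningOracle.sampledPolicy]
    · intro s' _ hs'
      simp [hs'.symm]
    · simp
  | succ t =>
    obtain ⟨α, hα⟩ := exists_runLaw_eq_transLik_mul O μ₀ β ep D t
    refine ⟨fun x => ∑ y, ∑ s', α y * if x = y.1.extend (y.2 y.1.2) s' then 1 else 0,
      fun θ x π => ?_⟩
    simp only [runLaw_succ, PMF.bind_apply, tsum_fintype, hα, Finset.mul_sum, Finset.sum_mul]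
    refine Finset.sum_congr rfl fun y _ => Finset.sum_congr rfl fun s' _ => ?_
    rw [nextPolicy_apply_of_start O μ₀ β ep D ht]
    by_cases hz : x = y.1.extend (y.2 y.1.2) s'
    · simp only [hz, if_true, transLik_extend]
      ring
    · simp [hz]

end Run

/-! ### Bounded measurable functions -/

/-- `f` is measurable and bounded. -/
def BddMeasurable {Ω : Type*} [MeasurableSpace Ω] (f : Ω → ℝ) : Prop :=
  Measurable f ∧ ∃ C, ∀ ω, |f ω| ≤ C

namespace BddMeasurable

variable {Ω Ω' : Type*} [MeasurableSpace Ω] [MeasurableSpace Ω'] {f g : Ω → ℝ}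

lemma const (c : ℝ) : BddMeasurable fun _ : Ω => c := ⟨measurable_const, |c|, fun _ => le_rfl⟩

lemma add (hf : BddMeasurable f) (hg : BddMeasurable g) : BddMeasurable fun ω => f ω + g ω := by
  obtain ⟨hf, C, hC⟩ := hf
  obtain ⟨hg, C', hC'⟩ := hg
  exact ⟨hf.add hg, C + C', fun ω => (abs_add_le _ _).trans (add_le_add (hC ω) (hC' ω))⟩

lemma mul (hf : BddMeasurable f) (hg : BddMeasurable g) : BddMeasurable fun ω => f ω * g ω := by
  obtain ⟨hf, C, hC⟩ := hf
  obtain ⟨hg, C', hC'⟩ := hg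
  refine ⟨hf.mul hg, C * C', fun ω => ?_⟩
  rw [abs_mul]
  exact mul_le_mul (hC ω) (hC' ω) (abs_nonneg _) ((abs_nonneg _).trans (hC ω))

lemma const_mul (hf : BddMeasurable f) (c : ℝ) : BddMeasurable fun ω => c * f ω :=
  (const c).mul hf

lemma sub (hf : BddMeasurable f) (hg : BddMeasurable g) : BddMeasurable fun ω => f ω - g ω := by
  simpa [sub_eq_add_neg] using hf.add (hg.const_mul (-1))

lemma sum {ι : Type*} (s : Finset ι) {f : ι → Ω → ℝ} (hf : ∀ i ∈ s, BddMeasurable (f i)) :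
    BddMeasurable fun ω => ∑ i ∈ s, f i ω := by
  classical
  induction s using Finset.induction_on with
  | empty => simpa using const 0
  | insert i s hi ih =>
    simp only [Finset.sum_insert hi]
    exact (hf i (Finset.mem_insert_self i s)).add
      (ih fun j hj => hf j (Finset.mem_insert_of_mem hj))

lemma comp (hf : BddMeasurable f) {h : Ω' → Ω} (hh : Measurable h) :
    BddMeasurable fun ω => f (h ω) :=
  ⟨hf.1.comp hh, hf.2.choose, fun ω => hf.2.choose_spec (h ω)⟩

lemma ite {s : Set Ω} [DecidablePred (· ∈ s)] (hs : MeasurableSet s) (hf : BddMeasurable f)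
    (hg : BddMeasurable g) : BddMeasurable fun ω => if ω ∈ s then f ω else g ω := by
  obtain ⟨hf, C, hC⟩ := hf
  obtain ⟨hg, C', hC'⟩ := hg
  refine ⟨Measurable.ite hs hf hg, max C C', fun ω => ?_⟩
  dsimp only
  split_ifs
  · exact (hC ω).trans (le_max_left _ _)
  · exact (hC' ω).trans (le_max_right _ _)

lemma integrable (hf : BddMeasurable f) (μ : Measure Ω) [IsFiniteMeasure μ] : Integrable f μ :=
  Integrable.of_bound hf.1.aestronglyMeasurable hf.2.choose
    (Eventually.of_forall hf.2.choose_spec)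

lemma of_mem_Icc (hf : Measurable f) {a b : ℝ} (h : ∀ ω, f ω ∈ Set.Icc a b) : BddMeasurable f :=
  ⟨hf, max |a| |b|, fun ω => abs_le_max_abs_abs (h ω).1 (h ω).2⟩

lemma toReal_pmf {α : Type*} {p : Ω → PMF α} {a : α} (h : Measurable fun ω => p ω a) :
    BddMeasurable fun ω => (p ω a).toReal :=
  of_mem_Icc (a := 0) (b := 1) h.ennreal_toReal fun ω => ⟨ENNReal.toReal_nonneg,
    ENNReal.toReal_le_of_le_ofReal zero_le_one (by simpa using (p ω).coe_le_one a)⟩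

lemma expect {α : Type*} [Fintype α] {p : Ω → PMF α} {f : Ω → α → ℝ}
    (hp : ∀ a, Measurable fun ω => p ω a) (hf : ∀ a, BddMeasurable fun ω => f ω a) :
    BddMeasurable fun ω => expect (p ω) (f ω) :=
  sum _ fun a _ => (toReal_pmf (hp a)).mul (hf a)

end BddMeasurable

/-! ### Episodes -/

section Episodes

variable {ep : ℕ → ℕ}

lemma startTime_mono (ep : ℕ → ℕ) : Monotone (startTime ep) := fun _ _ h =>
  Finset.sum_le_sum_of_subset (Finset.Ico_subset_Ico_right h)

variable (hep : ∀ k, 1 ≤ k → 1 ≤ ep k)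

include hep

lemma le_startTime_add_one (k : ℕ) : k ≤ startTime ep k + 1 := by
  have : ∑ _l ∈ Finset.Ico 1 k, 1 ≤ startTime ep k :=
    Finset.sum_le_sum fun l hl => hep l (Finset.mem_Ico.1 hl).1
  simp at this
  omega

/-- On ℕ the `sSup` of an unbounded set is 0; this bound, due to episodes of positive length, makes
`numEpisodes` a true maximum. -/
lemma bddAbove_startTime_lt (T : ℕ) : BddAbove {k | startTime ep k < T} :=
  ⟨T, fun k hk => by have := le_startTime_add_one hep k; simp at hk; omega⟩

lemma startTime_numEpisodes_lt {T : ℕ} (hT : 1 ≤ T) : startTime ep (numEpisodes ep T) < T :=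
  Nat.sSup_mem (s := {k | startTime ep k < T}) ⟨1, show startTime ep 1 < T by rw [startTime_one]; omega⟩
    (bddAbove_startTime_lt hep T)

lemma le_numEpisodes_iff {T : ℕ} (hT : 1 ≤ T) {k : ℕ} :
    k ≤ numEpisodes ep T ↔ startTime ep k < T :=
  ⟨fun h => (startTime_mono ep h).trans_lt (startTime_numEpisodes_lt hep hT),
    fun h => le_csSup (bddAbove_startTime_lt hep T) h⟩

lemma one_le_numEpisodes {T : ℕ} (hT : 1 ≤ T) : 1 ≤ numEpisodes ep T :=
  (le_numEpisodes_iff hep hT).2 (by rw [startTime_one]; omega)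

lemma episodeAt_eq {t k : ℕ} (h1 : startTime ep k ≤ t) (h2 : t < startTime ep (k + 1)) :
    episodeAt ep t = k := by
  refine le_antisymm (not_lt.1 fun h => ?_) ?_
  · have := (le_numEpisodes_iff hep (Nat.le_add_left 1 t)).1 (Nat.succ_le_of_lt h)
    rw [Nat.succ_eq_add_one] at this
    omega
  · exact (le_numEpisodes_iff hep (Nat.le_add_left 1 t)).2 (by omega)

omit hep in
/-- A sum over `t < T` as a sum over the episodes. -/
lemma sum_range_eq_sum_episodes_aux (ep : ℕ → ℕ) (T : ℕ) (f : ℕ → ℝ) {k : ℕ} (hk : 1 ≤ k) :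
    ∑ t ∈ Finset.range (min (startTime ep k) T), f t =
      ∑ j ∈ Finset.Ico 1 k, ∑ m ∈ Finset.range (min (ep j) (T - startTime ep j)),
        f (startTime ep j + m) := by
  induction k, hk using Nat.le_induction with
  | base => simp [startTime_one]
  | succ k hk ih =>
    rw [Finset.sum_Ico_succ_top hk, ← ih, startTime_succ ep hk]
    rcases le_total T (startTime ep k) with h | h
    -- The horizon lies before this episode, and truncated subtraction makes its contribution empty.
    · rw [min_eq_right (by omega), min_eq_right h, Nat.sub_eq_zero_of_le h]
      simp
    · have h' : min (startTime ep k + ep k) T =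
          startTime ep k + min (ep k) (T - startTime ep k) := by omega
      rw [h', Finset.sum_range_add, min_eq_left h]

lemma sum_range_eq_sum_episodes {T : ℕ} (hT : 1 ≤ T) (f : ℕ → ℝ) :
    ∑ t ∈ Finset.range T, f t =
      ∑ k ∈ Finset.Icc 1 (numEpisodes ep T),
        ∑ m ∈ Finset.range (min (ep k) (T - startTime ep k)), f (startTime ep k + m) := by
  have h := sum_range_eq_sum_episodes_aux ep T f (Nat.le_add_left 1 (numEpisodes ep T))
  have hlt : T ≤ startTime ep (numEpisodes ep T + 1) :=
    not_lt.1 fun hlt => absurd ((le_numEpisodes_iff hep hT).2 hlt) (by omega)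
  rw [min_eq_right hlt] at h
  exact h

end Episodes

/-! ### Evolution of a run during an episode -/

section Extension

variable {S A : Type*} [Fintype S] [Fintype A]

/-- Law of the extension of the trajectory `x` by `m` steps of the deterministic policy `f`. -/
def extLaw (P : S → A → PMF S) (f : S → A) {t : ℕ} (x : History S A t) :
    (m : ℕ) → PMF (History S A (t + m))
  | 0 => PMF.pure x
  | m + 1 => (extLaw P f x m).bind fun y => (P y.2 (f y.2)).map fun s' => y.extend (f y.2) s'

variable {P : S → A → PMF S} {f : S → A} {t : ℕ} {x : History S A t}

lemma expect_extLaw_zero (g : History S A (t + 0) → ℝ) : expect (extLaw P f x 0) g = g x :=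
  expect_pure _ _

lemma expect_extLaw_succ (m : ℕ) (g : History S A (t + (m + 1)) → ℝ) :
    expect (extLaw P f x (m + 1)) g = expect (extLaw P f x m) fun y =>
      expect (P y.2 (f y.2)) fun s' => g (y.extend (f y.2) s') := by
  simp only [extLaw, expect_bind, expect_map]

/-- Telescoping along the extension of a trajectory. -/
lemma sum_expect_extLaw_sub (W : S → ℝ) (n : ℕ) :
    ∑ m ∈ Finset.range n, expect (extLaw P f x m) (fun y => expect (P y.2 (f y.2)) W - W y.2) =
      expect (extLaw P f x n) (fun y => W y.2) - W x.2 := by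
  induction n with
  | zero => simp [expect_extLaw_zero]
  | succ n ih =>
    rw [Finset.sum_range_succ, ih, expect_sub, expect_extLaw_succ]
    simp only [History.extend_snd]
    ring

lemma measurable_extLaw {Θ : Type*} [MeasurableSpace Θ] {P : Θ → S → A → PMF S}
    (hP : ∀ s a s', Measurable fun θ => P θ s a s') (f : S → A) {t : ℕ} (x : History S A t)
    (m : ℕ) (y : History S A (t + m)) : Measurable fun θ => extLaw (P θ) f x m y := by
  classical
  induction m with
  | zero => exact measurable_const
  | succ m ih =>
    simp only [extLaw, PMF.bind_apply, PMF.map_apply, tsum_fintype]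
    refine Finset.measurable_fun_sum _ fun z _ => (ih z).mul
      (Finset.measurable_fun_sum _ fun s' _ => ?_)
    split_ifs
    · exact hP _ _ _
    · exact measurable_const

end Extension

/-! ### Expectations along a run -/

section Run

variable {S A Θ : Type*} [Fintype S] [DecidableEq S] [Fintype A] [MeasurableSpace Θ]
  {M : Model S A Θ} {sref : S} (O : PlanningOracle M sref) (μ₀ : Measure Θ)
  [IsProbabilityMeasure μ₀] (β : ℝ) (ep : ℕ → ℕ) {N : ℕ} (D : History S A N)

/-- `g` ignores the policy component, so a possible redraw of the policy integrates out. -/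
lemma expect_runLaw_succ (θ : Θ) (t : ℕ) {g : History S A (t + 1) × (S → A) → ℝ}
    {h : History S A t → A → S → ℝ}
    (hg : ∀ x a s' π, g (History.extend x a s', π) = h x a s') :
    expect (runLaw O μ₀ β ep D θ (t + 1)) g = expect (runLaw O μ₀ β ep D θ t) fun y =>
      expect (M.trans θ y.1.2 (y.2 y.1.2)) fun s' => h y.1 (y.2 y.1.2) s' := by
  rw [runLaw_succ, expect_bind]
  simp only [expect_bind]
  refine congrArg _ (funext fun y => congrArg _ (funext fun s' => ?_))
  rw [← expect_const (nextPolicy O μ₀ β ep D (y.1.extend (y.2 y.1.2) s') y.2)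
    (h y.1 (y.2 y.1.2) s')]
  refine expect_congr_of_support _ fun z hz => ?_
  have hz1 : z.1 = y.1.extend (y.2 y.1.2) s' := by
    by_contra hne
    exact hz (nextPolicy_apply_of_ne O μ₀ β ep D hne)
  rw [← hg _ _ _ z.2, ← hz1]

/-- During an episode the policy is kept. -/
lemma expect_runLaw_add (θ : Θ) (t m : ℕ)
    (hm : ∀ j, 1 ≤ j → j ≤ m → startTime ep (episodeAt ep (t + j)) ≠ t + j)
    (g : History S A (t + m) × (S → A) → ℝ) :
    expect (runLaw O μ₀ β ep D θ (t + m)) g = expect (runLaw O μ₀ β ep D θ t) fun y =>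
      expect (extLaw (M.trans θ) y.2 y.1 m) fun x => g (x, y.2) := by
  induction m with
  | zero => simp [expect_extLaw_zero]
  | succ m ih =>
    have hm' := hm (m + 1) (Nat.le_add_left 1 m) le_rfl
    rw [← add_assoc] at hm'
    change expect (runLaw O μ₀ β ep D θ (t + m + 1)) g = _
    rw [runLaw_succ, expect_bind, ih fun j h1 h2 => hm j h1 (h2.trans (Nat.le_succ m))]
    simp only [expect_bind, nextPolicy, if_neg hm', expect_pure, expect_extLaw_succ]

lemma expect_runLaw_episode (hep : ∀ k, 1 ≤ k → 1 ≤ ep k) (θ : Θ) {k m : ℕ} (hk : 1 ≤ k)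
    (hm : m < ep k) (g : History S A (startTime ep k + m) × (S → A) → ℝ) :
    expect (runLaw O μ₀ β ep D θ (startTime ep k + m)) g =
      expect (runLaw O μ₀ β ep D θ (startTime ep k)) fun y =>
        expect (extLaw (M.trans θ) y.2 y.1 m) fun x => g (x, y.2) := by
  refine expect_runLaw_add O μ₀ β ep D θ _ m (fun j h1 h2 => ?_) g
  rw [episodeAt_eq hep (Nat.le_add_right _ j) (by rw [startTime_succ ep hk]; omega)]
  omega

lemma measurable_runLaw (t : ℕ) (y : History S A t × (S → A)) :
    Measurable fun θ => runLaw O μ₀ β ep D θ t y := by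
  obtain ⟨α, hα⟩ := exists_runLaw_eq_transLik_mul O μ₀ β ep D t
  simp only [hα]
  exact (Finset.measurable_fun_prod _ fun i _ => M.measurable_trans _ _ _).mul_const _

-- There are finitely many policies and the oracle has measurable fibres, so composition with it is
-- a finite sum over fibres.
variable {O} in
lemma BddMeasurable.of_solve_comp {Ω : Type*} [MeasurableSpace Ω] {h : Ω → Θ} (hh : Measurable h)
    {F : (S → A) → Ω → ℝ} (hF : ∀ π, BddMeasurable (F π)) :
    BddMeasurable fun ω => F (O.solve (h ω)) ω := by
  classical
  have : (fun ω => F (O.solve (h ω)) ω) =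
      fun ω => ∑ π, (if ω ∈ h ⁻¹' (O.solve ⁻¹' {π}) then F π ω else 0) := by
    funext θ
    simp
  rw [this]
  exact BddMeasurable.sum _ fun π _ =>
    BddMeasurable.ite (hh (O.measurableSet_fiber π)) (hF π) (BddMeasurable.const 0)

/-- The second coordinate acts only through its policy, whose law is that of the policy drawn by the
algorithm. -/
lemma integral_prod_solve (μ : Measure Θ) [IsProbabilityMeasure μ] {F : (S → A) → Θ → ℝ}
    (hF : ∀ π, BddMeasurable (F π)) :
    ∫ p, F (O.solve p.2) p.1 ∂(μ.prod μ) =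
      ∑ π, (μ (O.solve ⁻¹' {π})).toReal * ∫ θ, F π θ ∂μ := by
  classical
  have h1 (p : Θ × Θ) : F (O.solve p.2) p.1 =
      ∑ π, F π p.1 * (O.solve ⁻¹' {π}).indicator 1 p.2 := by
    simp [Set.indicator_apply]
  have hind (π : S → A) : BddMeasurable ((O.solve ⁻¹' {π}).indicator (1 : Θ → ℝ)) := by
    have := BddMeasurable.ite (O.measurableSet_fiber π) (BddMeasurable.const (1 : ℝ))
      (BddMeasurable.const 0)
    convert this using 1
    funext θ
    simp [Set.indicator_apply]
  simp_rw [h1]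
  rw [integral_finsetSum _ fun π _ =>
    (((hF π).comp measurable_fst).mul ((hind π).comp measurable_snd)).integrable _]
  refine Finset.sum_congr rfl fun π _ => ?_
  rw [integral_prod_mul (F π) ((O.solve ⁻¹' {π}).indicator (1 : Θ → ℝ)),
    integral_indicator_one (O.measurableSet_fiber π), mul_comm]
  rfl

end Run

/-! ### Expectations under the joint law of parameter, dataset and run -/

section Joint

variable {S A Θ : Type*} [Fintype S] [DecidableEq S] [Fintype A] [Nonempty A] [MeasurableSpace Θ]
  {M : Model S A Θ} {sref : S} (O : PlanningOracle M sref) (μ₀ : Measure Θ)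
  [IsProbabilityMeasure μ₀] (β : ℝ) (sbar : S) {N : ℕ} (ep : ℕ → ℕ)

/-- Expectation of `g` given `θ`, over the offline dataset and the run up to time `t`. -/
def condExpect (t : ℕ) (θ : Θ) (g : History S A N → History S A t × (S → A) → ℝ) : ℝ :=
  expect (M.offlineLaw sref β sbar N θ) fun D => expect (runLaw O μ₀ β ep D θ t) (g D)

/-- Expectation of `g` over the parameter, the offline dataset and the run up to time `t`. -/
def jointExpect (t : ℕ) (g : Θ → History S A N → History S A t × (S → A) → ℝ) : ℝ :=
  ∫ θ, condExpect O μ₀ β sbar ep t θ (g θ) ∂μ₀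

variable {O β sbar ep} (hM : ∀ θ, Communicating (M.trans θ))

include hM in
lemma measurable_offlineLaw (D : History S A N) :
    Measurable fun θ => M.offlineLaw sref β sbar N θ D := by
  simp only [Model.offlineLaw_apply]
  exact (Model.measurable_offlineLik hM sref β D).const_mul _

section Linear

variable {t : ℕ} {g h : Θ → History S A N → History S A t × (S → A) → ℝ}
  (hg : ∀ D y, BddMeasurable fun θ => g θ D y) (hh : ∀ D y, BddMeasurable fun θ => h θ D y)

include hM hg

lemma bddMeasurable_condExpect :
    BddMeasurable fun θ => condExpect O μ₀ β sbar ep t θ (g θ) :=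
  BddMeasurable.expect (measurable_offlineLaw hM) fun D =>
    BddMeasurable.expect (measurable_runLaw O μ₀ β ep D t) fun y => hg D y

include hh

lemma jointExpect_add :
    jointExpect O μ₀ β sbar ep t (fun θ D y => g θ D y + h θ D y) =
      jointExpect O μ₀ β sbar ep t g + jointExpect O μ₀ β sbar ep t h := by
  unfold jointExpect
  rw [← integral_add ((bddMeasurable_condExpect μ₀ hM hg).integrable μ₀)
    ((bddMeasurable_condExpect μ₀ hM hh).integrable μ₀)]
  simp only [condExpect, expect_add]

lemma jointExpect_mono (hgh : ∀ θ D y, g θ D y ≤ h θ D y) :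
    jointExpect O μ₀ β sbar ep t g ≤ jointExpect O μ₀ β sbar ep t h :=
  integral_mono ((bddMeasurable_condExpect μ₀ hM hg).integrable μ₀)
    ((bddMeasurable_condExpect μ₀ hM hh).integrable μ₀) fun θ =>
      expect_mono _ fun D => expect_mono _ fun y => hgh θ D y

end Linear

lemma jointExpect_const_mul {t : ℕ} (c : ℝ)
    (g : Θ → History S A N → History S A t × (S → A) → ℝ) :
    jointExpect O μ₀ β sbar ep t (fun θ D y => c * g θ D y) =
      c * jointExpect O μ₀ β sbar ep t g := by
  unfold jointExpect
  rw [← integral_const_mul]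
  simp only [condExpect, expect_const_mul]

lemma jointExpect_nonneg {t : ℕ} {g : Θ → History S A N → History S A t × (S → A) → ℝ}
    (hg : ∀ θ D y, 0 ≤ g θ D y) : 0 ≤ jointExpect O μ₀ β sbar ep t g :=
  integral_nonneg fun θ => expect_nonneg _ fun D => expect_nonneg _ fun y => hg θ D y

include hM in
lemma jointExpect_sum {t : ℕ} {ι : Type*} (s : Finset ι)
    {g : ι → Θ → History S A N → History S A t × (S → A) → ℝ}
    (hg : ∀ i ∈ s, ∀ D y, BddMeasurable fun θ => g i θ D y) :
    jointExpect O μ₀ β sbar ep t (fun θ D y => ∑ i ∈ s, g i θ D y) =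
      ∑ i ∈ s, jointExpect O μ₀ β sbar ep t (g i) := by
  unfold jointExpect
  rw [← integral_finsetSum _ fun i hi =>
    (bddMeasurable_condExpect μ₀ hM (hg i hi)).integrable μ₀]
  simp only [condExpect, expect_sum]

variable (O β sbar ep)

/-- At the start of an episode, given the observations, the parameter and the sampled parameter are
independent with law the posterior. -/
lemma exists_jointExpect_eq (hM : ∀ θ, Communicating (M.trans θ)) (hep : ∀ k, 1 ≤ k → 1 ≤ ep k)
    {k : ℕ} (hk : 1 ≤ k) :
    ∃ w : History S A N → History S A (startTime ep k) → ℝ, (∀ D x, 0 ≤ w D x) ∧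
      ∀ H : Θ → History S A N → History S A (startTime ep k) × (S → A) → ℝ,
        (∀ D y, BddMeasurable fun θ => H θ D y) →
        jointExpect O μ₀ β sbar ep (startTime ep k) H =
          ∑ D, ∑ x, w D x * ∫ p, H p.1 D (x, O.solve p.2)
            ∂((M.posterior μ₀ sref β ep D x k).prod (M.posterior μ₀ sref β ep D x k)) := by
  have hk' : episodeAt ep (startTime ep k) = k :=
    episodeAt_eq hep le_rfl (by rw [startTime_succ ep hk]; have := hep k hk; omega)
  choose α hα using fun D : History S A N =>
    exists_runLaw_eq_transLik_mul_posterior O μ₀ β ep D hep (t := startTime ep k) (by rw [hk'])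
  rw [hk'] at hα
  let lik (D : History S A N) (x : History S A (startTime ep k)) (θ : Θ) : ENNReal :=
    M.offlineLik sref β D θ * transLik (M.trans θ) x
  have htl (x : History S A (startTime ep k)) : Measurable fun θ => transLik (M.trans θ) x :=
    Finset.measurable_fun_prod _ fun i _ => M.measurable_trans _ _ _
  have hlikm (D x) : Measurable (lik D x) := (Model.measurable_offlineLik hM sref β D).mul (htl x)
  have hlik1 (D x θ) : lik D x θ ≤ 1 := mul_le_one' (M.offlineLik_le_one sref β D θ)
    (Finset.prod_le_one' fun _ _ => PMF.coe_le_one _ _)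
  have hpost (D x) : (∫⁻ θ, lik D x θ ∂μ₀) • M.posterior μ₀ sref β ep D x k =
      μ₀.withDensity (lik D x) := by
    have := Model.smul_posterior hM μ₀ sref β ep D x hk
    simpa only [M.prod_episodeLik_eq_transLik ep hk rfl] using this
  -- The part of the joint law that is free of θ; multiplied by the evidence of the observations it
  -- gives the weight `w`.
  let c (D : History S A N) (x : History S A (startTime ep k)) : ENNReal :=
    (if D.state 0 = sbar then 1 else 0) * α D x
  refine ⟨fun D x => (c D x * ∫⁻ θ, lik D x θ ∂μ₀).toReal,
    fun D x => ENNReal.toReal_nonneg, fun H hH => ?_⟩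
  -- Two posteriors appear for different reasons: the probability of `π` is the draw of the
  -- algorithm, while the integral over θ comes from Bayes' rule.
  have hterm (D x π) : ∫ θ, (M.offlineLaw sref β sbar N θ D).toReal *
      ((runLaw O μ₀ β ep D θ (startTime ep k) (x, π)).toReal * H θ D (x, π)) ∂μ₀ =
      (c D x * ∫⁻ θ, lik D x θ ∂μ₀).toReal *
        ((M.posterior μ₀ sref β ep D x k (O.solve ⁻¹' {π})).toReal *
          ∫ θ, H θ D (x, π) ∂(M.posterior μ₀ sref β ep D x k)) := by
    have h1 := integral_withDensity_eq_integral_toReal_smul (μ := μ₀) (hlikm D x)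
      (Eventually.of_forall fun θ => (hlik1 D x θ).trans_lt ENNReal.one_lt_top)
      fun θ => H θ D (x, π)
    rw [← hpost, integral_smul_measure] at h1
    rw [ENNReal.toReal_mul]
    calc _ = ∫ θ, (c D x).toReal *
          (M.posterior μ₀ sref β ep D x k (O.solve ⁻¹' {π})).toReal *
          ((lik D x θ).toReal • H θ D (x, π)) ∂μ₀ := by
          refine integral_congr_ae (Eventually.of_forall fun θ => ?_)
          simp only [hα, M.offlineLaw_apply, c, lik, ENNReal.toReal_mul, smul_eq_mul]
          ring
      _ = _ := by
          rw [integral_const_mul, ← h1, smul_eq_mul]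
          ring
  have hint (D y) : BddMeasurable fun θ => (M.offlineLaw sref β sbar N θ D).toReal *
      ((runLaw O μ₀ β ep D θ (startTime ep k) y).toReal * H θ D y) :=
    (BddMeasurable.toReal_pmf (measurable_offlineLaw hM D)).mul
      ((BddMeasurable.toReal_pmf (measurable_runLaw O μ₀ β ep D _ y)).mul (hH D y))
  simp only [jointExpect, condExpect, expect, Finset.mul_sum (s := Finset.univ)]
  rw [integral_finsetSum _ fun D _ => (BddMeasurable.sum _ fun y _ => hint D y).integrable μ₀]
  refine Finset.sum_congr rfl fun D _ => ?_
  rw [integral_finsetSum _ fun y _ => (hint D y).integrable μ₀, Fintype.sum_prod_type]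
  refine Finset.sum_congr rfl fun x _ => ?_
  rw [integral_prod_solve O _ (F := fun π θ => H θ D (x, π)) fun π => hH D (x, π),
    Finset.mul_sum]
  exact Finset.sum_congr rfl fun π _ => hterm D x π

end Joint

/-! ### Counting the visits of a sequence -/

section Visits

variable {ι : Type*}

open Classical in
/-- The number of visits of the sequence `z` to `p` before time `j`. -/
def visitCount (z : ℕ → ι) (j : ℕ) (p : ι) : ℕ := ((Finset.range j).filter fun i => z i = p).card

open Classical in
lemma visitCount_succ (z : ℕ → ι) (j : ℕ) (p : ι) :
    visitCount z (j + 1) p = visitCount z j p + if z j = p then 1 else 0 := by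
  unfold visitCount
  rw [Finset.range_add_one, Finset.filter_insert]
  split_ifs with h
  · rw [Finset.card_insert_of_notMem (by simp)]
  · rfl

lemma visitCount_mono (z : ℕ → ι) (p : ι) : Monotone fun j => visitCount z j p :=
  fun _ _ h => by
    classical
    exact Finset.card_le_card (Finset.filter_subset_filter _ (Finset.range_mono h))

lemma visitCount_congr {z z' : ℕ → ι} {j : ℕ} (h : ∀ i < j, z i = z' i) (p : ι) :
    visitCount z j p = visitCount z' j p := by
  classical
  unfold visitCount
  congr 1
  refine Finset.filter_congr fun i hi => ?_
  rw [h i (Finset.mem_range.1 hi)]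

lemma sum_visitCount [Fintype ι] (z : ℕ → ι) (j : ℕ) : ∑ p, visitCount z j p = j := by
  classical
  have := Finset.card_eq_sum_card_fiberwise (f := z) (s := Finset.range j) (t := Finset.univ)
    (fun _ _ => Finset.mem_coe.2 (Finset.mem_univ _))
  rw [Finset.card_range] at this
  refine Eq.trans (Finset.sum_congr rfl fun p _ => ?_) this.symm
  unfold visitCount
  congr!

variable [Fintype ι]

/-- Concavity of the logarithm, for the numbers of visits. -/
lemma sum_log_visitCount_le [Nonempty ι] (z : ℕ → ι) (T : ℕ) :
    ∑ p, Real.log (visitCount z T p + 1) ≤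
      Fintype.card ι * Real.log (T / Fintype.card ι + 1) := by
  have hc : (0 : ℝ) < Fintype.card ι := by exact_mod_cast Fintype.card_pos
  have h := strictConcaveOn_log_Ioi.concaveOn.le_map_sum (t := Finset.univ)
    (w := fun _ : ι => (Fintype.card ι : ℝ)⁻¹) (p := fun p => (visitCount z T p : ℝ) + 1)
    (fun _ _ => by positivity) (by simp [hc.ne']) (fun p _ => by simp; positivity)
  have hs : ∑ p, (visitCount z T p : ℝ) = T := by exact_mod_cast sum_visitCount z T
  simp only [smul_eq_mul, ← Finset.mul_sum, Finset.sum_add_distrib, hs, Finset.sum_const,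
    Finset.card_univ, nsmul_eq_mul, mul_one, mul_add] at h
  rw [inv_mul_le_iff₀ hc] at h
  rwa [inv_mul_eq_div, mul_inv_cancel₀ hc.ne'] at h

/-- Successive visits to the same p contribute 1, 1/2, 1/3, and so on. -/
lemma sum_inv_visitCount (z : ℕ → ι) (T : ℕ) :
    ∑ i ∈ Finset.range T, ((visitCount z i (z i) : ℝ) + 1)⁻¹ =
      ∑ p, (harmonic (visitCount z T p) : ℝ) := by
  classical
  induction T with
  | zero => simp [visitCount]
  | succ T ih =>
    rw [Finset.sum_range_succ, ih]
    have (p : ι) : (harmonic (visitCount z (T + 1) p) : ℝ) = harmonic (visitCount z T p) +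
        if z T = p then ((visitCount z T p : ℝ) + 1)⁻¹ else 0 := by
      rw [visitCount_succ]
      split_ifs
      · rw [harmonic_succ]
        push_cast
        rfl
      · simp
    simp only [this, Finset.sum_add_distrib]
    simp

lemma sum_inv_visitCount_le [Nonempty ι] (z : ℕ → ι) (T : ℕ) :
    ∑ i ∈ Finset.range T, ((visitCount z i (z i) : ℝ) + 1)⁻¹ ≤
      Fintype.card ι * (1 + Real.log (T / Fintype.card ι + 1)) := by
  rw [sum_inv_visitCount, mul_add, mul_one]
  calc _ ≤ ∑ p, (1 + Real.log (visitCount z T p + 1)) := by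
        refine Finset.sum_le_sum fun p _ => (harmonic_le_one_add_log _).trans ?_
        -- Unvisited points use `Real.log 0 = 0`.
        rcases Nat.eq_zero_or_pos (visitCount z T p) with h | h
        · simp [h]
        · have : (0 : ℝ) < visitCount z T p := by exact_mod_cast h
          linarith [Real.log_le_log this (by linarith : _ ≤ (visitCount z T p : ℝ) + 1)]
    _ = Fintype.card ι + ∑ p, Real.log (visitCount z T p + 1) := by
        simp [Finset.sum_add_distrib]
    _ ≤ _ := by linarith [sum_log_visitCount_le z T]

/-- At time `i` the number of visits to `z i` has more than doubled since the start of the current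
episode. -/
def HasDoubled (ep : ℕ → ℕ) (z : ℕ → ι) (i : ℕ) : Prop :=
  2 * visitCount z (startTime ep (episodeAt ep i)) (z i) < visitCount z i (z i) + 1

-- Let n be the number of visits to p. In an episode with a doubled visit to p, n + 1 at least
-- doubles from start to end, so log₂(n + 1) grows by at least 1; this pays for all steps of the
-- episode, at most the maximal length.
open Classical in
omit [Fintype ι] in
lemma sum_hasDoubled_le_aux {ep : ℕ → ℕ} (hep : ∀ k, 1 ≤ k → 1 ≤ ep k) {T : ℕ} (hT : 1 ≤ T)
    (z : ℕ → ι) (p : ι) {k : ℕ} (hk : 1 ≤ k) (hkT : k ≤ numEpisodes ep T + 1) :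
    ∑ i ∈ Finset.range (min (startTime ep k) T), (if HasDoubled ep z i ∧ z i = p then 1 else 0) ≤
      ((Finset.Icc 1 (numEpisodes ep T)).sup ep : ℕ) *
        Real.logb 2 (visitCount z (min (startTime ep k) T) p + 1) := by
  induction k, hk using Nat.le_induction with
  | base => simp [startTime_one, visitCount]
  | succ k hk ih =>
    have hkK : k ≤ numEpisodes ep T := by omega
    have hlt := (le_numEpisodes_iff hep hT).1 hkK
    have hmin : min (startTime ep (k + 1)) T =
        startTime ep k + min (ep k) (T - startTime ep k) := by
      rw [startTime_succ ep hk]; omega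
    specialize ih (by omega)
    rw [min_eq_left hlt.le] at ih
    set n := min (ep k) (T - startTime ep k)
    have hnle : (n : ℝ) ≤ ((Finset.Icc 1 (numEpisodes ep T)).sup ep : ℕ) := by
      exact_mod_cast (min_le_left _ _).trans (Finset.le_sup (f := ep) (Finset.mem_Icc.2 ⟨hk, hkK⟩))
    rw [hmin, Finset.sum_range_add]
    have hmono : visitCount z (startTime ep k) p ≤ visitCount z (startTime ep k + n) p :=
      visitCount_mono z p (Nat.le_add_right _ _)
    by_cases hbad : ∃ m < n, HasDoubled ep z (startTime ep k + m) ∧ z (startTime ep k + m) = p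
    · obtain ⟨m, hm, hb, hp⟩ := hbad
      have hep' : episodeAt ep (startTime ep k + m) = k :=
        episodeAt_eq hep (Nat.le_add_right _ _) (by
          rw [startTime_succ ep hk]
          have : n ≤ ep k := min_le_left _ _
          omega)
      rw [HasDoubled, hep', hp] at hb
      have h2 : visitCount z (startTime ep k + m + 1) p ≤ visitCount z (startTime ep k + n) p :=
        visitCount_mono z p (by omega)
      rw [visitCount_succ, if_pos hp] at h2
      -- The doubled visit itself is counted by the end of the episode, which supplies the missing
      -- unit.
      have h3 : 2 * (visitCount z (startTime ep k) p + 1 : ℝ) ≤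
          visitCount z (startTime ep k + n) p + 1 := by
        exact_mod_cast (by omega : 2 * (visitCount z (startTime ep k) p + 1) ≤
          visitCount z (startTime ep k + n) p + 1)
      have h4 : 1 + Real.logb 2 (visitCount z (startTime ep k) p + 1) ≤
          Real.logb 2 (visitCount z (startTime ep k + n) p + 1) := by
        calc _ = Real.logb 2 (2 * (visitCount z (startTime ep k) p + 1)) := by
              rw [Real.logb_mul two_ne_zero (by positivity),
                Real.logb_self_eq_one one_lt_two]
          _ ≤ _ := Real.logb_le_logb_of_le one_lt_two (by positivity) h3
      have h5 : ∑ m ∈ Finset.range n, (if HasDoubled ep z (startTime ep k + m) ∧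
          z (startTime ep k + m) = p then (1 : ℝ) else 0) ≤ n := by
        refine (Finset.sum_le_sum (g := fun _ => 1) fun m _ => ?_).trans (by simp)
        split_ifs <;> norm_num
      nlinarith [mul_le_mul_of_nonneg_left h4 (n.cast_nonneg.trans hnle)]
    · push Not at hbad
      have h5 : ∑ m ∈ Finset.range n, (if HasDoubled ep z (startTime ep k + m) ∧
          z (startTime ep k + m) = p then (1 : ℝ) else 0) = 0 :=
        Finset.sum_eq_zero fun m hm =>
          if_neg fun h => hbad m (Finset.mem_range.1 hm) h.1 h.2
      rw [h5, add_zero]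
      refine ih.trans (mul_le_mul_of_nonneg_left ?_ (Nat.cast_nonneg _))
      exact Real.logb_le_logb_of_le one_lt_two (by positivity)
        (by exact_mod_cast Nat.succ_le_succ hmono)

open Classical in
lemma sum_hasDoubled_le [Nonempty ι] {ep : ℕ → ℕ} (hep : ∀ k, 1 ≤ k → 1 ≤ ep k) {T : ℕ}
    (hT : 1 ≤ T) (z : ℕ → ι) :
    ∑ i ∈ Finset.range T, (if HasDoubled ep z i then (1 : ℝ) else 0) ≤
      Fintype.card ι * ((Finset.Icc 1 (numEpisodes ep T)).sup ep : ℕ) *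
        Real.logb 2 (T / Fintype.card ι + 1) := by
  have hlt : T ≤ startTime ep (numEpisodes ep T + 1) :=
    not_lt.1 fun hlt => absurd ((le_numEpisodes_iff hep hT).2 hlt) (by omega)
  have key (p : ι) := sum_hasDoubled_le_aux hep hT z p
    (Nat.le_add_left 1 (numEpisodes ep T)) le_rfl
  rw [min_eq_right hlt] at key
  calc _ = ∑ p, ∑ i ∈ Finset.range T, (if HasDoubled ep z i ∧ z i = p then (1 : ℝ) else 0) := by
        rw [Finset.sum_comm]
        refine Finset.sum_congr rfl fun i _ => ?_
        by_cases h : HasDoubled ep z i <;> simp [h]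
    _ ≤ ∑ p, ((Finset.Icc 1 (numEpisodes ep T)).sup ep : ℕ) *
          Real.logb 2 (visitCount z T p + 1) := Finset.sum_le_sum fun p _ => key p
    _ = ((Finset.Icc 1 (numEpisodes ep T)).sup ep : ℕ) *
          ((∑ p, Real.log (visitCount z T p + 1)) / Real.log 2) := by
        simp only [← Finset.mul_sum, Real.logb, Finset.sum_div]
    _ ≤ ((Finset.Icc 1 (numEpisodes ep T)).sup ep : ℕ) *
          ((Fintype.card ι * Real.log (T / Fintype.card ι + 1)) / Real.log 2) := by
        have h2 : 0 ≤ Real.log 2 := Real.log_nonneg one_le_two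
        have := sum_log_visitCount_le z T
        gcongr
    _ = _ := by
        rw [Real.logb]
        ring

-- Away from doubled times the count at the start of the episode is positive and at least half of
-- the current count plus one, so freezing it costs a factor 2 in the harmonic sum.
open Classical in
lemma sum_not_hasDoubled_le [Nonempty ι] (ep : ℕ → ℕ) (T : ℕ) (z : ℕ → ι) :
    ∑ i ∈ Finset.range T, (if HasDoubled ep z i then (0 : ℝ) else
      (visitCount z (startTime ep (episodeAt ep i)) (z i) : ℝ)⁻¹) ≤
      2 * (Fintype.card ι * (1 + Real.log (T / Fintype.card ι + 1))) := by
  refine le_trans ?_ (mul_le_mul_of_nonneg_left (sum_inv_visitCount_le z T) zero_le_two)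
  rw [Finset.mul_sum]
  refine Finset.sum_le_sum fun i _ => ?_
  split_ifs with h
  · positivity
  · rw [HasDoubled, not_lt] at h
    set n := visitCount z (startTime ep (episodeAt ep i)) (z i)
    have h' : ((visitCount z i (z i) : ℝ) + 1) ≤ 2 * n := by exact_mod_cast h
    have hn : (0 : ℝ) < n := by
      have : (0 : ℝ) ≤ visitCount z i (z i) := Nat.cast_nonneg _
      linarith
    rw [← div_eq_mul_inv, inv_eq_one_div, div_le_div_iff₀ hn (by positivity)]
    linarith

end Visits

/-! ### Concentration of the empirical transition frequencies -/

section Concentration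

variable {S A : Type*} [Fintype S] {t : ℕ}

/-- The sequence of state-action pairs of a trajectory, when `a` is the next action. -/
def History.path (x : History S A t) (a : A) (i : ℕ) : S × A :=
  if h : i < t then x.1 ⟨i, h⟩ else (x.2, a)

omit [Fintype S] in
lemma History.path_self (x : History S A t) (a : A) : x.path a t = (x.2, a) := by
  simp [History.path]

omit [Fintype S] in
lemma History.path_extend (x : History S A t) (a b : A) (s' : S) {i : ℕ} (hi : i ≤ t) :
    (x.extend a s').path b i = x.path a i := by
  unfold History.path
  rcases hi.lt_or_eq with h | rfl
  · rw [dif_pos (Nat.lt_succ_of_lt h), dif_pos h]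
    exact x.extend_fst_castSucc a s' ⟨i, h⟩
  · rw [dif_pos (Nat.lt_succ_self i), dif_neg (lt_irrefl i)]
    exact x.extend_fst_last a s'

open Classical in
/-- The number of visits of a trajectory to a state-action pair. -/
def pairCount (x : History S A t) (p : S × A) : ℕ := ∑ i : Fin t, if x.1 i = p then 1 else 0

open Classical in
/-- Indicator function of a set of states. -/
def stateInd (B : Finset S) (s : S) : ℝ := if s ∈ B then 1 else 0

open Classical in
/-- The number of transitions of a trajectory from `p` into `B`, minus its conditional mean. -/
def deviation (P : S → A → PMF S) (p : S × A) (B : Finset S) (x : History S A t) : ℝ :=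
  ∑ i : Fin t, if x.1 i = p then
    stateInd B (x.state ((i : ℕ) + 1)) - expect (P p.1 p.2) (stateInd B) else 0

omit [Fintype S] in
lemma visitCount_path (x : History S A t) (a : A) (p : S × A) :
    visitCount (x.path a) t p = pairCount x p := by
  classical
  unfold visitCount pairCount
  rw [Finset.card_filter, Finset.sum_range]
  refine Finset.sum_congr rfl fun i _ => ?_
  simp [History.path]

open Classical in
omit [Fintype S] in
lemma pairCount_extend (x : History S A t) (a : A) (s' : S) (p : S × A) :
    pairCount (x.extend a s') p = pairCount x p + if (x.2, a) = p then 1 else 0 := by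
  unfold pairCount
  rw [Fin.sum_univ_castSucc]
  simp only [History.extend_fst_castSucc, History.extend_fst_last]

open Classical in
lemma deviation_extend (P : S → A → PMF S) (p : S × A) (B : Finset S) (x : History S A t) (a : A)
    (s' : S) : deviation P p B (x.extend a s') = deviation P p B x +
      if (x.2, a) = p then stateInd B s' - expect (P p.1 p.2) (stateInd B) else 0 := by
  unfold deviation
  rw [Fin.sum_univ_castSucc]
  congr 1
  · refine Finset.sum_congr rfl fun i _ => ?_
    rw [History.extend_fst_castSucc, Fin.val_castSucc, History.state_extend_of_le _ _ _ i.2]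
  · rw [History.extend_fst_last, Fin.val_last, History.state_self, History.extend_snd]

/-- Hoeffding's lemma for the indicator of `B`. -/
lemma expect_exp_stateInd_le (p : PMF S) (B : Finset S) (l : ℝ) :
    expect p (fun s => Real.exp (l * (stateInd B s - expect p (stateInd B)))) ≤
      Real.exp (l ^ 2 / 8) := by
  let : MeasurableSpace S := ⊤
  have : MeasurableSingletonClass S := ⟨fun _ => trivial⟩
  have hE (f : S → ℝ) : ∫ s, f s ∂p.toMeasure = expect p f := by
    rw [PMF.integral_eq_sum]
    rfl
  have h := ProbabilityTheory.hasSubgaussianMGF_of_mem_Icc (μ := p.toMeasure) (X := stateInd B)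
    (a := 0) (b := 1) (measurable_of_finite _).aemeasurable
    (Eventually.of_forall fun s => by unfold stateInd; split_ifs <;> simp)
  have h2 := h.mgf_le l
  simp only [ProbabilityTheory.mgf, hE] at h2
  refine h2.trans_eq ?_
  congr 1
  simp
  ring

/-- The empirical transition frequencies of `x` are close to `P`. -/
def Consistent (P : S → A → PMF S) (L : ℝ) (x : History S A t) : Prop :=
  ∀ p B, deviation P p B x ≤ √(pairCount x p * Fintype.card S * L / 2)

lemma deviation_eq_zero_of_pairCount (P : S → A → PMF S) {p : S × A} (B : Finset S)
    {x : History S A t} (h : pairCount x p = 0) : deviation P p B x = 0 := by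
  classical
  unfold pairCount at h
  rw [Finset.sum_eq_zero_iff] at h
  refine Finset.sum_eq_zero fun i hi => if_neg fun hp => ?_
  simpa [hp] using h i hi

/-- With a single state every transition is certain. The case is separate because the later union
bound needs at least two states. -/
lemma consistent_of_subsingleton [Subsingleton S] (P : S → A → PMF S) (L : ℝ)
    (x : History S A t) : Consistent P L x := by
  classical
  intro p B
  refine le_trans (le_of_eq ?_) (Real.sqrt_nonneg _)
  refine Finset.sum_eq_zero fun i _ => ?_
  split_ifs
  swap
  · rfl
  rw [sub_eq_zero, ← expect_const (P p.1 p.2) (stateInd B _)]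
  exact congrArg _ (funext fun s => congrArg _ (Subsingleton.elim _ _))

/-- The difference is Σ (p' − p)(v − min v) with 0 ≤ v − min v ≤ c, so keeping only the set where p'
> p bounds it. -/
lemma expect_sub_expect_le (p p' : PMF S) {v : S → ℝ} {c : ℝ} (hv : ∀ s s', v s - v s' ≤ c) :
    ∃ B : Finset S, expect p' v - expect p v ≤
      c * (expect p' (stateInd B) - expect p (stateInd B)) := by
  classical
  rcases isEmpty_or_nonempty S with hS | hS
  · exact ⟨∅, by simp [expect]⟩
  obtain ⟨m, -, hm⟩ := Finset.exists_min_image Finset.univ v Finset.univ_nonempty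
  refine ⟨Finset.univ.filter fun s => (p s).toReal < (p' s).toReal, ?_⟩
  have e1 : expect p' v - expect p v =
      ∑ s, ((p' s).toReal - (p s).toReal) * (v s - v m) := by
    simp only [mul_sub, sub_mul, Finset.sum_sub_distrib, ← Finset.sum_mul, sum_toReal_pmf]
    simp [expect]
  rw [e1]
  unfold expect
  rw [← Finset.sum_sub_distrib, Finset.mul_sum]
  refine Finset.sum_le_sum fun s _ => ?_
  have h1 := hm s (Finset.mem_univ s)
  have h2 := hv s m
  simp only [stateInd, Finset.mem_filter, Finset.mem_univ, true_and]
  split_ifs with h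
  · nlinarith
  · nlinarith

/-- The empirical frequencies cancel between B and its complement; one-sided bounds for the two
kernels thus bound their difference on B. -/
lemma deviation_add_deviation_compl [DecidableEq S] (P P' : S → A → PMF S) (p : S × A)
    (B : Finset S) (x : History S A t) :
    deviation P p B x + deviation P' p Bᶜ x =
      pairCount x p * (expect (P' p.1 p.2) (stateInd B) - expect (P p.1 p.2) (stateInd B)) := by
  classical
  have hc (s : S) : stateInd Bᶜ s = 1 - stateInd B s := by
    unfold stateInd
    by_cases h : s ∈ B <;> simp [h]
  have hc' : expect (P' p.1 p.2) (stateInd Bᶜ) = 1 - expect (P' p.1 p.2) (stateInd B) := by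
    rw [← expect_const (P' p.1 p.2) 1, ← expect_sub]
    exact congrArg _ (funext hc)
  unfold deviation pairCount
  rw [← Finset.sum_add_distrib]
  push_cast
  rw [Finset.sum_mul]
  refine Finset.sum_congr rfl fun i _ => ?_
  split_ifs
  · rw [hc, hc']
    ring
  · simp

/-- Two kernels for which a trajectory is typical are close to each other. -/
lemma expect_sub_expect_le_of_consistent {P P' : S → A → PMF S} {L : ℝ}
    {x : History S A t} (hP : Consistent P L x) (hP' : Consistent P' L x) {p : S × A}
    (hn : 0 < pairCount x p) {v : S → ℝ} {c : ℝ} (hc : 0 ≤ c) (hv : ∀ s s', v s - v s' ≤ c) :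
    expect (P' p.1 p.2) v - expect (P p.1 p.2) v ≤
      c * √(2 * Fintype.card S * L * (pairCount x p : ℝ)⁻¹) := by
  classical
  obtain ⟨B, hB⟩ := expect_sub_expect_le (P p.1 p.2) (P' p.1 p.2) hv
  refine hB.trans (mul_le_mul_of_nonneg_left ?_ hc)
  have h1 := deviation_add_deviation_compl P P' p B x
  have h2 := hP p B
  have h3 := hP' p Bᶜ
  have hn' : (0 : ℝ) < pairCount x p := by exact_mod_cast hn
  set n : ℝ := (pairCount x p : ℝ)
  have h4 : n * (expect (P' p.1 p.2) (stateInd B) - expect (P p.1 p.2) (stateInd B)) ≤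
      2 * √(n * Fintype.card S * L / 2) := by linarith
  -- Dividing by the visit count n turns twice the confidence threshold into the width of the bonus.
  have h5 : 2 * √(n * Fintype.card S * L / 2) = n * √(2 * Fintype.card S * L * n⁻¹) := by
    have e1 : (2 : ℝ) = √(2 ^ 2) := (Real.sqrt_sq zero_le_two).symm
    have e2 : n = √(n ^ 2) := (Real.sqrt_sq hn'.le).symm
    calc _ = √(2 ^ 2) * √(n * Fintype.card S * L / 2) := by rw [← e1]
      _ = √(n ^ 2) * √(2 * Fintype.card S * L * n⁻¹) := by
        rw [← Real.sqrt_mul (by norm_num), ← Real.sqrt_mul (by positivity)]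
        congr 1
        field_simp
      _ = _ := by rw [← e2]
  rw [h5] at h4
  exact le_of_mul_le_mul_left h4 hn'

end Concentration

/-! ### Concentration along a run -/

section RunConcentration

variable {S A Θ : Type*} [Fintype S] [DecidableEq S] [Fintype A] [MeasurableSpace Θ]
  {M : Model S A Θ} {sref : S} (O : PlanningOracle M sref) (μ₀ : Measure Θ)
  [IsProbabilityMeasure μ₀] (β : ℝ) (ep : ℕ → ℕ) {N : ℕ} (D : History S A N) (θ : Θ)

/-- An exponential supermartingale: a step away from p leaves the exponent unchanged, and a step at
p multiplies by a factor of conditional mean at most 1 by Hoeffding's lemma. -/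
lemma expect_exp_deviation_le (p : S × A) (B : Finset S) (l : ℝ) (t : ℕ) :
    expect (runLaw O μ₀ β ep D θ t) (fun y => Real.exp (l * deviation (M.trans θ) p B y.1 -
      l ^ 2 / 8 * pairCount y.1 p)) ≤ 1 := by
  classical
  induction t with
  | zero => exact expect_le_const _ fun y => by simp [deviation, pairCount]
  | succ t ih =>
    refine le_trans (le_of_eq (expect_runLaw_succ O μ₀ β ep D θ t (h := fun x a s' =>
      Real.exp (l * deviation (M.trans θ) p B (x.extend a s') -
        l ^ 2 / 8 * pairCount (x.extend a s') p)) fun x a s' π => rfl)) ?_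
    refine le_trans (expect_mono _ fun y => ?_) ih
    simp only [deviation_extend, pairCount_extend]
    by_cases h : (y.1.2, y.2 y.1.2) = p
    · subst h
      simp only [if_true]
      have e (s' : S) : Real.exp (l * (deviation (M.trans θ) (y.1.2, y.2 y.1.2) B y.1 +
          (stateInd B s' - expect (M.trans θ y.1.2 (y.2 y.1.2)) (stateInd B))) -
          l ^ 2 / 8 * ((pairCount y.1 (y.1.2, y.2 y.1.2) + 1 : ℕ) : ℝ)) =
          Real.exp (l * deviation (M.trans θ) (y.1.2, y.2 y.1.2) B y.1 -
            l ^ 2 / 8 * pairCount y.1 (y.1.2, y.2 y.1.2)) * Real.exp (-(l ^ 2 / 8)) *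
          Real.exp (l * (stateInd B s' - expect (M.trans θ y.1.2 (y.2 y.1.2)) (stateInd B))) := by
        rw [← Real.exp_add, ← Real.exp_add]
        push_cast
        congr 1
        ring
      simp only [e]
      rw [expect_const_mul, mul_assoc]
      refine mul_le_of_le_one_right (Real.exp_pos _).le ?_
      calc _ ≤ Real.exp (-(l ^ 2 / 8)) * Real.exp (l ^ 2 / 8) :=
            mul_le_mul_of_nonneg_left (expect_exp_stateInd_le _ B l) (Real.exp_pos _).le
        _ = 1 := by rw [← Real.exp_add]; simp
    · simp only [if_neg h, add_zero]
      rw [expect_const]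

-- Chernoff's bound with the optimal parameter 4d/n for the threshold d, which gives the exponent
-- −2d²/n = −SL. Fixing the value n of the random visit count makes the threshold deterministic.
open Classical in
lemma expect_deviation_gt_le (p : S × A) (B : Finset S) {L : ℝ} (hL : 0 ≤ L) (t : ℕ) {n : ℕ}
    (hn : 1 ≤ n) :
    expect (runLaw O μ₀ β ep D θ t) (fun y => if pairCount y.1 p = n ∧
      √(n * Fintype.card S * L / 2) < deviation (M.trans θ) p B y.1 then 1 else 0) ≤
      Real.exp (-(Fintype.card S * L)) := by
  have hn' : (0 : ℝ) < n := by exact_mod_cast hn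
  set d : ℝ := √(n * Fintype.card S * L / 2)
  have hd : d ^ 2 = n * Fintype.card S * L / 2 := Real.sq_sqrt (by positivity)
  have hd0 : 0 ≤ d := Real.sqrt_nonneg _
  have h := mul_le_mul_of_nonneg_left
    (expect_exp_deviation_le O μ₀ β ep D θ p B (4 * d / n) t)
    (Real.exp_pos (-(Fintype.card S * L))).le
  rw [← expect_const_mul, mul_one] at h
  refine le_trans (expect_mono _ fun y => ?_) h
  split_ifs with hy
  · rw [← Real.exp_add]
    refine Real.one_le_exp ?_
    rw [hy.1]
    have e1 : 4 * d / n * d = 2 * Fintype.card S * L := by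
      rw [div_mul_eq_mul_div, mul_assoc, ← pow_two, hd]
      field_simp
      ring
    have e2 : (4 * d / n) ^ 2 / 8 * n = Fintype.card S * L := by
      rw [div_pow, mul_pow, hd]
      field_simp
      ring
    rw [e2]
    have : 4 * d / n * d ≤ 4 * d / n * deviation (M.trans θ) p B y.1 :=
      mul_le_mul_of_nonneg_left hy.2.le (by positivity)
    linarith
  · positivity

omit [Fintype S] [Fintype A] in
lemma pairCount_le {t : ℕ} (x : History S A t) (p : S × A) : pairCount x p ≤ t := by
  classical
  unfold pairCount
  refine (Finset.sum_le_sum (g := fun _ => 1) fun i _ => ?_).trans (by simp)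
  split_ifs <;> simp

-- Union bound over the pair, the set of states and the value of the visit count; a count of zero
-- cannot fail, since then the deviation is zero.
open Classical in
lemma expect_not_consistent_le_aux {L : ℝ} (hL : 0 ≤ L) (t : ℕ) :
    expect (runLaw O μ₀ β ep D θ t)
      (fun y => if Consistent (M.trans θ) L y.1 then 0 else 1) ≤
      Fintype.card S * Fintype.card A * 2 ^ Fintype.card S * t *
        Real.exp (-(Fintype.card S * L)) := by
  have hle : expect (runLaw O μ₀ β ep D θ t)
      (fun y => if Consistent (M.trans θ) L y.1 then 0 else 1) ≤
      ∑ p : S × A, ∑ B : Finset S, ∑ n ∈ Finset.Icc 1 t, expect (runLaw O μ₀ β ep D θ t)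
        (fun y => if pairCount y.1 p = n ∧
          √(n * Fintype.card S * L / 2) < deviation (M.trans θ) p B y.1 then 1 else 0) := by
    simp only [← expect_sum]
    refine expect_mono _ fun y => ?_
    have hnn (p : S × A) (B : Finset S) (n : ℕ) : (0 : ℝ) ≤ if pairCount y.1 p = n ∧
          √(n * Fintype.card S * L / 2) < deviation (M.trans θ) p B y.1 then 1 else 0 := by
      split_ifs <;> norm_num
    split_ifs with h
    · exact Finset.sum_nonneg fun p _ => Finset.sum_nonneg fun B _ => Finset.sum_nonneg
        fun n _ => hnn p B n
    · unfold Consistent at h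
      push Not at h
      obtain ⟨p, B, hpB⟩ := h
      have hpos : 1 ≤ pairCount y.1 p := by
        by_contra h0
        have h0 : pairCount y.1 p = 0 := by omega
        rw [deviation_eq_zero_of_pairCount _ B h0] at hpB
        exact absurd hpB (not_lt.2 (Real.sqrt_nonneg _))
      calc (1 : ℝ) = if pairCount y.1 p = pairCount y.1 p ∧
            √(pairCount y.1 p * Fintype.card S * L / 2) < deviation (M.trans θ) p B y.1
            then 1 else 0 := by rw [if_pos ⟨rfl, hpB⟩]
        _ ≤ ∑ n ∈ Finset.Icc 1 t, if pairCount y.1 p = n ∧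
            √(n * Fintype.card S * L / 2) < deviation (M.trans θ) p B y.1 then 1 else 0 :=
          Finset.single_le_sum (f := fun n : ℕ => if pairCount y.1 p = n ∧
            √(n * Fintype.card S * L / 2) < deviation (M.trans θ) p B y.1 then (1 : ℝ) else 0)
            (fun n _ => hnn p B n) (Finset.mem_Icc.2 ⟨hpos, pairCount_le _ _⟩)
        _ ≤ ∑ B : Finset S, ∑ n ∈ Finset.Icc 1 t, if pairCount y.1 p = n ∧
            √(n * Fintype.card S * L / 2) < deviation (M.trans θ) p B y.1 then 1 else 0 :=
          Finset.single_le_sum (f := fun B : Finset S => ∑ n ∈ Finset.Icc 1 t,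
            if pairCount y.1 p = n ∧ √(n * Fintype.card S * L / 2) <
              deviation (M.trans θ) p B y.1 then (1 : ℝ) else 0)
            (fun B _ => Finset.sum_nonneg fun n _ => hnn p B n) (Finset.mem_univ B)
        _ ≤ _ := Finset.single_le_sum (f := fun p : S × A => ∑ B : Finset S,
            ∑ n ∈ Finset.Icc 1 t, if pairCount y.1 p = n ∧ √(n * Fintype.card S * L / 2) <
              deviation (M.trans θ) p B y.1 then (1 : ℝ) else 0)
            (fun p _ => Finset.sum_nonneg fun B _ => Finset.sum_nonneg fun n _ => hnn p B n)
            (Finset.mem_univ p)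
  refine hle.trans ?_
  calc _ ≤ ∑ _p : S × A, ∑ _B : Finset S, ∑ _n ∈ Finset.Icc 1 t,
        Real.exp (-(Fintype.card S * L)) :=
        Finset.sum_le_sum fun p _ => Finset.sum_le_sum fun B _ => Finset.sum_le_sum fun n hn =>
          expect_deviation_gt_le O μ₀ β ep D θ p B hL t (Finset.mem_Icc.1 hn).1
    _ = _ := by
        simp
        ring

open Classical in
/-- With high probability the empirical frequencies are close to the true transition kernel. -/
lemma expect_not_consistent_le [Nonempty A] {K T t : ℕ} (hK : 1 ≤ K) (hT : 1 ≤ T) (ht : t ≤ T) :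
    expect (runLaw O μ₀ β ep D θ t) (fun y => if Consistent (M.trans θ)
      (Real.log (2 * Fintype.card S * Fintype.card A * K * T)) y.1 then 0 else 1) ≤
      1 / (T : ℝ) := by
  have : Nonempty S := ⟨sref⟩
  -- The estimate below gains from the exponent S only if S ≥ 2.
  rcases subsingleton_or_nontrivial S with hS | hS
  · simp only [consistent_of_subsingleton, if_true]
    rw [expect_const]
    positivity
  have hS2 : 2 ≤ Fintype.card S := Fintype.one_lt_card
  have hS' : (2 : ℝ) ≤ Fintype.card S := by exact_mod_cast hS2
  have hA' : (1 : ℝ) ≤ Fintype.card A := by exact_mod_cast Fintype.card_pos (α := A)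
  have hK' : (1 : ℝ) ≤ K := by exact_mod_cast hK
  have hT' : (1 : ℝ) ≤ T := by exact_mod_cast hT
  have ht' : (t : ℝ) ≤ T := by exact_mod_cast ht
  set nS : ℝ := (Fintype.card S : ℝ) with hnS
  set nA : ℝ := (Fintype.card A : ℝ)
  have hSA : 1 ≤ nS * nA := by nlinarith
  have hSAK : 1 ≤ nS * nA * K := by nlinarith
  have hq : 1 ≤ nS * nA * K * T := by nlinarith
  have hL : 0 ≤ Real.log (2 * nS * nA * K * T) := Real.log_nonneg (by nlinarith)
  refine (expect_not_consistent_le_aux O μ₀ β ep D θ hL t).trans ?_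
  have hexp : Real.exp (-(nS * Real.log (2 * nS * nA * K * T))) =
      ((2 * nS * nA * K * T) ^ Fintype.card S)⁻¹ := by
    rw [Real.exp_neg, hnS, Real.exp_nat_mul, Real.exp_log]
    nlinarith
  rw [hexp]
  -- The 2 inside the logarithm yields 2^S, which cancels the number of subsets; two of the S powers
  -- of SAKT then suffice for the bound 1/T.
  have e : (2 * nS * nA * K * T) ^ Fintype.card S =
      2 ^ Fintype.card S * (nS * nA * K * T) ^ Fintype.card S := by
    rw [← mul_pow]
    ring
  have hpow : (nS * nA * K * T) ^ 2 ≤ (nS * nA * K * T) ^ Fintype.card S :=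
    pow_le_pow_right₀ hq hS2
  calc _ = nS * nA * t / (nS * nA * K * T) ^ Fintype.card S := by
        rw [e]
        field_simp
        change nS * nA * t = _
        ring
    _ ≤ nS * nA * T / (nS * nA * K * T) ^ 2 := by
        gcongr
    _ ≤ 1 / T := by
        rw [div_le_div_iff₀ (by positivity) (by positivity)]
        have h1 : 1 ≤ nS * nA * K ^ 2 := by nlinarith
        have h2 : 0 ≤ nS * nA * T ^ 2 := by positivity
        nlinarith [mul_le_mul_of_nonneg_left h1 h2]

end RunConcentration

/-! ### The regret of a run -/

/-- No coupling of the two laws is needed: the difference of f and g is bounded at every pair of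
points. -/
lemma expect_le_add_expect {α γ : Type*} [Fintype α] [Fintype γ] (p : PMF α) (p' : PMF γ)
    {f : α → ℝ} {g : γ → ℝ} {c : ℝ} (h : ∀ x y, f x - g y ≤ c) :
    expect p f ≤ c + expect p' g := by
  refine expect_le_const p fun x => ?_
  have : f x - c ≤ expect p' g := const_le_expect p' fun y => by linarith [h x y]
  linarith

section Gap

variable {S A Θ : Type*} [Fintype S] [Fintype A] [MeasurableSpace Θ] (M : Model S A Θ) (sref : S)

/-- The loss in relative value of the action `a` at the state `s`. -/
def Model.gap (θ : Θ) (s : S) (a : A) : ℝ := M.gain sref θ + M.value sref θ s - M.q sref θ s a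

/-- In this form the sum of the gaps along a run telescopes in the value function. -/
lemma Model.gap_eq (θ : Θ) (s : S) (a : A) : M.gap sref θ s a =
    M.gain sref θ - M.reward s a - (expect (M.trans θ s a) (M.value sref θ) - M.value sref θ s) := by
  have : M.q sref θ s a = M.reward s a + expect (M.trans θ s a) (M.value sref θ) := rfl
  rw [Model.gap, this]
  ring

variable {M} [Nonempty A] (hM : ∀ θ, Communicating (M.trans θ))

include hM

lemma Model.value_sref (θ : Θ) : M.value sref θ sref = 0 := by
  have h := tendsto_relValue M.reward_nonneg M.reward_le_one (hM θ) sref sref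
  simp only [sub_self] at h
  exact tendsto_nhds_unique h tendsto_const_nhds

lemma PlanningOracle.gap_solve {sref : S} (O : PlanningOracle M sref) (θ : Θ) (s : S) :
    M.gap sref θ s (O.solve θ s) = 0 := by
  have := relQ_eq_of_forall_le M.reward_nonneg M.reward_le_one (hM θ) sref s (O.greedy θ s)
  change M.q sref θ s (O.solve θ s) = M.value sref θ s + M.gain sref θ at this
  rw [Model.gap, this]
  ring

omit hM in
lemma Model.bddMeasurable_gain : BddMeasurable (M.gain sref) :=
  BddMeasurable.of_mem_Icc (M.measurable_gain sref)
    fun _ => optGain_mem_Icc M.reward_nonneg M.reward_le_one sref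

variable {vbar : ℝ} (hspan : ∀ θ s s', M.value sref θ s - M.value sref θ s' ≤ vbar)

include hspan

/-- The value vanishes at the reference state, so the bound on the span bounds its absolute value.
-/
lemma Model.bddMeasurable_value (s : S) : BddMeasurable fun θ => M.value sref θ s := by
  refine BddMeasurable.of_mem_Icc (a := -vbar) (b := vbar) (Model.measurable_value hM sref s)
    fun θ => ?_
  have h1 := hspan θ s sref
  have h2 := hspan θ sref s
  rw [Model.value_sref sref hM] at h1 h2
  constructor <;> linarith

lemma Model.bddMeasurable_gap (s : S) (a : A) : BddMeasurable fun θ => M.gap sref θ s a := by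
  have hv := Model.bddMeasurable_value sref hM hspan
  simp only [Model.gap_eq]
  exact ((Model.bddMeasurable_gain sref).sub (.const _)).sub
    ((BddMeasurable.expect (M.measurable_trans s a) hv).sub (hv s))

end Gap

/-! ### From regret to accumulated gaps -/

section Regret

variable {S A Θ : Type*} [Fintype S] [DecidableEq S] [Fintype A] [Nonempty A] [MeasurableSpace Θ]
  {M : Model S A Θ} {sref : S} (O : PlanningOracle M sref) (μ₀ : Measure Θ)
  [IsProbabilityMeasure μ₀] (β : ℝ) (sbar : S) {N : ℕ} (ep : ℕ → ℕ)

lemma regret_eq (T : ℕ) (θ : Θ) :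
    regret O μ₀ β sbar N ep T θ = T * M.gain sref θ - ∑ t ∈ Finset.range T,
      condExpect O μ₀ β sbar ep t θ (fun (_ : History S A N) y => M.reward y.1.2 (y.2 y.1.2)) := by
  simp only [condExpect, ← expect_sum]
  rfl

/-- The regret is bounded by the accumulated gaps. -/
lemma regret_le {vbar : ℝ} (hspan : ∀ θ s s', M.value sref θ s - M.value sref θ s' ≤ vbar)
    (T : ℕ) (θ : Θ) :
    regret O μ₀ β sbar N ep T θ ≤ vbar + ∑ t ∈ Finset.range T,
      condExpect O μ₀ β sbar ep t θ
        (fun (_ : History S A N) y => M.gap sref θ y.1.2 (y.2 y.1.2)) := by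
  -- The expected increments of the value function telescope, leaving only the values at times n and
  -- 0.
  have key (n : ℕ) : ∑ t ∈ Finset.range n, condExpect O μ₀ β sbar ep t θ
        (fun (_ : History S A N) y => M.gap sref θ y.1.2 (y.2 y.1.2)) =
      n * M.gain sref θ - ∑ t ∈ Finset.range n, condExpect O μ₀ β sbar ep t θ
        (fun (_ : History S A N) y => M.reward y.1.2 (y.2 y.1.2)) -
      (condExpect O μ₀ β sbar ep n θ (fun (_ : History S A N) y => M.value sref θ y.1.2) -
        condExpect O μ₀ β sbar ep 0 θ (fun (_ : History S A N) y => M.value sref θ y.1.2)) := by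
    induction n with
    | zero => simp
    | succ n ih =>
      rw [Finset.sum_range_succ, Finset.sum_range_succ, ih]
      have h1 : condExpect O μ₀ β sbar ep (n + 1) θ
          (fun (_ : History S A N) y => M.value sref θ y.1.2) =
          condExpect O μ₀ β sbar ep n θ (fun (_ : History S A N) y =>
            expect (M.trans θ y.1.2 (y.2 y.1.2)) (M.value sref θ)) := by
        unfold condExpect
        refine congrArg _ (funext fun D => ?_)
        exact expect_runLaw_succ O μ₀ β ep D θ n (h := fun _ _ s' => M.value sref θ s')
          fun x a s' π => rfl
      rw [h1]
      simp only [Model.gap_eq, condExpect, expect_sub, expect_const]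
      push_cast
      ring
  have hend : condExpect O μ₀ β sbar ep T θ
        (fun (_ : History S A N) y => M.value sref θ y.1.2) ≤
      vbar + condExpect O μ₀ β sbar ep 0 θ
        (fun (_ : History S A N) y => M.value sref θ y.1.2) := by
    unfold condExpect
    rw [← expect_const (M.offlineLaw sref β sbar N θ) vbar, ← expect_add]
    simp only
    exact expect_mono _ fun D => expect_le_add_expect _ _ fun x y => hspan θ _ _
  rw [key, regret_eq]
  linarith

omit [Nonempty A] in
/-- Sums over a run of adapted functionals of the sequence of state-action pairs. -/
lemma sum_expect_path_eq (D : History S A N) (θ : Θ) {g : (ℕ → S × A) → ℕ → ℝ}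
    (hg : ∀ z z' t, (∀ i ≤ t, z i = z' i) → g z t = g z' t) (n : ℕ) :
    ∑ t ∈ Finset.range n, expect (runLaw O μ₀ β ep D θ t)
        (fun y => g (y.1.path (y.2 y.1.2)) t) =
      expect (runLaw O μ₀ β ep D θ n)
        (fun y => ∑ t ∈ Finset.range n, g (y.1.path (y.2 y.1.2)) t) := by
  induction n with
  | zero => simp [expect_const]
  | succ n ih =>
    rw [Finset.sum_range_succ, ih, ← expect_add]
    symm
    refine (expect_runLaw_succ O μ₀ β ep D θ n
      (h := fun x a _ => ∑ t ∈ Finset.range (n + 1), g (x.path a) t) fun x a s' π => ?_).trans ?_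
    · refine Finset.sum_congr rfl fun t ht => hg _ _ _ fun i hi => ?_
      exact x.path_extend a _ s' (hi.trans (Nat.lt_succ_iff.1 (Finset.mem_range.1 ht)))
    · simp only [expect_const, Finset.sum_range_succ]

variable {O β sbar ep}

/-- The summands live on runs of different lengths; adaptedness of g allows all of them to be read
off one run, where the pathwise bound applies. -/
lemma sum_jointExpect_path_le (hM : ∀ θ, Communicating (M.trans θ)) {g : (ℕ → S × A) → ℕ → ℝ}
    (hg : ∀ z z' t, (∀ i ≤ t, z i = z' i) → g z t = g z' t) {T : ℕ} {C : ℝ}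
    (hC : ∀ z, ∑ t ∈ Finset.range T, g z t ≤ C) :
    ∑ t ∈ Finset.range T, jointExpect O μ₀ β sbar ep t
      (fun _ (_ : History S A N) y => g (y.1.path (y.2 y.1.2)) t) ≤ C := by
  have hb (t : ℕ) : BddMeasurable fun θ => condExpect O μ₀ β sbar ep t θ
      (fun (_ : History S A N) y => g (y.1.path (y.2 y.1.2)) t) :=
    bddMeasurable_condExpect μ₀ hM fun D y => .const _
  unfold jointExpect
  rw [← integral_finsetSum _ fun t _ => (hb t).integrable μ₀]
  calc _ ≤ ∫ _θ, C ∂μ₀ := by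
        refine integral_mono ((BddMeasurable.sum _ fun t _ => hb t).integrable μ₀)
          (integrable_const C) fun θ => ?_
        simp only [condExpect, ← expect_sum]
        refine expect_le_const _ fun D => ?_
        rw [sum_expect_path_eq O μ₀ β ep D θ hg]
        exact expect_le_const _ fun y => hC _
    _ = C := by simp

end Regret

/-! ### The probability of a mismatch -/

section Mismatch

variable {S A Θ : Type*} [Fintype S] [Fintype A] [MeasurableSpace Θ]
  {M : Model S A Θ} {sref : S} (O : PlanningOracle M sref)

open Classical in
/-- Indicator of the event that `π` is not the policy which the oracle computes for `θ`. -/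
def mismatch (θ : Θ) (π : S → A) : ℝ := if π = O.solve θ then 0 else 1

lemma mismatch_nonneg (θ : Θ) (π : S → A) : 0 ≤ mismatch O θ π := by
  unfold mismatch
  split_ifs <;> norm_num

lemma mismatch_le_one (θ : Θ) (π : S → A) : mismatch O θ π ≤ 1 := by
  unfold mismatch
  split_ifs <;> norm_num

lemma mismatch_mul_self (θ : Θ) (π : S → A) :
    mismatch O θ π * mismatch O θ π = mismatch O θ π := by
  unfold mismatch
  split_ifs <;> norm_num

/-- This symmetry lets the true and the sampled parameter be exchanged inside a mismatch event. -/
lemma mismatch_solve_comm (θ θ' : Θ) :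
    mismatch O θ (O.solve θ') = mismatch O θ' (O.solve θ) := by
  by_cases h : O.solve θ = O.solve θ'
  · simp [mismatch, h]
  · simp [mismatch, h, Ne.symm h]

variable [DecidableEq S]

lemma bddMeasurable_mismatch (π : S → A) : BddMeasurable fun θ => mismatch O θ π := by
  classical
  exact BddMeasurable.of_solve_comp (O := O) (h := id) measurable_id
    (F := fun π' _ => if π = π' then 0 else 1) fun π' => .const _

omit [DecidableEq S] in
lemma integral_mismatch (μ : Measure Θ) [IsProbabilityMeasure μ] (π : S → A) :
    ∫ θ, mismatch O θ π ∂μ = 1 - (μ (O.solve ⁻¹' {π})).toReal := by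
  classical
  have h (θ : Θ) : mismatch O θ π = 1 - (O.solve ⁻¹' {π}).indicator 1 θ := by
    simp only [mismatch, Set.indicator_apply, Set.mem_preimage, Set.mem_singleton_iff,
      Pi.one_apply, eq_comm (a := π)]
    split_ifs <;> norm_num
  simp_rw [h]
  have hi : Integrable ((O.solve ⁻¹' {π}).indicator (1 : Θ → ℝ)) μ :=
    (integrable_const (1 : ℝ)).indicator (O.measurableSet_fiber π)
  rw [integral_sub (integrable_const _) hi, integral_indicator_one (O.measurableSet_fiber π)]
  simp [Measure.real]

variable [Nonempty A] (μ₀ : Measure Θ) [IsProbabilityMeasure μ₀] {β : ℝ} {sbar : S} {N : ℕ}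
  {ep : ℕ → ℕ}

lemma jointExpect_const_run (c : Θ → History S A N → ℝ) (t : ℕ) :
    jointExpect O μ₀ β sbar ep t (fun θ D _ => c θ D) =
      ∫ θ, expect (M.offlineLaw sref β sbar N θ) (c θ) ∂μ₀ := by
  simp only [jointExpect, condExpect, expect_const]

omit [DecidableEq S] in
lemma initialMismatch_nonneg : 0 ≤ initialMismatch O μ₀ β sbar N :=
  integral_nonneg fun _ => Finset.sum_nonneg fun _ _ =>
    mul_nonneg ENNReal.toReal_nonneg measureReal_nonneg

omit [Nonempty A] in
lemma sum_toReal_fiber (μ : Measure Θ) [IsProbabilityMeasure μ] :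
    ∑ π, (μ (O.solve ⁻¹' {π})).toReal = 1 := by
  have := sum_toReal_pmf (O.sampledPolicy μ)
  simpa [PlanningOracle.sampledPolicy] using this

variable (hM : ∀ θ, Communicating (M.trans θ)) (hep : ∀ k, 1 ≤ k → 1 ≤ ep k)

include hM hep

/-- The mismatch probability does not increase over the episodes. -/
lemma jointExpect_mismatch_start_le {k : ℕ} (hk : 1 ≤ k) :
    jointExpect O μ₀ β sbar ep (startTime ep k)
      (fun θ (_ : History S A N) y => mismatch O θ y.2) ≤ initialMismatch O μ₀ β sbar N := by
  -- The law of π^* given the offline dataset only, to be compared with its law at the start of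
  -- episode k.
  let ν (D : History S A N) (π : S → A) : ℝ :=
    (bayesUpdate μ₀ (M.offlineLik sref β D) (O.solve ⁻¹' {π})).toReal
  let J (c : History S A N → (S → A) → ℝ) : ℝ :=
    ∫ θ, expect (M.offlineLaw sref β sbar N θ) (fun D => c D (O.solve θ)) ∂μ₀
  have hrep {j : ℕ} (hj : 1 ≤ j) : ∃ w : History S A N → History S A (startTime ep j) → ℝ,
      (∀ D x, 0 ≤ w D x) ∧ (∀ c, J c = ∑ D, ∑ x, w D x * ∑ π,
        (M.posterior μ₀ sref β ep D x j (O.solve ⁻¹' {π})).toReal * c D π) ∧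
      jointExpect O μ₀ β sbar ep (startTime ep j)
        (fun θ (_ : History S A N) y => mismatch O θ y.2) = ∑ D, ∑ x, w D x * ∑ π,
        (M.posterior μ₀ sref β ep D x j (O.solve ⁻¹' {π})).toReal *
          (1 - (M.posterior μ₀ sref β ep D x j (O.solve ⁻¹' {π})).toReal) := by
    obtain ⟨w, hw, hrep⟩ := exists_jointExpect_eq (N := N) O μ₀ β sbar ep hM hep hj
    refine ⟨w, hw, fun c => ?_, ?_⟩
    · simp only [J]
      rw [← jointExpect_const_run O μ₀ (ep := ep) (fun θ D => c D (O.solve θ)) (startTime ep j)]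
      rw [hrep (fun θ D _ => c D (O.solve θ)) fun D y =>
        BddMeasurable.of_solve_comp (O := O) (h := id) measurable_id
          (F := fun π _ => c D π) fun π => .const _]
      refine Finset.sum_congr rfl fun D _ => Finset.sum_congr rfl fun x _ => ?_
      congr 1
      set μ := M.posterior μ₀ sref β ep D x j
      calc ∫ p, c D (O.solve p.1) ∂(μ.prod μ) = ∫ p, c D (O.solve p.2) ∂(μ.prod μ) :=
            integral_prod_swap (μ := μ) (ν := μ) fun p => c D (O.solve p.2)
        _ = ∑ π, (μ (O.solve ⁻¹' {π})).toReal * ∫ _θ, c D π ∂μ :=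
            integral_prod_solve O μ (F := fun π _ => c D π) fun π => .const _
        _ = _ := by simp
    · rw [hrep _ fun D y => bddMeasurable_mismatch O y.2]
      refine Finset.sum_congr rfl fun D _ => Finset.sum_congr rfl fun x _ => ?_
      congr 1
      set μ := M.posterior μ₀ sref β ep D x j
      rw [integral_prod_solve O μ (F := fun π θ => mismatch O θ π)
        fun π => bddMeasurable_mismatch O π]
      simp only [integral_mismatch]
  obtain ⟨w, hw, hJ, hmis⟩ := hrep hk
  obtain ⟨w₁, -, hJ₁, -⟩ := hrep le_rfl
  have hνsum (D : History S A N) : ∑ π, ν D π = 1 := sum_toReal_fiber O _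
  have hε : initialMismatch O μ₀ β sbar N = J fun D π => 1 - ν D π := by
    unfold initialMismatch
    refine integral_congr_ae (Eventually.of_forall fun θ => ?_)
    refine Finset.sum_congr rfl fun D _ => ?_
    have : {θ' | O.solve θ' ≠ O.solve θ} = (O.solve ⁻¹' {O.solve θ})ᶜ := rfl
    rw [this, probReal_compl_eq_one_sub (O.measurableSet_fiber _)]
    rfl
  clear_value J
  -- Given the dataset, π^* has law ν, so the mean of ν(π^*) is that of Σ ν².
  have hν : J ν = J fun D _ => ∑ π, ν D π * ν D π := by
    rw [hJ₁, hJ₁]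
    refine Finset.sum_congr rfl fun D _ => Finset.sum_congr rfl fun x _ => ?_
    rw [← Finset.sum_mul, sum_toReal_fiber, one_mul]
    rfl
  rw [hJ, hJ] at hν
  rw [hε, hmis, hJ]
  -- This is Σ (p − ν)² ≥ 0. After averaging, the last two terms cancel by `hν` and the first
  -- becomes ε.
  have key (D : History S A N) (x : History S A (startTime ep k)) :
      ∑ π, (M.posterior μ₀ sref β ep D x k (O.solve ⁻¹' {π})).toReal *
          (1 - (M.posterior μ₀ sref β ep D x k (O.solve ⁻¹' {π})).toReal) ≤
        ∑ π, (M.posterior μ₀ sref β ep D x k (O.solve ⁻¹' {π})).toReal * (1 - ν D π) -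
          ∑ π, (M.posterior μ₀ sref β ep D x k (O.solve ⁻¹' {π})).toReal * ν D π +
          ∑ π, (M.posterior μ₀ sref β ep D x k (O.solve ⁻¹' {π})).toReal *
            ∑ π', ν D π' * ν D π' := by
    have hp : ∑ π, (M.posterior μ₀ sref β ep D x k (O.solve ⁻¹' {π})).toReal = 1 :=
      sum_toReal_fiber O _
    rw [← Finset.sum_mul, hp, one_mul]
    set p : (S → A) → ℝ := fun π => (M.posterior μ₀ sref β ep D x k (O.solve ⁻¹' {π})).toReal
    have e : ∑ π, (p π - ν D π) ^ 2 =
        ∑ π, p π * p π - 2 * ∑ π, p π * ν D π + ∑ π, ν D π * ν D π := by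
      rw [Finset.mul_sum, ← Finset.sum_sub_distrib, ← Finset.sum_add_distrib]
      exact Finset.sum_congr rfl fun π _ => by ring
    have h0 : 0 ≤ ∑ π, (p π - ν D π) ^ 2 := Finset.sum_nonneg fun π _ => sq_nonneg _
    have e1 : ∑ π, p π * (1 - p π) = ∑ π, p π - ∑ π, p π * p π := by
      simp only [mul_sub, mul_one, Finset.sum_sub_distrib]
    have e2 : ∑ π, p π * (1 - ν D π) = ∑ π, p π - ∑ π, p π * ν D π := by
      simp only [mul_sub, mul_one, Finset.sum_sub_distrib]
    linarith
  have hsum := Finset.sum_le_sum fun D (_ : D ∈ Finset.univ) => Finset.sum_le_sum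
    fun x (_ : x ∈ Finset.univ) => mul_le_mul_of_nonneg_left (key D x) (hw D x)
  simp only [mul_add, mul_sub, Finset.sum_add_distrib, Finset.sum_sub_distrib] at hsum hν ⊢
  linarith

lemma jointExpect_mismatch_episode_le {k m : ℕ} (hk : 1 ≤ k) (hm : m < ep k) :
    jointExpect O μ₀ β sbar ep (startTime ep k + m)
      (fun θ (_ : History S A N) y => mismatch O θ y.2) ≤ initialMismatch O μ₀ β sbar N := by
  refine le_trans (le_of_eq ?_) (jointExpect_mismatch_start_le O μ₀ hM hep hk)
  simp only [jointExpect, condExpect, expect_runLaw_episode O μ₀ β ep _ hep _ hk hm, expect_const]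

end Mismatch

/-! ### The regret of an episode -/

section Bonus

variable {S A : Type*} [Fintype S]

open Classical in
/-- The width of the confidence set at time `i`, or `1` if the number of visits has doubled since
the start of the episode. -/
def bonus (ep : ℕ → ℕ) (L : ℝ) (z : ℕ → S × A) (i : ℕ) : ℝ :=
  if HasDoubled ep z i then 1 else
    √(2 * Fintype.card S * L * (visitCount z (startTime ep (episodeAt ep i)) (z i) : ℝ)⁻¹)

lemma bonus_nonneg (ep : ℕ → ℕ) (L : ℝ) (z : ℕ → S × A) (i : ℕ) : 0 ≤ bonus ep L z i := by
  unfold bonus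
  split_ifs
  · exact zero_le_one
  · exact Real.sqrt_nonneg _

-- An extension never rewrites the past, so visit counts at the start of the episode are those of x
-- throughout the episode.
omit [Fintype S] in
lemma path_eq_of_extLaw_ne_zero [Fintype A] {P : S → A → PMF S} {f : S → A} {t : ℕ}
    {x : History S A t} {m : ℕ} {y : History S A (t + m)} (hy : extLaw P f x m y ≠ 0) (a b : A) :
    ∀ i < t, y.path a i = x.path b i := by
  classical
  induction m generalizing a with
  | zero =>
    have : y = x := by
      by_contra h
      exact hy (by simp [extLaw, PMF.pure_apply, h])
    subst this
    intro i hi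
    simp [History.path, hi]
  | succ m ih =>
    rw [← PMF.mem_support_iff, extLaw, PMF.mem_support_bind_iff] at hy
    obtain ⟨z, hz, hy⟩ := hy
    rw [PMF.mem_support_map_iff] at hy
    obtain ⟨s', -, rfl⟩ := hy
    intro i hi
    refine Eq.trans ?_ (ih ((PMF.mem_support_iff _ _).1 hz) (f z.2) i hi)
    exact History.path_extend (t := t + m) z (f z.2) a s' (show i ≤ t + m by omega)

end Bonus

/-! ### Exchange of parameters and model error within an episode -/

section Episode

variable {S A Θ : Type*} [Fintype S] [DecidableEq S] [Fintype A] [Nonempty A] [MeasurableSpace Θ]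
  {M : Model S A Θ} {sref : S}

open Classical in
/-- Indicator of the event that the trajectory `x` is not typical for `θ`. -/
def atypical (M : Model S A Θ) (L : ℝ) {t : ℕ} (x : History S A t) (θ : Θ) : ℝ :=
  if Consistent (M.trans θ) L x then 0 else 1

omit [DecidableEq S] [Fintype A] [Nonempty A] in
lemma atypical_nonneg (L : ℝ) {t : ℕ} (x : History S A t) (θ : Θ) : 0 ≤ atypical M L x θ := by
  unfold atypical
  split_ifs <;> norm_num

omit [Nonempty A] in
lemma bddMeasurable_atypical (L : ℝ) {t : ℕ} (x : History S A t) :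
    BddMeasurable (atypical M L x) := by
  classical
  refine BddMeasurable.ite (s := {θ | Consistent (M.trans θ) L x}) ?_ (.const 0) (.const 1)
  simp only [Consistent, Set.ofPred_forall]
  refine MeasurableSet.iInter fun p => MeasurableSet.iInter fun B =>
    measurableSet_le ?_ measurable_const
  unfold deviation expect
  refine Finset.measurable_fun_sum _ fun i _ => ?_
  split_ifs <;> fun_prop

variable (M) in
/-- The total reward of `n` steps of the policy `π` from the end of the trajectory `x`. -/
def rewardSum {t : ℕ} (n : ℕ) (x : History S A t) (θ : Θ) (π : S → A) : ℝ :=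
  ∑ m ∈ Finset.range n, expect (extLaw (M.trans θ) π x m) fun y => M.reward y.2 (π y.2)

variable (M) in
/-- The total bonus of `n` steps of the policy `π` from the end of the trajectory `x`. -/
def bonusSum (ep : ℕ → ℕ) (L : ℝ) {t : ℕ} (n : ℕ) (x : History S A t) (θ : Θ) (π : S → A) : ℝ :=
  ∑ m ∈ Finset.range n, expect (extLaw (M.trans θ) π x m) fun y =>
    bonus ep L (y.path (π y.2)) (t + m)

omit [DecidableEq S] [Nonempty A] in
lemma bddMeasurable_rewardSum {t : ℕ} (n : ℕ) (x : History S A t) (π : S → A) :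
    BddMeasurable fun θ => rewardSum M n x θ π :=
  .sum _ fun m _ => .expect (measurable_extLaw M.measurable_trans π x m) fun _ => .const _

omit [DecidableEq S] [Nonempty A] in
lemma bddMeasurable_bonusSum (ep : ℕ → ℕ) (L : ℝ) {t : ℕ} (n : ℕ) (x : History S A t)
    (π : S → A) : BddMeasurable fun θ => bonusSum M ep L n x θ π :=
  .sum _ fun m _ => .expect (measurable_extLaw M.measurable_trans π x m) fun _ => .const _

variable (O : PlanningOracle M sref) {vbar : ℝ} {ep : ℕ → ℕ}
  (hspan : ∀ θ s s', M.value sref θ s - M.value sref θ s' ≤ vbar)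
  (hM : ∀ θ, Communicating (M.trans θ))

include hspan

omit [DecidableEq S] in
/-- The accumulated gaps of a policy over an episode. -/
lemma sum_gap_le (hM : ∀ θ, Communicating (M.trans θ)) {t : ℕ} (n : ℕ) (x : History S A t)
    (θ : Θ) (π : S → A) :
    ∑ m ∈ Finset.range n, expect (extLaw (M.trans θ) π x m)
        (fun y => M.gap sref θ y.2 (π y.2)) ≤
      mismatch O θ π * (n * M.gain sref θ - rewardSum M n x θ π + vbar) := by
  -- Without a mismatch all gaps vanish; otherwise the value function telescopes and its endpoints
  -- cost one span.
  by_cases h : π = O.solve θ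
  · subst h
    simp only [PlanningOracle.gap_solve hM, expect_const, mismatch, if_true]
    simp
  · rw [mismatch, if_neg h, one_mul]
    simp only [Model.gap_eq]
    have h1 := sum_expect_extLaw_sub (P := M.trans θ) (f := π) (x := x) (M.value sref θ) n
    have h2 : M.value sref θ x.2 ≤
        vbar + expect (extLaw (M.trans θ) π x n) (fun y => M.value sref θ y.2) := by
      rw [← expect_pure x fun x => M.value sref θ x.2]
      exact expect_le_add_expect _ _ fun x y => hspan θ _ _
    simp only [expect_sub, expect_const] at h1 ⊢
    rw [Finset.sum_sub_distrib, Finset.sum_sub_distrib, Finset.sum_const, Finset.card_range,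
      nsmul_eq_mul, h1]
    unfold rewardSum
    linarith

include hM

omit [DecidableEq S] in
/-- The regret of the policy for `θ'` in the environment of `θ`, with respect to the optimal gain
in the environment of `θ'`. -/
lemma gain_sub_rewardSum_le (hep : ∀ k, 1 ≤ k → 1 ≤ ep k) {k n : ℕ} (hk : 1 ≤ k) (hn : n ≤ ep k)
    (L : ℝ) (x : History S A (startTime ep k)) (θ θ' : Θ) :
    n * M.gain sref θ' - rewardSum M n x θ (O.solve θ') ≤
      vbar + n * (vbar * (atypical M L x θ + atypical M L x θ')) +
        vbar * bonusSum M ep L n x θ (O.solve θ') := by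
  have hv0 : 0 ≤ vbar := by simpa using hspan θ sref sref
  set π := O.solve θ'
  set v := M.value sref θ'
  -- The Bellman equation of θ', split into the drift of v under the true kernel, which telescopes,
  -- and the model error.
  have hr (s : S) : M.gain sref θ' - M.reward s (π s) = (expect (M.trans θ s (π s)) v - v s) +
      (expect (M.trans θ' s (π s)) v - expect (M.trans θ s (π s)) v) := by
    have := O.gap_solve hM θ' s
    rw [Model.gap_eq] at this
    linarith
  have h1 : n * M.gain sref θ' - rewardSum M n x θ π = ∑ m ∈ Finset.range n,
      expect (extLaw (M.trans θ) π x m) fun y => M.gain sref θ' - M.reward y.2 (π y.2) := by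
    simp only [expect_sub, expect_const, Finset.sum_sub_distrib, Finset.sum_const,
      Finset.card_range, nsmul_eq_mul, rewardSum]
  have h2 : expect (extLaw (M.trans θ) π x n) (fun y => v y.2) - v x.2 ≤ vbar := by
    rw [← expect_pure x fun x => v x.2]
    linarith [expect_le_add_expect (extLaw (M.trans θ) π x n) (PMF.pure x)
      (f := fun y => v y.2) (g := fun x => v x.2) (c := vbar) fun x y => hspan θ' _ _]
  rw [h1]
  simp only [hr, expect_add (extLaw _ _ _ _)]
  rw [Finset.sum_add_distrib, sum_expect_extLaw_sub v n, add_assoc]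
  refine add_le_add h2 ?_
  -- The error never exceeds the span, which settles the atypical and the doubled cases; otherwise
  -- both kernels fit the data at the start of the episode.
  have h3 : ∀ m ∈ Finset.range n, expect (extLaw (M.trans θ) π x m) (fun y =>
      expect (M.trans θ' y.2 (π y.2)) v - expect (M.trans θ y.2 (π y.2)) v) ≤
      vbar * (atypical M L x θ + atypical M L x θ') +
        vbar * expect (extLaw (M.trans θ) π x m) fun y =>
          bonus ep L (y.path (π y.2)) (startTime ep k + m) := by
    intro m hm
    rw [← expect_const_mul, ← expect_const (extLaw (M.trans θ) π x m)
      (vbar * (atypical M L x θ + atypical M L x θ')), ← expect_add]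
    refine expect_mono_of_support _ fun y hy => ?_
    have hle : expect (M.trans θ' y.2 (π y.2)) v - expect (M.trans θ y.2 (π y.2)) v ≤ vbar := by
      linarith [expect_le_add_expect (M.trans θ' y.2 (π y.2)) (M.trans θ y.2 (π y.2))
        (f := v) (g := v) (hspan θ')]
    have hb := mul_nonneg hv0 (bonus_nonneg ep L (y.path (π y.2)) (startTime ep k + m))
    have ha := mul_nonneg hv0 (atypical_nonneg (M := M) L x θ)
    have ha' := mul_nonneg hv0 (atypical_nonneg (M := M) L x θ')
    by_cases hc : Consistent (M.trans θ) L x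
    swap
    · have : atypical M L x θ = 1 := if_neg hc
      rw [this] at ha ⊢
      linarith
    by_cases hc' : Consistent (M.trans θ') L x
    swap
    · have : atypical M L x θ' = 1 := if_neg hc'
      rw [this] at ha' ⊢
      linarith
    by_cases hd : HasDoubled ep (y.path (π y.2)) (startTime ep k + m)
    · have : bonus ep L (y.path (π y.2)) (startTime ep k + m) = 1 := if_pos hd
      rw [this]
      linarith
    · have hepk : episodeAt ep (startTime ep k + m) = k :=
        episodeAt_eq hep (Nat.le_add_right _ _) (by
          rw [startTime_succ ep hk]
          have := Finset.mem_range.1 hm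
          omega)
      have hcount : visitCount (y.path (π y.2)) (startTime ep k) (y.2, π y.2) =
          pairCount x (y.2, π y.2) := by
        rw [← visitCount_path x (π y.2)]
        exact visitCount_congr (path_eq_of_extLaw_ne_zero hy _ _) _
      have hbonus : bonus ep L (y.path (π y.2)) (startTime ep k + m) =
          √(2 * Fintype.card S * L * (pairCount x (y.2, π y.2) : ℝ)⁻¹) := by
        rw [bonus, if_neg hd, hepk, History.path_self, hcount]
      rw [HasDoubled, hepk, History.path_self, hcount] at hd
      have := expect_sub_expect_le_of_consistent hc hc' (p := (y.2, π y.2)) (by omega) hv0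
        (hspan θ')
      rw [hbonus]
      have h0 := mul_nonneg hv0 (add_nonneg (atypical_nonneg (M := M) L x θ)
        (atypical_nonneg (M := M) L x θ'))
      linarith
  refine (Finset.sum_le_sum h3).trans_eq ?_
  rw [Finset.sum_add_distrib, Finset.sum_const, Finset.card_range, nsmul_eq_mul, ← Finset.mul_sum]
  rfl

variable (μ₀ : Measure Θ) [IsProbabilityMeasure μ₀] {β : ℝ} {sbar : S} {N : ℕ}

/-- The accumulated gaps over an episode, in terms of the mismatch probability, the probability
that the trajectory is atypical, and the bonuses. -/
lemma sum_jointExpect_gap_le (hep : ∀ k, 1 ≤ k → 1 ≤ ep k) {k n : ℕ} (hk : 1 ≤ k) (hn : n ≤ ep k)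
    (L : ℝ) :
    ∑ m ∈ Finset.range n, jointExpect O μ₀ β sbar ep (startTime ep k + m)
        (fun θ (_ : History S A N) y => M.gap sref θ y.1.2 (y.2 y.1.2)) ≤
      2 * vbar * jointExpect O μ₀ β sbar ep (startTime ep k)
          (fun θ (_ : History S A N) y => mismatch O θ y.2) +
        2 * (n * vbar) * jointExpect O μ₀ β sbar ep (startTime ep k)
          (fun θ (_ : History S A N) y => atypical M L y.1 θ) +
        vbar * ∑ m ∈ Finset.range n, jointExpect O μ₀ β sbar ep (startTime ep k + m)
          (fun θ (_ : History S A N) y => mismatch O θ y.2 *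
            bonus ep L (y.1.path (y.2 y.1.2)) (startTime ep k + m)) := by
  obtain ⟨θ₀⟩ := nonempty_of_isProbabilityMeasure μ₀
  have hv0 : 0 ≤ vbar := by simpa using hspan θ₀ sref sref
  have hgain := Model.bddMeasurable_gain (M := M) sref
  have hgap := Model.bddMeasurable_gap sref hM hspan
  have hmis := bddMeasurable_mismatch O
  have step (m : ℕ) (hm : m ∈ Finset.range n)
      (g : Θ → History S A (startTime ep k + m) × (S → A) → ℝ) :
      jointExpect O μ₀ β sbar ep (startTime ep k + m) (fun θ (_ : History S A N) y => g θ y) =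
      jointExpect O μ₀ β sbar ep (startTime ep k) (fun θ (_ : History S A N) y =>
        expect (extLaw (M.trans θ) y.2 y.1 m) fun x => g θ (x, y.2)) := by
    simp only [jointExpect, condExpect,
      expect_runLaw_episode O μ₀ β ep _ hep _ hk ((Finset.mem_range.1 hm).trans_le hn)]
  have hL : ∑ m ∈ Finset.range n, jointExpect O μ₀ β sbar ep (startTime ep k + m)
        (fun θ (_ : History S A N) y => M.gap sref θ y.1.2 (y.2 y.1.2)) ≤
      jointExpect O μ₀ β sbar ep (startTime ep k) (fun θ (_ : History S A N) y =>
        mismatch O θ y.2 * (n * M.gain sref θ - rewardSum M n y.1 θ y.2 + vbar)) := by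
    have hb (m : ℕ) (y : History S A (startTime ep k) × (S → A)) : BddMeasurable fun θ =>
        expect (extLaw (M.trans θ) y.2 y.1 m) fun x => M.gap sref θ x.2 (y.2 x.2) :=
      .expect (measurable_extLaw M.measurable_trans _ _ _) fun x => hgap _ _
    rw [Finset.sum_congr rfl fun m hm => step m hm fun θ y => M.gap sref θ y.1.2 (y.2 y.1.2),
      ← jointExpect_sum μ₀ hM _ fun m _ D y => hb m y]
    refine jointExpect_mono μ₀ hM (fun D y => .sum _ fun m _ => hb m y) (fun D y => ?_)
      fun θ D y => sum_gap_le O hspan hM n y.1 θ y.2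
    exact (hmis _).mul (((hgain.const_mul _).sub (bddMeasurable_rewardSum n _ _)).add (.const _))
  have hR : ∑ m ∈ Finset.range n, jointExpect O μ₀ β sbar ep (startTime ep k + m)
          (fun θ (_ : History S A N) y => mismatch O θ y.2 *
            bonus ep L (y.1.path (y.2 y.1.2)) (startTime ep k + m)) =
      jointExpect O μ₀ β sbar ep (startTime ep k) (fun θ (_ : History S A N) y =>
        mismatch O θ y.2 * bonusSum M ep L n y.1 θ y.2) := by
    rw [Finset.sum_congr rfl fun m hm => step m hm fun θ y => mismatch O θ y.2 *
      bonus ep L (y.1.path (y.2 y.1.2)) (startTime ep k + m)]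
    simp only [expect_const_mul]
    rw [← jointExpect_sum (N := N) μ₀ hM (Finset.range n) (g := fun m θ _ y => mismatch O θ y.2 *
        expect (extLaw (M.trans θ) y.2 y.1 m) fun x =>
          bonus ep L (x.path (y.2 x.2)) (startTime ep k + m)) fun m _ D y => (hmis _).mul
      (.expect (measurable_extLaw M.measurable_trans _ _ _) fun x => .const _)]
    simp only [← Finset.mul_sum]
    rfl
  refine hL.trans ?_
  rw [hR]
  obtain ⟨w, hw, hrep⟩ := exists_jointExpect_eq (N := N) O μ₀ β sbar ep hM hep hk
  have hbs := bddMeasurable_bonusSum (M := M) ep L n (t := startTime ep k)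
  have hrs := bddMeasurable_rewardSum (M := M) n (t := startTime ep k)
  have hat := bddMeasurable_atypical (M := M) L (t := startTime ep k)
  rw [hrep _ fun D y => (hmis _).mul (((hgain.const_mul _).sub (hrs _ _)).add (.const _)),
    hrep _ fun D y => hmis _, hrep _ fun D y => hat _,
    hrep _ fun D y => (hmis _).mul (hbs _ _)]
  simp only [Finset.mul_sum (s := Finset.univ), ← Finset.sum_add_distrib]
  refine Finset.sum_le_sum fun D _ => Finset.sum_le_sum fun x _ => ?_
  set μ := M.posterior μ₀ sref β ep D x k
  have bm : BddMeasurable fun p : Θ × Θ => mismatch O p.1 (O.solve p.2) :=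
    .of_solve_comp (O := O) measurable_snd (F := fun π p => mismatch O p.1 π)
      fun π => (hmis π).comp measurable_fst
  have brs : BddMeasurable fun p : Θ × Θ => rewardSum M n x p.1 (O.solve p.2) :=
    .of_solve_comp (O := O) measurable_snd (F := fun π p => rewardSum M n x p.1 π)
      fun π => (hrs x π).comp measurable_fst
  have bbs : BddMeasurable fun p : Θ × Θ => bonusSum M ep L n x p.1 (O.solve p.2) :=
    .of_solve_comp (O := O) measurable_snd (F := fun π p => bonusSum M ep L n x p.1 π)
      fun π => (hbs x π).comp measurable_fst
  have bg1 : BddMeasurable fun p : Θ × Θ => M.gain sref p.1 := hgain.comp measurable_fst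
  have bg2 : BddMeasurable fun p : Θ × Θ => M.gain sref p.2 := hgain.comp measurable_snd
  have ba1 : BddMeasurable fun p : Θ × Θ => atypical M L x p.1 := (hat x).comp measurable_fst
  have ba2 : BddMeasurable fun p : Θ × Θ => atypical M L x p.2 := (hat x).comp measurable_snd
  -- Exchange of θ^* and θ̃: the mismatch is symmetric, so only the gain changes its argument, while
  -- the reward keeps its roles.
  have hswap : ∫ p : Θ × Θ, mismatch O p.1 (O.solve p.2) * M.gain sref p.1 ∂(μ.prod μ) =
      ∫ p : Θ × Θ, mismatch O p.1 (O.solve p.2) * M.gain sref p.2 ∂(μ.prod μ) := by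
    rw [← integral_prod_swap]
    refine integral_congr_ae (Eventually.of_forall fun p => ?_)
    simp only [Prod.fst_swap, Prod.snd_swap]
    rw [mismatch_solve_comm]
  have hswap' : ∫ p : Θ × Θ, atypical M L x p.2 ∂(μ.prod μ) =
      ∫ p : Θ × Θ, atypical M L x p.1 ∂(μ.prod μ) :=
    integral_prod_swap (μ := μ) (ν := μ) fun p => atypical M L x p.1
  have h1 : ∫ p : Θ × Θ, mismatch O p.1 (O.solve p.2) *
        (n * M.gain sref p.1 - rewardSum M n x p.1 (O.solve p.2) + vbar) ∂(μ.prod μ) =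
      ∫ p : Θ × Θ, mismatch O p.1 (O.solve p.2) *
        (n * M.gain sref p.2 - rewardSum M n x p.1 (O.solve p.2) + vbar) ∂(μ.prod μ) := by
    have e (i : Θ × Θ → ℝ) (p : Θ × Θ) : mismatch O p.1 (O.solve p.2) *
        (n * i p - rewardSum M n x p.1 (O.solve p.2) + vbar) =
        n * (mismatch O p.1 (O.solve p.2) * i p) + mismatch O p.1 (O.solve p.2) *
          (vbar - rewardSum M n x p.1 (O.solve p.2)) := by ring
    rw [integral_congr_ae (Eventually.of_forall fun p => e (fun p => M.gain sref p.1) p),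
      integral_congr_ae (Eventually.of_forall fun p => e (fun p => M.gain sref p.2) p),
      integral_add (((bm.mul bg1).const_mul _).integrable _)
        ((bm.mul ((BddMeasurable.const _).sub brs)).integrable _),
      integral_add (((bm.mul bg2).const_mul _).integrable _)
        ((bm.mul ((BddMeasurable.const _).sub brs)).integrable _),
      integral_const_mul, integral_const_mul, hswap]
  -- The mismatch factor is kept on the span and the bonus, where ε is needed, and bounded by 1 on
  -- the atypical terms.
  have h2 : ∫ p : Θ × Θ, mismatch O p.1 (O.solve p.2) *
        (n * M.gain sref p.2 - rewardSum M n x p.1 (O.solve p.2) + vbar) ∂(μ.prod μ) ≤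
      ∫ p : Θ × Θ, (2 * vbar * mismatch O p.1 (O.solve p.2) +
        n * vbar * (atypical M L x p.1 + atypical M L x p.2) +
        vbar * (mismatch O p.1 (O.solve p.2) * bonusSum M ep L n x p.1 (O.solve p.2)))
        ∂(μ.prod μ) := by
    refine integral_mono
      ((bm.mul (((bg2.const_mul _).sub brs).add (.const _))).integrable _)
      ((((bm.const_mul _).add ((ba1.add ba2).const_mul _)).add
        ((bm.mul bbs).const_mul _)).integrable _) fun p => ?_
    have hg := gain_sub_rewardSum_le O hspan hM hep hk hn L x p.1 p.2
    have hm0 := mismatch_nonneg O p.1 (O.solve p.2)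
    have hm1 := mismatch_le_one O p.1 (O.solve p.2)
    have ha : 0 ≤ n * (vbar * (atypical M L x p.1 + atypical M L x p.2)) :=
      mul_nonneg n.cast_nonneg (mul_nonneg hv0
        (add_nonneg (atypical_nonneg L x p.1) (atypical_nonneg L x p.2)))
    have h3 := mul_le_mul_of_nonneg_left hg hm0
    have h4 := mul_le_mul_of_nonneg_right hm1 ha
    dsimp only
    linarith
  have h3 : ∫ p : Θ × Θ, (2 * vbar * mismatch O p.1 (O.solve p.2) +
        n * vbar * (atypical M L x p.1 + atypical M L x p.2) +
        vbar * (mismatch O p.1 (O.solve p.2) * bonusSum M ep L n x p.1 (O.solve p.2)))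
        ∂(μ.prod μ) =
      2 * vbar * ∫ p : Θ × Θ, mismatch O p.1 (O.solve p.2) ∂(μ.prod μ) +
      2 * (n * vbar) * ∫ p : Θ × Θ, atypical M L x p.1 ∂(μ.prod μ) +
      vbar * ∫ p : Θ × Θ, mismatch O p.1 (O.solve p.2) *
        bonusSum M ep L n x p.1 (O.solve p.2) ∂(μ.prod μ) := by
    rw [integral_add (((bm.const_mul _).add ((ba1.add ba2).const_mul _)).integrable _)
        (((bm.mul bbs).const_mul _).integrable _),
      integral_add ((bm.const_mul _).integrable _) (((ba1.add ba2).const_mul _).integrable _),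
      integral_const_mul, integral_const_mul, integral_const_mul,
      integral_add (ba1.integrable _) (ba2.integrable _), hswap']
    ring
  have h4 := mul_le_mul_of_nonneg_left (h2.trans_eq h3) (hw D x)
  rw [← h1] at h4
  linarith

omit hspan in
lemma jointExpect_atypical_le {k K T : ℕ} (hK : 1 ≤ K) (hT : 1 ≤ T) (hk : startTime ep k ≤ T) :
    jointExpect O μ₀ β sbar ep (startTime ep k) (fun θ (_ : History S A N) y =>
      atypical M (Real.log (2 * Fintype.card S * Fintype.card A * K * T)) y.1 θ) ≤
      1 / (T : ℝ) := by
  calc _ ≤ ∫ _θ, 1 / (T : ℝ) ∂μ₀ := by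
        refine integral_mono ((bddMeasurable_condExpect μ₀ hM
          fun D y => bddMeasurable_atypical _ _).integrable μ₀) (integrable_const _) fun θ => ?_
        exact expect_le_const _ fun D => expect_not_consistent_le O μ₀ β ep D θ hK hT hk
    _ = 1 / (T : ℝ) := by simp

end Episode

/-! ### The Bayesian regret -/

section BayesRegret

variable {S A Θ : Type*} [Fintype S] [DecidableEq S] [Fintype A] [Nonempty A] [MeasurableSpace Θ]
  {M : Model S A Θ} {sref : S} (O : PlanningOracle M sref) (μ₀ : Measure Θ)
  [IsProbabilityMeasure μ₀] {β : ℝ} {sbar : S} {N : ℕ} {ep : ℕ → ℕ}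
  (hM : ∀ θ, Communicating (M.trans θ)) (hep : ∀ k, 1 ≤ k → 1 ≤ ep k)

include hM hep

lemma jointExpect_mismatch_le (t : ℕ) :
    jointExpect O μ₀ β sbar ep t (fun θ (_ : History S A N) y => mismatch O θ y.2) ≤
      initialMismatch O μ₀ β sbar N := by
  have hk : 1 ≤ episodeAt ep t := one_le_numEpisodes hep (Nat.le_add_left 1 t)
  have h1 : startTime ep (episodeAt ep t) < t + 1 :=
    startTime_numEpisodes_lt hep (Nat.le_add_left 1 t)
  have h2 : ¬ startTime ep (episodeAt ep t + 1) < t + 1 := fun h =>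
    absurd ((le_numEpisodes_iff hep (Nat.le_add_left 1 t)).2 h) (by unfold episodeAt; omega)
  rw [startTime_succ ep hk] at h2
  obtain ⟨m, hm⟩ := Nat.exists_eq_add_of_le (Nat.lt_succ_iff.1 h1)
  have := jointExpect_mismatch_episode_le (N := N) (β := β) (sbar := sbar) O μ₀ hM hep hk
    (m := m) (by omega)
  rwa [← hm] at this

-- Doubling and the frozen count at time t depend only on the path up to t, as
-- `sum_jointExpect_path_le` requires.
omit hM in
lemma hasDoubled_congr {ι : Type*} {z z' : ℕ → ι} {t : ℕ} (h : ∀ i ≤ t, z i = z' i) :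
    (HasDoubled ep z t ↔ HasDoubled ep z' t) ∧
      visitCount z (startTime ep (episodeAt ep t)) (z t) =
        visitCount z' (startTime ep (episodeAt ep t)) (z' t) := by
  have h1 : startTime ep (episodeAt ep t) < t + 1 :=
    startTime_numEpisodes_lt hep (Nat.le_add_left 1 t)
  have e1 : visitCount z (startTime ep (episodeAt ep t)) (z t) =
      visitCount z' (startTime ep (episodeAt ep t)) (z' t) := by
    rw [h t le_rfl]
    exact visitCount_congr (fun i hi => h i (by omega)) _
  have e2 : visitCount z t (z t) = visitCount z' t (z' t) := by
    rw [h t le_rfl]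
    exact visitCount_congr (fun i hi => h i hi.le) _
  exact ⟨by rw [HasDoubled, HasDoubled, e1, e2], e1⟩

/-- The accumulated bonus during episodes with a mismatch. -/
lemma sum_jointExpect_mismatch_mul_bonus_le {T : ℕ} (hT : 1 ≤ T) {L : ℝ} (hL : 0 ≤ L) :
    ∑ t ∈ Finset.range T, jointExpect O μ₀ β sbar ep t (fun θ (_ : History S A N) y =>
        mismatch O θ y.2 * bonus ep L (y.1.path (y.2 y.1.2)) t) ≤
      min (initialMismatch O μ₀ β sbar N * T)
        (Fintype.card (S × A) * ((Finset.Icc 1 (numEpisodes ep T)).sup ep : ℕ) *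
          Real.logb 2 (T / Fintype.card (S × A) + 1)) +
      √(initialMismatch O μ₀ β sbar N * T * (2 * Fintype.card S * L *
        (2 * (Fintype.card (S × A) * (1 + Real.log (T / Fintype.card (S × A) + 1)))))) := by
  classical
  have : Nonempty (S × A) := ⟨(sref, Classical.arbitrary A)⟩
  let dbl (z : ℕ → S × A) (t : ℕ) : ℝ := if HasDoubled ep z t then 1 else 0
  let inv (z : ℕ → S × A) (t : ℕ) : ℝ := if HasDoubled ep z t then 0 else
    (visitCount z (startTime ep (episodeAt ep t)) (z t) : ℝ)⁻¹
  let b (z : ℕ → S × A) (t : ℕ) : ℝ := √(2 * Fintype.card S * L * inv z t)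
  have hinv0 (z t) : 0 ≤ inv z t := by
    simp only [inv]
    split_ifs <;> positivity
  have hdbl0 (z t) : 0 ≤ dbl z t := by
    simp only [dbl]
    split_ifs <;> norm_num
  have hdbl1 (z t) : dbl z t ≤ 1 := by
    simp only [dbl]
    split_ifs <;> norm_num
  have hbsq (z t) : b z t ^ 2 = 2 * Fintype.card S * L * inv z t :=
    Real.sq_sqrt (mul_nonneg (by positivity) (hinv0 z t))
  have hbonus (z t) : bonus ep L z t = dbl z t + b z t := by
    simp only [bonus, dbl, b, inv]
    split_ifs <;> simp
  have hmis := bddMeasurable_mismatch O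
  set ε := initialMismatch O μ₀ β sbar N
  let Emis (t : ℕ) : ℝ := jointExpect O μ₀ β sbar ep t
    (fun θ (_ : History S A N) y => mismatch O θ y.2)
  let E1 (t : ℕ) : ℝ := jointExpect O μ₀ β sbar ep t (fun θ (_ : History S A N) y =>
    mismatch O θ y.2 * dbl (y.1.path (y.2 y.1.2)) t)
  let E2 (t : ℕ) : ℝ := jointExpect O μ₀ β sbar ep t (fun θ (_ : History S A N) y =>
    mismatch O θ y.2 * b (y.1.path (y.2 y.1.2)) t)
  let E3 (t : ℕ) : ℝ := jointExpect O μ₀ β sbar ep t (fun _ (_ : History S A N) y =>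
    inv (y.1.path (y.2 y.1.2)) t)
  have hX : ∑ t ∈ Finset.range T, Emis t ≤ ε * T := by
    refine (Finset.sum_le_sum fun t _ => jointExpect_mismatch_le O μ₀ hM hep t).trans_eq ?_
    rw [Finset.sum_const, Finset.card_range, nsmul_eq_mul, mul_comm]
  have hY : ∑ t ∈ Finset.range T, E3 t ≤
      2 * (Fintype.card (S × A) * (1 + Real.log (T / Fintype.card (S × A) + 1))) := by
    refine sum_jointExpect_path_le μ₀ hM (g := inv) (fun z z' t h => ?_)
      fun z => sum_not_hasDoubled_le ep T z
    obtain ⟨h1, h2⟩ := hasDoubled_congr hep h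
    simp only [inv, h1, h2]
  have hsplit (t : ℕ) : jointExpect O μ₀ β sbar ep t (fun θ (_ : History S A N) y =>
      mismatch O θ y.2 * bonus ep L (y.1.path (y.2 y.1.2)) t) = E1 t + E2 t := by
    simp only [hbonus, mul_add]
    exact jointExpect_add μ₀ hM (fun D y => (hmis _).mul (.const _))
      fun D y => (hmis _).mul (.const _)
  rw [Finset.sum_congr rfl fun t _ => hsplit t, Finset.sum_add_distrib]
  -- At doubled times the bonus is 1, so their share is bounded both by the number of mismatched
  -- steps and by the number of doubled times.
  refine add_le_add (le_min ?_ ?_) ?_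
  · refine le_trans (Finset.sum_le_sum fun t _ => ?_) hX
    exact jointExpect_mono μ₀ hM (fun D y => (hmis _).mul (.const _)) (fun D y => hmis _)
      fun θ D y => mul_le_of_le_one_right (mismatch_nonneg O _ _) (hdbl1 _ _)
  · calc _ ≤ ∑ t ∈ Finset.range T, jointExpect O μ₀ β sbar ep t
          (fun _ (_ : History S A N) y => dbl (y.1.path (y.2 y.1.2)) t) :=
          Finset.sum_le_sum fun t _ => jointExpect_mono μ₀ hM
            (fun D y => (hmis _).mul (.const _)) (fun D y => .const _)
            fun θ D y => mul_le_of_le_one_left (hdbl0 _ _) (mismatch_le_one O _ _)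
      _ ≤ _ := by
          refine sum_jointExpect_path_le μ₀ hM (g := dbl) (fun z z' t h => ?_)
            fun z => sum_hasDoubled_le hep hT z
          simp only [dbl, (hasDoubled_congr hep h).1]
  · set X := ∑ t ∈ Finset.range T, Emis t
    set Z := ∑ t ∈ Finset.range T, E2 t
    set Y := ∑ t ∈ Finset.range T, E3 t
    have hX0 : 0 ≤ X := Finset.sum_nonneg fun t _ =>
      jointExpect_nonneg μ₀ fun θ D y => mismatch_nonneg O _ _
    have hY0 : 0 ≤ Y := Finset.sum_nonneg fun t _ => jointExpect_nonneg μ₀ fun θ D y => hinv0 _ _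
    -- Cauchy–Schwarz over the joint law and time through a discriminant; the mismatch indicator
    -- equals its square, so the leading coefficient X is at most εT.
    have hquad (l : ℝ) : 0 ≤ X * (l * l) + (-2 * Z) * l + 2 * Fintype.card S * L * Y := by
      have h (t : ℕ) : 0 ≤ l * l * Emis t + ((-2 * l) * E2 t + 2 * Fintype.card S * L * E3 t) := by
        have : l * l * Emis t + ((-2 * l) * E2 t + 2 * Fintype.card S * L * E3 t) =
            jointExpect O μ₀ β sbar ep t (fun θ (_ : History S A N) y =>
              l * l * mismatch O θ y.2 +
                ((-2 * l) * (mismatch O θ y.2 * b (y.1.path (y.2 y.1.2)) t) +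
                  2 * Fintype.card S * L * inv (y.1.path (y.2 y.1.2)) t)) := by
          have hb1 (y : History S A t × (S → A)) : BddMeasurable fun θ =>
              (-2 * l) * (mismatch O θ y.2 * b (y.1.path (y.2 y.1.2)) t) :=
            ((hmis _).mul (.const _)).const_mul _
          rw [jointExpect_add μ₀ hM (fun D y => (hmis _).const_mul _)
            (fun D y => (hb1 y).add (.const _)),
            jointExpect_add μ₀ hM (h := fun _ _ y =>
              2 * Fintype.card S * L * inv (y.1.path (y.2 y.1.2)) t) (fun D y => hb1 y)
              (fun D y => .const _),
            jointExpect_const_mul, jointExpect_const_mul, jointExpect_const_mul]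
        rw [this]
        refine jointExpect_nonneg μ₀ fun θ D y => ?_
        rw [← hbsq]
        calc (0 : ℝ) ≤ (mismatch O θ y.2 * l - b (y.1.path (y.2 y.1.2)) t) ^ 2 := sq_nonneg _
          _ = l * l * (mismatch O θ y.2 * mismatch O θ y.2) +
                ((-2 * l) * (mismatch O θ y.2 * b (y.1.path (y.2 y.1.2)) t) +
                  b (y.1.path (y.2 y.1.2)) t ^ 2) := by ring
          _ = _ := by rw [mismatch_mul_self]
      have := Finset.sum_nonneg fun t (_ : t ∈ Finset.range T) => h t
      simp only [Finset.sum_add_distrib, ← Finset.mul_sum] at this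
      linarith
    have hdisc := discrim_le_zero hquad
    rw [discrim] at hdisc
    refine Real.le_sqrt_of_sq_le ?_
    calc Z ^ 2 ≤ X * (2 * Fintype.card S * L * Y) := by linarith
      _ ≤ _ := mul_le_mul hX (mul_le_mul_of_nonneg_left hY (by positivity)) (by positivity)
          (hX0.trans hX)

omit hep in
lemma integrable_regret (T : ℕ) : Integrable (regret O μ₀ β sbar N ep T) μ₀ := by
  have : BddMeasurable (regret O μ₀ β sbar N ep T) := by
    have h : regret O μ₀ β sbar N ep T = fun θ => T * M.gain sref θ - ∑ t ∈ Finset.range T,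
        condExpect O μ₀ β sbar ep t θ
          (fun (_ : History S A N) y => M.reward y.1.2 (y.2 y.1.2)) :=
      funext fun θ => regret_eq O μ₀ β sbar ep T θ
    rw [h]
    exact ((Model.bddMeasurable_gain sref).const_mul _).sub
      (.sum _ fun t _ => bddMeasurable_condExpect μ₀ hM fun D y => .const _)
  exact this.integrable μ₀

variable {vbar : ℝ} (hspan : ∀ θ s s', M.value sref θ s - M.value sref θ s' ≤ vbar)

include hspan

omit hep in
lemma bayesRegret_le (T : ℕ) :
    bayesRegret O μ₀ β sbar N ep T ≤ vbar + ∑ t ∈ Finset.range T,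
      jointExpect O μ₀ β sbar ep t
        (fun θ (_ : History S A N) y => M.gap sref θ y.1.2 (y.2 y.1.2)) := by
  have hb (t : ℕ) : BddMeasurable fun θ => condExpect O μ₀ β sbar ep t θ
      (fun (_ : History S A N) y => M.gap sref θ y.1.2 (y.2 y.1.2)) :=
    bddMeasurable_condExpect μ₀ hM fun D y => Model.bddMeasurable_gap sref hM hspan _ _
  unfold jointExpect
  rw [← integral_finsetSum _ fun t _ => (hb t).integrable μ₀]
  have hv : vbar = ∫ _θ : Θ, vbar ∂μ₀ := by simp
  nth_rewrite 1 [hv]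
  rw [← integral_add (integrable_const _) ((BddMeasurable.sum _ fun t _ => hb t).integrable μ₀)]
  exact integral_mono (integrable_regret O μ₀ hM T)
    (((BddMeasurable.const _).add (.sum _ fun t _ => hb t)).integrable μ₀)
    fun θ => regret_le O μ₀ β sbar ep hspan T θ

/-- The accumulated gaps, in terms of the accumulated bonus. -/
lemma sum_jointExpect_gap_le_bonus {T : ℕ} (hT : 1 ≤ T) :
    ∑ t ∈ Finset.range T, jointExpect O μ₀ β sbar ep t
        (fun θ (_ : History S A N) y => M.gap sref θ y.1.2 (y.2 y.1.2)) ≤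
      2 * vbar * (initialMismatch O μ₀ β sbar N * numEpisodes ep T) + 2 * vbar +
        vbar * ∑ t ∈ Finset.range T, jointExpect O μ₀ β sbar ep t
          (fun θ (_ : History S A N) y => mismatch O θ y.2 * bonus ep
            (Real.log (2 * Fintype.card S * Fintype.card A * numEpisodes ep T * T))
            (y.1.path (y.2 y.1.2)) t) := by
  obtain ⟨θ₀⟩ := nonempty_of_isProbabilityMeasure μ₀
  have hv0 : 0 ≤ vbar := by simpa using hspan θ₀ sref sref
  set L := Real.log (2 * Fintype.card S * Fintype.card A * numEpisodes ep T * T)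
  have hT' : (0 : ℝ) < T := by exact_mod_cast hT
  set ε := initialMismatch O μ₀ β sbar N
  let len (k : ℕ) : ℕ := min (ep k) (T - startTime ep k)
  -- The lengths truncated at T add up to T, so the atypical terms, of probability 1/T each, cost
  -- 2v̄ in all.
  have hlen : ∑ k ∈ Finset.Icc 1 (numEpisodes ep T), (len k : ℝ) = T := by
    have := sum_range_eq_sum_episodes hep hT fun _ => (1 : ℝ)
    simpa [len] using this.symm
  rw [sum_range_eq_sum_episodes hep hT, sum_range_eq_sum_episodes hep hT, Finset.mul_sum]
  calc _ ≤ ∑ k ∈ Finset.Icc 1 (numEpisodes ep T), (2 * vbar * ε + 2 * (len k * vbar) * (1 / T) +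
          vbar * ∑ m ∈ Finset.range (len k), jointExpect O μ₀ β sbar ep (startTime ep k + m)
            (fun θ (_ : History S A N) y => mismatch O θ y.2 *
              bonus ep L (y.1.path (y.2 y.1.2)) (startTime ep k + m))) := by
        refine Finset.sum_le_sum fun k hk => ?_
        obtain ⟨hk1, hk2⟩ := Finset.mem_Icc.1 hk
        have hkT := (le_numEpisodes_iff hep hT).1 hk2
        refine (sum_jointExpect_gap_le O hspan hM μ₀ hep hk1 (min_le_left _ _) L).trans ?_
        gcongr
        · exact jointExpect_mismatch_start_le O μ₀ hM hep hk1
        · exact jointExpect_atypical_le O hM μ₀ (one_le_numEpisodes hep hT) hT hkT.le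
    _ = _ := by
        rw [Finset.sum_add_distrib, Finset.sum_add_distrib, Finset.sum_const, Nat.card_Icc,
          Nat.add_sub_cancel, nsmul_eq_mul]
        have : ∑ k ∈ Finset.Icc 1 (numEpisodes ep T), 2 * (len k * vbar) * (1 / T) =
            2 * vbar * (1 / T) * ∑ k ∈ Finset.Icc 1 (numEpisodes ep T), (len k : ℝ) := by
          rw [Finset.mul_sum]
          exact Finset.sum_congr rfl fun k _ => by ring
        rw [this, hlen, mul_assoc (2 * vbar) (1 / (T : ℝ)), one_div_mul_cancel hT'.ne']
        ring

end BayesRegret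

end InfPSRL

end

/-! ### Assembly of the regret bound -/

theorem theorem1 {S A Θ : Type*} [Fintype S] [DecidableEq S] [Fintype A] [Nonempty A]
    [MeasurableSpace Θ] (M : InfPSRL.Model S A Θ)
    (μ₀ : MeasureTheory.Measure Θ) [MeasureTheory.IsProbabilityMeasure μ₀]
    (sref : S) (O : InfPSRL.PlanningOracle M sref)
    (β : ℝ) (hβ : 0 < β) (sbar : S) (N : ℕ)
    (ep : ℕ → ℕ) (hep : ∀ k, 1 ≤ k → 1 ≤ ep k)
    (hcomm : ∀ θ, InfPSRL.Communicating (M.trans θ))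
    (vbar : ℝ) (hspan : ∀ θ s s', M.value sref θ s - M.value sref θ s' ≤ vbar)
    (T : ℕ) (hT : 1 ≤ T) (ε R₁ R₂ R₃ nS nA K : ℝ)
    (hε : ε = InfPSRL.initialMismatch O μ₀ β sbar N)
    (hnS : nS = Fintype.card S) (hnA : nA = Fintype.card A)
    (hK : K = InfPSRL.numEpisodes ep T)
    (hR₁ : R₁ = ε * K)
    (hR₂ : R₂ = √(ε * nS ^ 2 * nA * T * Real.log (2 * nS * nA * K * T) *
      (1 + Real.log (T / (nS * nA) + 1))))
    (hR₃ : R₃ = min (ε * T) (nS * nA *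
      ((Finset.Icc 1 (InfPSRL.numEpisodes ep T)).sup ep : ℕ) *
      Real.logb 2 (T / (nS * nA) + 1))) :
    MeasureTheory.Integrable (InfPSRL.regret O μ₀ β sbar N ep T) μ₀ ∧
      InfPSRL.bayesRegret O μ₀ β sbar N ep T ≤ 3 * vbar + 2 * vbar * (R₁ + R₂ + R₃) := by
  obtain ⟨θ₀⟩ := MeasureTheory.nonempty_of_isProbabilityMeasure μ₀
  have hv0 : 0 ≤ vbar := by simpa using hspan θ₀ sref sref
  refine ⟨InfPSRL.integrable_regret O μ₀ hcomm T, ?_⟩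
  have h1 := InfPSRL.bayesRegret_le (N := N) (β := β) (sbar := sbar) (ep := ep) O μ₀ hcomm hspan T
  have h2 := InfPSRL.sum_jointExpect_gap_le_bonus (N := N) (β := β) (sbar := sbar) O μ₀ hcomm hep
    hspan hT
  have hS : (1 : ℝ) ≤ Fintype.card S := by exact_mod_cast Fintype.card_pos_iff.2 ⟨sref⟩
  have hA : (1 : ℝ) ≤ Fintype.card A := by exact_mod_cast Fintype.card_pos (α := A)
  have hK1 : (1 : ℝ) ≤ InfPSRL.numEpisodes ep T := by
    exact_mod_cast InfPSRL.one_le_numEpisodes hep hT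
  have hT1 : (1 : ℝ) ≤ T := by exact_mod_cast hT
  rw [← hnS] at hS
  rw [← hnA] at hA
  rw [← hK] at hK1
  rw [← hnS, ← hnA, ← hK, ← hε] at h2
  have hL : 0 ≤ Real.log (2 * nS * nA * K * T) := by
    refine Real.log_nonneg ?_
    have h3 : 1 ≤ nS * nA := one_le_mul_of_one_le_of_one_le hS hA
    have h4 : 1 ≤ nS * nA * K := one_le_mul_of_one_le_of_one_le h3 hK1
    have h5 : 1 ≤ nS * nA * K * T := one_le_mul_of_one_le_of_one_le h4 hT1
    linarith
  have h3 := InfPSRL.sum_jointExpect_mismatch_mul_bonus_le (N := N) (β := β) (sbar := sbar) O μ₀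
    hcomm hep hT hL
  have hcard : (Fintype.card (S × A) : ℝ) = nS * nA := by
    rw [Fintype.card_prod, Nat.cast_mul, hnS, hnA]
  rw [hcard, ← hnS, ← hε, ← hR₃] at h3
  -- One factor 2 comes from the width of the bonus and one from the frozen counts; together they
  -- leave the root as 2.
  have hsqrt : √(ε * T * (2 * nS * Real.log (2 * nS * nA * K * T) *
      (2 * (nS * nA * (1 + Real.log (T / (nS * nA) + 1)))))) = 2 * R₂ := by
    calc _ = √(2 ^ 2 * (ε * nS ^ 2 * nA * T * Real.log (2 * nS * nA * K * T) *
          (1 + Real.log (T / (nS * nA) + 1)))) := by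
          congr 1
          ring
      _ = 2 * R₂ := by rw [Real.sqrt_mul (by norm_num), Real.sqrt_sq zero_le_two, hR₂]
  rw [hsqrt] at h3
  -- The argument yields only v̄R₃; nonnegativity allows 2v̄R₃ in the common factor.
  have hR₃0 : 0 ≤ R₃ := by
    have hε0 : 0 ≤ ε := hε ▸ InfPSRL.initialMismatch_nonneg O μ₀
    rw [hR₃]
    refine le_min (by positivity) ?_
    have : 0 ≤ Real.logb 2 (T / (nS * nA) + 1) :=
      Real.logb_nonneg one_lt_two (by linarith [show 0 ≤ T / (nS * nA) by positivity])
    positivity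
  have h4 := mul_le_mul_of_nonneg_left h3 hv0
  have h5 := mul_nonneg hv0 hR₃0
  rw [hR₁]
  linarith
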